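/- Let $M$ be a closed connected smooth $3$-manifold, with a distance $d$ inducing its topology. A topological Anosov flow on $M$ is a continuous flow $\phi^t$, generated by a continuous nowhere vanishing vector field, that is expansive (for every $\varepsilon>0$ there is $\delta>0$ such that, if $x,y\in M$ and $s\colon\mathbb R\to\mathbb R$ is continuous with $s(0)=0$ and $d(\phi^t(x),\phi^{s(t)}(y))<\delta$ for all $t\in\mathbb R$, then $y=\phi^\tau(x)$ for some $|\tau|<\varepsilon$) and that preserves two topologically transverse two-dimensional continuous foliations, weak stable and weak unstable, such that the connected components of the intersections of their leaves are the orbits of the flow, and such that for any two points $x,y$ of the same weak stable (resp. weak unstable) leaf there is an increasing homeomorphism $\sigma$ of $\mathbb R$ with $d(\phi^t(x),\phi^{\sigma(t)}(y))\to0$ as $t\to+\infty$ (resp. $t\to-\infty$). A $C^\infty$ diffeomorphism $f\colon M\to M$ is partially hyperbolic if there is a continuous $Df$-invariant splitting $TM=E^s\oplus E^c\oplus E^u$ into line bundles such that, for some Riemannian metric and some $n\ge 1$, for all $x\in M$ and all unit vectors $v^\ast\in E^\ast_x$ ($\ast=s,c,u$), one has $\|Df^nv^s\|<1<\|Df^nv^u\|$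 and $\|Df^nv^s\|<\|Df^nv^c\|<\|Df^nv^u\|$. It is a discretized Anosov flow if moreover there are a topological Anosov flow $\phi^t$ on $M$ and a continuous function $h\colon M\to(0,\infty)$ with $f(x)=\phi^{h(x)}(x)$ for all $x\in M$. Let $f$ be a discretized Anosov flow on $M$, and let $\mathcal W^{cs}$, $\mathcal W^{cu}$ be $f$-invariant continuous foliations with $C^1$ leaves tangent to $E^s\oplus E^c$ and $E^c\oplus E^u$. The leaf $\mathcal W^c(x)$ of the center foliation through $x$ is the connected component containing $x$ of $\mathcal W^{cs}(x)\cap\mathcal W^{cu}(x)$. (Connected components of intersections of leaves are taken here for the topology of the leaves.) Then for every $C^1$ diffeomorphism $g$ of $M$ with $g\circ f=f\circ g$ and every closed (that is, compact) center leaf $\mathcal W^c(x)$, there exists an integer $k\ge1$ such that $$g^k\left(\mathcal W^c(x)\right)=\mathcal W^c(x).$$ -/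

import Mathlib

open Set Filter Topology
open scoped Manifold ContDiff

namespace DiscretizedAnosov

/-! ## Two-dimensional foliations of 3-manifolds -/

/-- A two-dimensional (`C^0`) foliation of a 3-manifold, given by a foliated atlas: charts onto
`ℝ² × ℝ` covering the manifold, whose changes of coordinates are locally of the form
`(u, t) ↦ (a (u, t), b t)`. -/
structure SurfaceFoliation (M : Type*) [TopologicalSpace M] where
  atlas : Set (OpenPartialHomeomorph M (EuclideanSpace ℝ (Fin 2) × ℝ))
  target_eq : ∀ e ∈ atlas, e.target = univ
  covers : ∀ x : M, ∃ e ∈ atlas, x ∈ e.source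
  compatible : ∀ e ∈ atlas, ∀ e' ∈ atlas, ∀ x ∈ e.source ∩ e'.source,
    ∃ V ∈ 𝓝 x, V ⊆ e.source ∩ e'.source ∧
      ∀ y ∈ V, ∀ z ∈ V, (e y).2 = (e z).2 → (e' y).2 = (e' z).2

namespace SurfaceFoliation

variable {M : Type*} [TopologicalSpace M]

/-- Two points lie in a common plaque `e⁻¹(ℝ² × {t})` of the foliated atlas. -/
def SamePlaque (F : SurfaceFoliation M) (x y : M) : Prop :=
  ∃ e ∈ F.atlas, x ∈ e.source ∧ y ∈ e.source ∧ (e x).2 = (e y).2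

/-- The leaf through `x`: all points that a finite chain of plaques connects to `x`. -/
def leaf (F : SurfaceFoliation M) (x : M) : Set M :=
  {y | Relation.EqvGen F.SamePlaque x y}

/-- Topological transversality: near every point the two transverse coordinates
of the foliations can be completed to a local system of topological coordinates. -/
def TopologicallyTransverse (F G : SurfaceFoliation M) : Prop :=
  ∀ a ∈ F.atlas, ∀ b ∈ G.atlas, ∀ x ∈ a.source ∩ b.source,
    ∃ e : OpenPartialHomeomorph M (ℝ × ℝ × ℝ),
      x ∈ e.source ∧ e.source ⊆ a.source ∩ b.source ∧
        ∀ y ∈ e.source, (e y).1 = (a y).2 ∧ (e y).2.1 = (b y).2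

/-- The leaf through `x` of the one-dimensional foliation by (path) components of the
intersections of leaves of `F` and `G`. A path of `M` inside a leaf is continuous for the topology
of the leaf (a leaf meets a chart in countably many plaques), so the components for the
topology of `M` and for the topology of the leaves are the same. -/
def interLeaf (F G : SurfaceFoliation M) (x : M) : Set M :=
  pathComponentIn (F.leaf x ∩ G.leaf x) x

end SurfaceFoliation

/-! ## Topological Anosov flows -/

/-- Expansivity of a flow in the sense of Bowen and Walters. -/
def IsExpansiveFlow {M : Type*} [MetricSpace M] (φ : Flow ℝ M) : Prop :=
  ∀ ε > 0, ∃ δ > 0, ∀ x y : M, ∀ s : ℝ → ℝ, Continuous s → s 0 = 0 →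
    (∀ t, dist (φ t x) (φ (s t) y) < δ) → ∃ τ : ℝ, |τ| < ε ∧ y = φ τ x

section Manifold

variable {M : Type*} [MetricSpace M] [ChartedSpace (EuclideanSpace ℝ (Fin 3)) M]
  [IsManifold (𝓡 3) ∞ M]

/-- A topological Anosov flow on a closed 3-manifold: a flow generated by a continuous nowhere
vanishing vector field, which is expansive and preserves two topologically transverse foliations
(weak stable and weak unstable), whose leaves intersect along the orbits, and such that orbits of
one weak stable (weak unstable) leaf are forward (backward) asymptotic up to an increasing
reparametrization. That the flow preserves each leaf follows from the
condition that the intersections are the orbits. -/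
structure IsTopologicalAnosovFlow (φ : Flow ℝ M) : Prop where
  exists_vectorField : ∃ X : ∀ x : M, TangentSpace (𝓡 3) x,
    Continuous (fun x ↦ (⟨x, X x⟩ : TangentBundle (𝓡 3) M)) ∧ (∀ x, X x ≠ 0) ∧
      ∀ x, IsMIntegralCurve (I := 𝓡 3) (fun t ↦ φ t x) X
  expansive : IsExpansiveFlow φ
  exists_weakFoliations : ∃ Fs Fu : SurfaceFoliation M,
    Fs.TopologicallyTransverse Fu ∧
    (∀ x, Fs.interLeaf Fu x = φ.orbit x) ∧
    (∀ x, ∀ y ∈ Fs.leaf x, ∃ σ : ℝ ≃o ℝ,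
      Tendsto (fun t ↦ dist (φ t x) (φ (σ t) y)) atTop (𝓝 0)) ∧
    (∀ x, ∀ y ∈ Fu.leaf x, ∃ σ : ℝ ≃o ℝ,
      Tendsto (fun t ↦ dist (φ t x) (φ (σ t) y)) atBot (𝓝 0))

/-! ## Partially hyperbolic diffeomorphisms -/

/-- A continuous line field (one-dimensional continuous subbundle of `TM`). -/
def IsContinuousLineField (L : ∀ x : M, Submodule ℝ (TangentSpace (𝓡 3) x)) : Prop :=
  ∀ x : M, ∃ U ∈ 𝓝 x, ∃ v : ∀ y : M, TangentSpace (𝓡 3) y,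
    ContinuousOn (fun y ↦ (⟨y, v y⟩ : TangentBundle (𝓡 3) M)) U ∧
      ∀ y ∈ U, v y ≠ 0 ∧ L y = Submodule.span ℝ {v y}

/-- Smooth Riemannian metrics on `M`. -/
abbrev RiemMetric (M : Type*) [MetricSpace M] [ChartedSpace (EuclideanSpace ℝ (Fin 3)) M]
    [IsManifold (𝓡 3) ∞ M] :=
  Bundle.ContMDiffRiemannianMetric (𝓡 3) ∞ (EuclideanSpace ℝ (Fin 3))
    (fun x : M ↦ TangentSpace (𝓡 3) x)

/-- The norm of a tangent vector for a Riemannian metric. -/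
noncomputable def RiemMetric.length (ρ : RiemMetric M) {x : M} (v : TangentSpace (𝓡 3) x) : ℝ :=
  Real.sqrt (ρ.inner x v v)

/-- A partially hyperbolic splitting of a diffeomorphism of a 3-manifold: a continuous
`Df`-invariant splitting `TM = Es ⊕ Ec ⊕ Eu` into line fields (three lines that span a
three-dimensional space form a direct sum) such that, for some Riemannian metric and some iterate,
`Es` is contracted, `Eu` is expanded, and `Ec` is strictly in between at every point. -/
structure PartiallyHyperbolicSplitting (f : M ≃ₘ⟮𝓡 3, 𝓡 3⟯ M) where
  Es : ∀ x : M, Submodule ℝ (TangentSpace (𝓡 3) x)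
  Ec : ∀ x : M, Submodule ℝ (TangentSpace (𝓡 3) x)
  Eu : ∀ x : M, Submodule ℝ (TangentSpace (𝓡 3) x)
  continuous_Es : IsContinuousLineField Es
  continuous_Ec : IsContinuousLineField Ec
  continuous_Eu : IsContinuousLineField Eu
  span_eq_top : ∀ x, Es x ⊔ Ec x ⊔ Eu x = ⊤
  invariant_Es : ∀ x, (Es x).map (mfderiv (𝓡 3) (𝓡 3) f x).toLinearMap = Es (f x)
  invariant_Ec : ∀ x, (Ec x).map (mfderiv (𝓡 3) (𝓡 3) f x).toLinearMap = Ec (f x)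
  invariant_Eu : ∀ x, (Eu x).map (mfderiv (𝓡 3) (𝓡 3) f x).toLinearMap = Eu (f x)
  dominated : ∃ ρ : RiemMetric M, ∃ n : ℕ, 0 < n ∧ ∀ x : M,
    ∀ vs ∈ Es x, ∀ vc ∈ Ec x, ∀ vu ∈ Eu x,
      ρ.length vs = 1 → ρ.length vc = 1 → ρ.length vu = 1 →
        ρ.length (mfderiv (𝓡 3) (𝓡 3) f^[n] x vs) < 1 ∧
        1 < ρ.length (mfderiv (𝓡 3) (𝓡 3) f^[n] x vu) ∧
        ρ.length (mfderiv (𝓡 3) (𝓡 3) f^[n] x vs) < ρ.length (mfderiv (𝓡 3) (𝓡 3) f^[n] x vc) ∧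
        ρ.length (mfderiv (𝓡 3) (𝓡 3) f^[n] x vc) < ρ.length (mfderiv (𝓡 3) (𝓡 3) f^[n] x vu)

/-- A discretized Anosov flow: a partially hyperbolic diffeomorphism `f` for which there are a
topological Anosov flow `φ` and a continuous positive function `h` with `f x = φ^{h x} x`. -/
def IsDiscretizedAnosovFlow (f : M ≃ₘ⟮𝓡 3, 𝓡 3⟯ M) : Prop :=
  Nonempty (PartiallyHyperbolicSplitting f) ∧
    ∃ φ : Flow ℝ M, IsTopologicalAnosovFlow φ ∧
      ∃ h : M → ℝ, Continuous h ∧ (∀ x, 0 < h x) ∧ ∀ x, f x = φ (h x) x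

/-! ## Center foliations and centralizers -/

/-- The foliation has `C^1` leaves tangent to the plane field `P`: through each point there is
a `C^1` parametrized surface inside the leaf, immersed at that point with tangent plane `P x`
(injectivity of the derivative follows from the dimensions when `P x` is a plane). -/
def SurfaceFoliation.IsTangentTo (F : SurfaceFoliation M)
    (P : ∀ x : M, Submodule ℝ (TangentSpace (𝓡 3) x)) : Prop :=
  ∀ x : M, ∃ c : EuclideanSpace ℝ (Fin 2) → M, ContMDiff (𝓡 2) (𝓡 3) 1 c ∧
    c 0 = x ∧ (∀ u, c u ∈ F.leaf x) ∧
      LinearMap.range (mfderiv (𝓡 2) (𝓡 3) c 0).toLinearMap = P (c 0)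

/-- Dynamically coherent structure of `f`: `f`-invariant center stable and center unstable
foliations, tangent to `Es ⊕ Ec` and `Ec ⊕ Eu`. -/
structure CenterFoliations (f : M ≃ₘ⟮𝓡 3, 𝓡 3⟯ M) where
  splitting : PartiallyHyperbolicSplitting f
  Wcs : SurfaceFoliation M
  Wcu : SurfaceFoliation M
  tangent_Wcs : Wcs.IsTangentTo (fun x ↦ splitting.Es x ⊔ splitting.Ec x)
  tangent_Wcu : Wcu.IsTangentTo (fun x ↦ splitting.Ec x ⊔ splitting.Eu x)
  invariant_Wcs : ∀ x, f '' Wcs.leaf x = Wcs.leaf (f x)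
  invariant_Wcu : ∀ x, f '' Wcu.leaf x = Wcu.leaf (f x)

/-- The center leaf through `x`: the component through `x` of the intersection of the
center stable and the center unstable leaf of `x`. -/
def CenterFoliations.centerLeaf {f : M ≃ₘ⟮𝓡 3, 𝓡 3⟯ M} (W : CenterFoliations f) (x : M) : Set M :=
  W.Wcs.interLeaf W.Wcu x

/-- The centralizer of `f` in the `C^1` diffeomorphisms of `M`. -/
def centralizer (f : M ≃ₘ⟮𝓡 3, 𝓡 3⟯ M) : Set (M ≃ₘ^1⟮𝓡 3, 𝓡 3⟯ M) :=
  {g | ∀ x, g (f x) = f (g x)}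

end Manifold

end DiscretizedAnosov

/-!
Let `ψ` be a topological Anosov flow with `f x = ψ^{h x} x`. The theorem follows from the
identification of the center leaves with the orbits of `ψ`, which every diffeomorphism commuting
with `f` therefore permutes, and from the finiteness of the closed orbits of bounded period.

**Orbits lie in center leaves** (`orbit_subset_centerLeaf`). This holds for every flow `ψ` with
`f x = ψ^{h x} x`, `h > 0` continuous, Anosov or not. A high iterate of `f` expands the distances
transverse to `Wcs`, so that its inverse contracts the distances to local leaves
(`contracts_of_expands`). Hence a flow arc whose images under the iterates of `f` remain short lies
in one plaque (`exists_rightTangent`). An orbit segment of unit length has images of bounded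
length, so there are only finitely many points on it behind which every arc fails to be of this
kind (`finite_not_rightTangent`). The transverse coordinate of a plaque thus takes only countably
many values along the orbit and is constant (`orbit_subset_leaf`). For `Wcu` one uses the inverse
of `f` and the reversed flow.

The foliations are only continuous, with leaves known through one immersed disc at each point. What
replaces smoothness is the fact that a line of a chart transverse to the plane field crosses the
plaques (`crossesAt_line`), by invariance of domain in the plane (`image_closedBall_mem_nhds`).
Therefore limits of secant directions of the leaves are tangent to the plane field (`secant_mem`),
and transverse lines meet all nearby plaques (`eventually_exists_foot`).

**Center leaves lie in orbits** (`centerLeaf_eq_orbit`). Two nearby points that share a plaque of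
`Wcs` and a plaque of `Wcu` lie on one orbit: slide one of them along the flow to a plane
transverse to the flow through the other one; a limit of the resulting secant directions would be
tangent to both foliations, hence parallel to the vector field, and transverse to it
(`exists_flow_eq_of_leafConn`).

**The centralizer** (`map_flow_mem_orbit`). If `g` commutes with `f`, then the flow `g ψ^t g⁻¹` also
satisfies the hypothesis of the first step, with `h ∘ g⁻¹`. Its orbits lie in the center leaves,
that is, in the orbits of `ψ`, so that `g` permutes the orbits of `ψ`.

**Closed orbits.** A compact orbit `γ` is periodic (`exists_period_of_isCompact`). The periods of
`g^n γ` are bounded (`exists_bounded_period`): if `f` fixes a point of `γ`, some value of `h` is a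
period of `g^n γ`; if not, the arc from a point of `g^n γ` to its image by `f` contains, pulled back
to `γ`, one of the two arcs between a point and its image, and a fixed number of images by `f` of
either arc cover `γ`. An expansive flow has only finitely many closed orbits of bounded period
(`exists_orbit_eq_of_bounded_period`), so that `g^n γ = g^m γ` for some `n < m`, and
`g^(m - n) γ = γ`.
-/

namespace DiscretizedAnosov

/-! ### Invariance of domain in the plane -/

/-- Two continuous logarithms differ by a constant. -/
lemma exp_lift_const {X : Type*} [TopologicalSpace X] [PreconnectedSpace X] {D : X → ℂ}
    (hD : Continuous D) {c : ℂ} (h : ∀ x, Complex.exp (D x) = c) (x y : X) : D x = D y := by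
  have key := Complex.isCoveringMap_exp.eq_of_comp_eq (g₁ := D) (g₂ := fun _ ↦ D y) hD
    continuous_const (by ext z; simp [h]) y rfl
  exact congrFun key x

/-- A continuous nowhere zero function on a simply connected space has a continuous logarithm. -/
lemma exists_log {X : Type*} [TopologicalSpace X] [LocallyPathConnectedSpace X]
    [SimplyConnectedSpace X] {g : X → ℂ} (hg : Continuous g) (h0 : ∀ x, g x ≠ 0) :
    ∃ l : X → ℂ, Continuous l ∧ ∀ x, Complex.exp (l x) = g x := by
  obtain ⟨x₀⟩ : Nonempty X := inferInstance
  obtain ⟨F, ⟨-, hF⟩, -⟩ := Complex.isCoveringMapOn_exp.existsUnique_continuousMap_lifts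
    ⟨g, hg⟩ (a₀ := x₀) (e₀ := Complex.log (g x₀)) (Complex.exp_log (h0 x₀)) (fun a ↦ h0 a)
  exact ⟨F, F.continuous, fun x ↦ congrFun hF x⟩

/-- The radial retraction onto the closed unit disc. -/
noncomputable def discRetraction (z : ℂ) : ℂ := ((max 1 ‖z‖ : ℝ) : ℂ)⁻¹ * z

lemma continuous_discRetraction : Continuous discRetraction := by
  unfold discRetraction
  refine Continuous.mul (Continuous.inv₀ (by fun_prop) fun z ↦ ?_) continuous_id
  have : (0:ℝ) < max 1 ‖z‖ := by positivity
  exact_mod_cast this.ne'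

lemma norm_discRetraction_le (z : ℂ) : ‖discRetraction z‖ ≤ 1 := by
  have : (0:ℝ) < max 1 ‖z‖ := by positivity
  rw [discRetraction, norm_mul, norm_inv, Complex.norm_real, Real.norm_of_nonneg this.le,
    inv_mul_le_iff₀ this, mul_one]
  exact le_max_right _ _

lemma discRetraction_eq {z : ℂ} (h : ‖z‖ ≤ 1) : discRetraction z = z := by
  simp [discRetraction, max_eq_left h]

/-- The winding number of the boundary loop around the value at the centre cannot vanish: an
injective map of the disc deforms `u ↦ f u - f 0`, without zeros, into an odd loop, and an odd
loop has no logarithm. -/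
lemma no_log_on_circle {f : ℂ → ℂ} (hf : ContinuousOn f (Metric.closedBall 0 1))
    (hi : InjOn f (Metric.closedBall 0 1)) {l : ℝ → ℂ} (hl : Continuous l)
    (hper : ∀ θ, l (θ + 2 * Real.pi) = l θ)
    (hexp : ∀ θ : ℝ, Complex.exp (l θ) = f (Complex.exp (θ * Complex.I)) - f 0) : False := by
  let F : ℂ → ℂ := fun z ↦ f (discRetraction z)
  have hFc : Continuous F := hf.comp_continuous continuous_discRetraction
    fun z ↦ by simpa using norm_discRetraction_le z
  let τ : ℝ → ℝ := fun t ↦ max 0 (min 1 t)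
  have hτc : Continuous τ := by fun_prop
  have hτ0 : ∀ t, 0 ≤ τ t := fun t ↦ le_max_left _ _
  have hτ1 : ∀ t, τ t ≤ 1 := fun t ↦ max_le zero_le_one (min_le_left _ _)
  -- For `t` from `0` to `1`, `A - B` stays the unit vector `e^{iθ}`, while the pair `(A, B)` moves
  -- from `(e^{iθ}, 0)` to the antipodal pair `(e^{iθ}/2, -e^{iθ}/2)`.
  let A : ℝ × ℝ → ℂ := fun p ↦ Complex.exp (p.1 * Complex.I) * ((1 + τ p.2 : ℝ) : ℂ)⁻¹
  let B : ℝ × ℝ → ℂ := fun p ↦ -(τ p.2 : ℂ) * A p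
  have hpos : ∀ t, (0:ℝ) < 1 + τ t := fun t ↦ by linarith [hτ0 t]
  have hne : ∀ t, ((1 + τ t : ℝ) : ℂ) ≠ 0 := fun t ↦ by exact_mod_cast (hpos t).ne'
  have hAc : Continuous A := by
    refine Continuous.mul (by fun_prop) (Continuous.inv₀ (by fun_prop) fun p ↦ hne _)
  have hBc : Continuous B := by
    refine Continuous.mul (by fun_prop) hAc
  have hA0 : ∀ p, A p ≠ 0 := fun p ↦ mul_ne_zero (Complex.exp_ne_zero _) (inv_ne_zero (hne _))
  have hAn : ∀ p, ‖A p‖ ≤ 1 := fun p ↦ by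
    simp only [A]
    rw [norm_mul, Complex.norm_exp_ofReal_mul_I, one_mul, norm_inv, Complex.norm_real,
      Real.norm_of_nonneg (hpos _).le]
    exact inv_le_one_of_one_le₀ (by linarith [hτ0 p.2])
  have hBn : ∀ p, ‖B p‖ ≤ 1 := fun p ↦ by
    simp only [B]
    rw [norm_mul, norm_neg, Complex.norm_real, Real.norm_of_nonneg (hτ0 _)]
    exact mul_le_one₀ (hτ1 _) (norm_nonneg _) (hAn p)
  have hAB : ∀ p, F (A p) - F (B p) ≠ 0 := by
    intro p h
    have h1 : f (A p) = f (B p) := by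
      have := sub_eq_zero.1 h
      simpa [F, discRetraction_eq (hAn p), discRetraction_eq (hBn p)] using this
    have h2 := hi (by simpa using hAn p) (by simpa using hBn p) h1
    have h3 : (1 + τ p.2 : ℂ) * A p = 0 := by
      have : A p = -(τ p.2 : ℂ) * A p := h2
      linear_combination this
    rcases mul_eq_zero.1 h3 with h4 | h4
    · exact hne p.2 (by push_cast; exact h4)
    · exact hA0 p h4
  obtain ⟨Λ, hΛc, hΛ⟩ := exists_log (g := fun p : ℝ × ℝ ↦ F (A p) - F (B p))
    ((hFc.comp hAc).sub (hFc.comp hBc)) hAB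
  have hperA : ∀ θ t, A (θ + 2 * Real.pi, t) = A (θ, t) := by
    intro θ t
    simp only [A]
    congr 1
    have : ((θ + 2 * Real.pi : ℝ) : ℂ) * Complex.I = θ * Complex.I + 2 * Real.pi * Complex.I := by
      push_cast; ring
    rw [this, Complex.exp_periodic]
  have hA1 : ∀ θ, A (θ + Real.pi, 1) = -A (θ, 1) := by
    intro θ
    simp only [A]
    have : ((θ + Real.pi : ℝ) : ℂ) * Complex.I = θ * Complex.I + Real.pi * Complex.I := by
      push_cast; ring
    rw [this, Complex.exp_antiperiodic]
    ring
  -- the period of the logarithm along the circle does not depend on the homotopy parameter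
  have hmono : ∀ x y : ℝ × ℝ, Λ (x.1 + 2 * Real.pi, x.2) - Λ x = Λ (y.1 + 2 * Real.pi, y.2) - Λ y :=
    exp_lift_const (D := fun x : ℝ × ℝ ↦ Λ (x.1 + 2 * Real.pi, x.2) - Λ x) (c := 1)
      (by fun_prop) (fun x ↦ by
        have hB2 : B (x.1 + 2 * Real.pi, x.2) = B x := by
          simp only [B]; rw [hperA]
        rw [Complex.exp_sub, hΛ, hΛ, hperA, hB2]
        exact div_self (hAB _))
  have hτz : τ 0 = 0 := by simp [τ]
  have hτo : τ 1 = 1 := by simp [τ]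
  have h0 : Λ (0 + 2 * Real.pi, 0) - Λ (0, 0) = 0 := by
    have := exp_lift_const (D := fun θ : ℝ ↦ Λ (θ, 0) - l θ) (c := 1) (by fun_prop) (fun θ ↦ by
        have hA' : A (θ, 0) = Complex.exp (θ * Complex.I) := by simp [A, hτz]
        have hB' : B (θ, 0) = 0 := by simp [B, hτz]
        have hz : discRetraction 0 = 0 := by simp [discRetraction]
        have he : discRetraction (Complex.exp (θ * Complex.I)) = Complex.exp (θ * Complex.I) :=
          discRetraction_eq (by rw [Complex.norm_exp_ofReal_mul_I])
        rw [Complex.exp_sub, hΛ, hexp, hA', hB']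
        simp only [F, hz, he]
        rw [← hexp]
        exact div_self (Complex.exp_ne_zero _)) (0 + 2 * Real.pi) 0
    simp only [hper] at this
    linear_combination this
  -- At `t = 1` the difference is odd, so that half a turn changes its logarithm by an odd multiple
  -- of `π i`, always the same one; a full turn then cannot change it by `0`.
  have hodd : ∀ θ, Complex.exp (Λ (θ + Real.pi, 1) - Λ (θ, 1)) = -1 := by
    intro θ
    have hB1 : ∀ θ, B (θ, 1) = -A (θ, 1) := fun θ ↦ by simp [B, hτo]
    rw [Complex.exp_sub, hΛ, hΛ, hB1, hB1, hA1, neg_neg]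
    rw [div_eq_iff (by have := hAB (θ, 1); rwa [hB1] at this)]
    ring
  have h1 : Λ (0 + Real.pi + Real.pi, 1) - Λ (0 + Real.pi, 1) = Λ (0 + Real.pi, 1) - Λ (0, 1) :=
    exp_lift_const (D := fun θ : ℝ ↦ Λ (θ + Real.pi, 1) - Λ (θ, 1)) (by fun_prop) hodd _ _
  have h2 := hmono (0, 1) (0, 0)
  simp only [h0] at h2
  have h3 : (0 + 2 * Real.pi : ℝ) = 0 + Real.pi + Real.pi := by ring
  rw [h3] at h2
  have h4 : Λ (0 + Real.pi, 1) - Λ (0, 1) = 0 := by linear_combination (h2 - h1) / 2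
  have := hodd 0
  rw [h4, Complex.exp_zero] at this
  norm_num at this

/-- Invariance of domain for the unit disc of the complex plane. -/
lemma image_closedBall_mem_nhds_complex {f : ℂ → ℂ}
    (hf : ContinuousOn f (Metric.closedBall 0 1)) (hi : InjOn f (Metric.closedBall 0 1)) :
    f '' Metric.closedBall 0 1 ∈ 𝓝 (f 0) := by
  by_contra hK
  have hsub : Metric.sphere (0:ℂ) 1 ⊆ Metric.closedBall 0 1 := Metric.sphere_subset_closedBall
  have hS : IsCompact (f '' Metric.sphere 0 1) := (isCompact_sphere _ _).image_of_continuousOn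
    (hf.mono hsub)
  have hp : f 0 ∈ (f '' Metric.sphere 0 1)ᶜ := by
    rintro ⟨u, hu, hu0⟩
    have := hi (hsub hu) (by simp) hu0
    simp [this] at hu
  obtain ⟨ε, hε, hball⟩ := Metric.isOpen_iff.1 hS.isClosed.isOpen_compl _ hp
  have : ¬ Metric.ball (f 0) ε ⊆ f '' Metric.closedBall 0 1 :=
    fun h ↦ hK (Filter.mem_of_superset (Metric.ball_mem_nhds _ hε) h)
  -- `f - q` has no zero on the whole disc, hence has a logarithm there, and
  -- in particular on the circle.
  obtain ⟨q, hq, hqK⟩ := Set.not_subset.1 this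
  have hFc : Continuous fun z ↦ f (discRetraction z) - q :=
    (hf.comp_continuous continuous_discRetraction
      fun z ↦ by simpa using norm_discRetraction_le z).sub continuous_const
  obtain ⟨G, hGc, hG⟩ := exists_log hFc fun z h ↦ hqK
    ⟨discRetraction z, by simpa using norm_discRetraction_le z, sub_eq_zero.1 h⟩
  have he : ∀ θ : ℝ, discRetraction (Complex.exp (θ * Complex.I)) = Complex.exp (θ * Complex.I) :=
    fun θ ↦ discRetraction_eq (by rw [Complex.norm_exp_ofReal_mul_I])
  have hsph : ∀ θ : ℝ, Complex.exp (θ * Complex.I) ∈ Metric.sphere (0:ℂ) 1 := fun θ ↦ by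
    simp [Complex.norm_exp_ofReal_mul_I]
  let E : ℝ → ℂ := fun θ ↦ f (Complex.exp (θ * Complex.I))
  have hEc : Continuous E := hf.comp_continuous (by fun_prop) fun θ ↦ hsub (hsph θ)
  have hfar : ∀ θ, ε ≤ ‖E θ - f 0‖ := fun θ ↦ by
    by_contra! h
    exact hball (by simpa [dist_eq_norm] using h) ⟨_, hsph θ, rfl⟩
  have hne : ∀ θ, E θ - f 0 ≠ 0 := fun θ ↦ norm_pos_iff.1 (hε.trans_le (hfar θ))
  -- on the circle, replacing `q` by the nearby point `f 0` multiplies by a factor close to `1`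
  have hslit : ∀ θ, (E θ - q) / (E θ - f 0) ∈ Complex.slitPlane := fun θ ↦ by
    have : (E θ - q) / (E θ - f 0) = 1 + -((q - f 0) / (E θ - f 0)) := by
      field_simp [hne θ]; ring
    rw [this]
    apply Complex.mem_slitPlane_of_norm_lt_one
    rw [norm_neg, norm_div, div_lt_one (norm_pos_iff.2 (hne θ))]
    rw [Metric.mem_ball, dist_eq_norm] at hq
    exact hq.trans_le (hfar θ)
  refine no_log_on_circle hf hi (l := fun θ : ℝ ↦ G (Complex.exp (θ * Complex.I)) -
    Complex.log ((E θ - q) / (E θ - f 0))) ?_ ?_ ?_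
  · refine Continuous.sub (by fun_prop) ?_
    exact Continuous.clog (Continuous.div (by fun_prop) (by fun_prop) hne) hslit
  · intro θ
    have : Complex.exp ((θ + 2 * Real.pi : ℝ) * Complex.I) = Complex.exp (θ * Complex.I) := by
      have : ((θ + 2 * Real.pi : ℝ) : ℂ) * Complex.I = θ * Complex.I + 2 * Real.pi * Complex.I := by
        push_cast; ring
      rw [this, Complex.exp_periodic]
    simp only [E, this]
  · intro θ
    have hq0 : E θ - q ≠ 0 := fun h ↦ hqK ⟨_, hsub (hsph θ), sub_eq_zero.1 h⟩
    rw [Complex.exp_sub, hG, he, Complex.exp_log (div_ne_zero hq0 (hne θ))]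
    change (E θ - q) / _ = E θ - f 0
    field_simp [hq0, hne θ]

/-- Invariance of domain in the plane, at the centre of a disc. -/
lemma image_closedBall_mem_nhds {f : EuclideanSpace ℝ (Fin 2) → EuclideanSpace ℝ (Fin 2)} {r : ℝ}
    (hr : 0 < r) (hf : ContinuousOn f (Metric.closedBall 0 r))
    (hi : InjOn f (Metric.closedBall 0 r)) : f '' Metric.closedBall 0 r ∈ 𝓝 (f 0) := by
  let T : ℂ ≃ₗᵢ[ℝ] EuclideanSpace ℝ (Fin 2) := Complex.orthonormalBasisOneI.repr
  let S : ℂ → EuclideanSpace ℝ (Fin 2) := fun z ↦ r • T z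
  have hS : MapsTo S (Metric.closedBall 0 1) (Metric.closedBall 0 r) := fun z hz ↦ by
    simp only [mem_closedBall_zero_iff] at hz
    simp only [mem_closedBall_zero_iff, S, norm_smul, T.norm_map, Real.norm_of_nonneg hr.le]
    nlinarith
  have hSc : Continuous S := by fun_prop
  have hSi : Function.Injective S := fun a b h ↦ T.injective (smul_right_injective _ hr.ne' h)
  have key := image_closedBall_mem_nhds_complex (f := fun z ↦ T.symm (f (S z)))
    (T.symm.continuous.comp_continuousOn (hf.comp hSc.continuousOn hS))
    (fun a ha b hb h ↦ hSi (hi (hS ha) (hS hb) (T.symm.injective h)))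
  have h0 : S 0 = 0 := by simp [S]
  rw [h0] at key
  have h2 := T.toHomeomorph.isOpenMap.image_mem_nhds key
  refine Filter.mem_of_superset (by simpa using h2) ?_
  rintro _ ⟨_, ⟨z, hz, rfl⟩, rfl⟩
  exact ⟨S z, hS hz, by simp⟩

/-! ### Leaves and plaques of a foliation -/

namespace SurfaceFoliation

section Leaf

variable {M : Type*} [TopologicalSpace M] (F : SurfaceFoliation M)

lemma mem_leaf_self (x : M) : x ∈ F.leaf x := Relation.EqvGen.refl x

variable {F}

lemma leaf_eq_of_mem {x y : M} (h : y ∈ F.leaf x) : F.leaf y = F.leaf x := by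
  ext z
  exact ⟨fun hz ↦ Relation.EqvGen.trans _ _ _ h hz,
    fun hz ↦ Relation.EqvGen.trans _ _ _ (Relation.EqvGen.symm _ _ h) hz⟩

lemma mem_leaf_of_level {x y : M} {e} (he : e ∈ F.atlas) (hx : x ∈ e.source) (hy : y ∈ e.source)
    (h : (e x).2 = (e y).2) : y ∈ F.leaf x := Relation.EqvGen.rel _ _ ⟨e, he, hx, hy, h⟩

lemma isPreconnected_plaque {e} (he : e ∈ F.atlas) (t : ℝ)
    {A : Set (EuclideanSpace ℝ (Fin 2))} (hA : IsPreconnected A) :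
    IsPreconnected ((fun u ↦ e.symm (u, t)) '' A) := by
  refine hA.image _ (ContinuousOn.comp (t := univ) ?_ (by fun_prop) (fun _ _ ↦ mem_univ _))
  have := e.continuousOn_symm
  rwa [F.target_eq e he] at this

lemma symm_mem_source {e} (he : e ∈ F.atlas) (p : EuclideanSpace ℝ (Fin 2) × ℝ) :
    e.symm p ∈ e.source := e.map_target (by rw [F.target_eq e he]; trivial)

lemma apply_symm_eq {e} (he : e ∈ F.atlas) (p : EuclideanSpace ℝ (Fin 2) × ℝ) :
    e (e.symm p) = p := e.right_inv (by rw [F.target_eq e he]; trivial)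

/-- A plaque of one chart meets only countably many plaques of another one. -/
lemma countable_levels_plaque [SecondCountableTopology M] {e e'} (he : e ∈ F.atlas)
    (he' : e' ∈ F.atlas) (t : ℝ) :
    {s | ∃ y ∈ e.source ∩ e'.source, (e y).2 = t ∧ (e' y).2 = s}.Countable := by
  let Q : Set M := {y | y ∈ e.source ∩ e'.source ∧ (e y).2 = t}
  have hloc : ∀ y, ∃ V : Set M, y ∈ Q → V ∈ 𝓝[Q] y ∧ ∀ z ∈ V, (e' y).2 = (e' z).2 := by
    intro y
    by_cases hy : y ∈ Q
    · obtain ⟨V, hV, -, h⟩ := F.compatible e he e' he' y hy.1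
      refine ⟨V ∩ Q, fun _ ↦ ⟨inter_mem (mem_nhdsWithin_of_mem_nhds hV) self_mem_nhdsWithin, ?_⟩⟩
      rintro z ⟨hz, hzQ⟩
      exact h y (mem_of_mem_nhds hV) z hz (hy.2.trans hzQ.2.symm)
    · exact ⟨univ, fun h ↦ absurd h hy⟩
  choose V hV using hloc
  obtain ⟨T, hTQ, hTc, hT⟩ := TopologicalSpace.countable_cover_nhdsWithin
    (s := Q) (f := V) fun y hy ↦ (hV y hy).1
  refine (hTc.image fun y ↦ (e' y).2).mono ?_
  rintro s ⟨y, hy, hyt, rfl⟩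
  obtain ⟨z, hz, hyz⟩ := mem_iUnion₂.1 (hT ⟨hy, hyt⟩)
  exact ⟨z, hz, (hV z (hTQ hz)).2 y hyz⟩

/-- A leaf meets a chart in countably many plaques. -/
lemma countable_levels_leaf [SecondCountableTopology M] [CompactSpace M] {e} (he : e ∈ F.atlas)
    (x : M) : {s | ∃ y ∈ e.source ∩ F.leaf x, (e y).2 = s}.Countable := by
  obtain ⟨𝓔, h𝓔sub, h𝓔fin, h𝓔⟩ := isCompact_univ.elim_finite_subcover_image
    (b := F.atlas) (c := fun e ↦ e.source) (fun e _ ↦ e.open_source) (fun y _ ↦ by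
      obtain ⟨e, he, hy⟩ := F.covers y
      exact mem_iUnion₂.2 ⟨e, he, hy⟩)
  let R : M → M → Prop := fun y z ↦ ∃ e ∈ 𝓔, y ∈ e.source ∧ z ∈ e.source ∧ (e y).2 = (e z).2
  have hRsymm : ∀ y z, R y z → R z y := fun y z ⟨e, h1, h2, h3, h4⟩ ↦ ⟨e, h1, h3, h2, h4.symm⟩
  have hRs : ∀ y z, Relation.ReflTransGen R y z → Relation.ReflTransGen R z y := fun y z h ↦ by
    induction h with
    | refl => exact .refl
    | tail _ h ih => exact (Relation.ReflTransGen.single (hRsymm _ _ h)).trans ih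
  -- a plaque of any chart is connected by plaques of the finite family
  have hsame : ∀ y z, F.SamePlaque y z → Relation.ReflTransGen R y z := by
    rintro y z ⟨e, he, hy, hz, hyz⟩
    have hmem : ∀ w ∈ e.source, (e w).2 = (e y).2 →
        w ∈ (fun u ↦ e.symm (u, (e y).2)) '' univ := fun w hw h ↦
      ⟨(e w).1, trivial, by rw [← h]; exact e.left_inv hw⟩
    refine (isPreconnected_plaque he (e y).2 isPreconnected_univ).induction₂
      (P := Relation.ReflTransGen R) ?_ (fun _ _ _ _ _ _ h1 h2 ↦ h1.trans h2)
      (fun a b _ _ h ↦ hRs a b h) (hmem y hy rfl) (hmem z hz hyz.symm)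
    rintro _ ⟨u, -, rfl⟩
    have hw : e.symm (u, (e y).2) ∈ e.source := symm_mem_source he _
    obtain ⟨e', he', hw'⟩ := mem_iUnion₂.1 (h𝓔 (mem_univ (e.symm (u, (e y).2))))
    obtain ⟨V, hV, hVs, h⟩ := F.compatible e he e' (h𝓔sub he') _ ⟨hw, hw'⟩
    filter_upwards [mem_nhdsWithin_of_mem_nhds hV, self_mem_nhdsWithin]
    rintro _ hv ⟨u', -, rfl⟩
    refine Relation.ReflTransGen.single ⟨e', he', hw', (hVs hv).2,
      h _ (mem_of_mem_nhds hV) _ hv ?_⟩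
    rw [apply_symm_eq he, apply_symm_eq he]
  have hleaf : ∀ z ∈ F.leaf x, Relation.ReflTransGen R x z := by
    intro z hz
    induction hz with
    | rel y z h => exact hsame y z h
    | refl y => exact .refl
    | symm y z _ ih => exact hRs _ _ ih
    | trans _ _ _ _ _ h1 h2 => exact h1.trans h2
  -- `N n` consists of the ends of chains of `n` plaques of the finite family that start at `x`.
  let N : ℕ → Set M := fun n ↦ Nat.rec {x} (fun _ A ↦ {z | ∃ y ∈ A, R y z}) n
  have hN : ∀ z, Relation.ReflTransGen R x z → ∃ n, z ∈ N n := by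
    intro z hz
    induction hz with
    | refl => exact ⟨0, rfl⟩
    | tail _ h ih =>
      obtain ⟨n, hn⟩ := ih
      exact ⟨n + 1, _, hn, h⟩
  have hcount : ∀ n, ∀ e ∈ F.atlas, {s | ∃ y ∈ e.source ∩ N n, (e y).2 = s}.Countable := by
    intro n
    induction n with
    | zero =>
      intro e _
      refine (countable_singleton (e x).2).mono ?_
      rintro s ⟨y, ⟨-, hy⟩, rfl⟩
      rw [show y = x from hy]; rfl
    | succ n ih =>
      intro e he
      have : {s | ∃ y ∈ e.source ∩ N (n + 1), (e y).2 = s} ⊆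
          ⋃ e' ∈ 𝓔, ⋃ t ∈ {s | ∃ y ∈ e'.source ∩ N n, (e' y).2 = s},
            {s | ∃ y ∈ e'.source ∩ e.source, (e' y).2 = t ∧ (e y).2 = s} := by
        rintro s ⟨z, ⟨hz, y, hy, e', he', hy', hz', hyz⟩, rfl⟩
        refine mem_iUnion₂.2 ⟨e', he', mem_iUnion₂.2 ⟨(e' y).2, ⟨y, ⟨hy', hy⟩, rfl⟩, ?_⟩⟩
        exact ⟨z, ⟨hz', hz⟩, hyz.symm, rfl⟩
      refine Countable.mono this (h𝓔fin.countable.biUnion fun e' he' ↦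
        (ih e' (h𝓔sub he')).biUnion fun t _ ↦ countable_levels_plaque (h𝓔sub he') he t)
  refine (countable_iUnion fun n ↦ hcount n e he).mono ?_
  rintro s ⟨y, ⟨hy, hyl⟩, rfl⟩
  obtain ⟨n, hn⟩ := hN y (hleaf y hyl)
  exact mem_iUnion.2 ⟨n, y, ⟨hy, hn⟩, rfl⟩

end Leaf

/-- A countable connected set of reals is a point. -/
lemma subsingleton_of_isPreconnected_of_countable {S : Set ℝ} (hS : IsPreconnected S)
    (hc : S.Countable) : S.Subsingleton := by
  intro a ha b hb
  by_contra hab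
  wlog h : a < b generalizing a b
  · exact this hb ha (Ne.symm hab) (lt_of_le_of_ne (not_lt.1 h) (Ne.symm hab))
  exact (Cardinal.Real.Icc_countable_iff.not.2 (not_le.2 h)) (hc.mono (hS.Icc_subset ha hb))

section Metric

variable {M : Type*} [MetricSpace M] {F : SurfaceFoliation M}

/-- The points `x` and `y` lie in a connected subset of diameter at most `r` of one leaf:
closeness at scale `r` inside the leaf, in a form that homeomorphisms preserving the foliation
respect. -/
def LeafConn (F : SurfaceFoliation M) (r : ℝ) (x y : M) : Prop :=
  ∃ S : Set M, IsPreconnected S ∧ S ⊆ F.leaf x ∧ x ∈ S ∧ y ∈ S ∧ ∀ u ∈ S, ∀ v ∈ S, dist u v < r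

lemma LeafConn.mem_leaf {r : ℝ} {x y : M} (h : F.LeafConn r x y) : y ∈ F.leaf x := by
  obtain ⟨S, -, h, -, hy, -⟩ := h
  exact h hy

lemma leafConn_self {r : ℝ} (hr : 0 < r) (x : M) : F.LeafConn r x x :=
  ⟨{x}, isPreconnected_singleton, by simpa using F.mem_leaf_self x, rfl, rfl, by
    rintro u rfl v rfl; simpa using hr⟩

lemma LeafConn.symm {r : ℝ} {x y : M} (h : F.LeafConn r x y) : F.LeafConn r y x := by
  have hl := leaf_eq_of_mem h.mem_leaf
  obtain ⟨S, h1, h2, h3, h4, h5⟩ := h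
  exact ⟨S, h1, by rwa [hl], h4, h3, h5⟩

lemma LeafConn.mono {r s : ℝ} {x y : M} (h : F.LeafConn r x y) (hrs : r ≤ s) :
    F.LeafConn s x y := by
  obtain ⟨S, h1, h2, h3, h4, h5⟩ := h
  exact ⟨S, h1, h2, h3, h4, fun u hu v hv ↦ (h5 u hu v hv).trans_le hrs⟩

lemma LeafConn.trans {r s : ℝ} {x y z : M} (h : F.LeafConn r x y) (h' : F.LeafConn s y z) :
    F.LeafConn (r + s) x z := by
  have hl := leaf_eq_of_mem h.mem_leaf
  obtain ⟨S, h1, h2, h3, h4, h5⟩ := h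
  obtain ⟨T, k1, k2, k3, k4, k5⟩ := h'
  have hr : 0 ≤ r := dist_nonneg.trans (h5 x h3 y h4).le
  have hs : 0 ≤ s := dist_nonneg.trans (k5 y k3 z k4).le
  refine ⟨S ∪ T, h1.union y h4 k3 k1, union_subset h2 (by rwa [← hl]), .inl h3, .inr k4, ?_⟩
  rintro u (hu | hu) v (hv | hv)
  · exact (h5 u hu v hv).trans_le (by linarith)
  · linarith [dist_triangle u y v, h5 u hu y h4, k5 y k3 v hv]
  · linarith [dist_triangle u y v, k5 u hu y k3, h5 y h4 v hv]
  · exact (k5 u hu v hv).trans_le (by linarith)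

lemma LeafConn.map {r r' : ℝ} {x y : M} (h : F.LeafConn r x y) {G : M → M} (hG : Continuous G)
    (hGF : ∀ x, G '' F.leaf x ⊆ F.leaf (G x)) (hr : ∀ u v, dist u v < r → dist (G u) (G v) < r') :
    F.LeafConn r' (G x) (G y) := by
  obtain ⟨S, h1, h2, h3, h4, h5⟩ := h
  refine ⟨G '' S, h1.image _ hG.continuousOn, (image_mono h2).trans (hGF x), ⟨x, h3, rfl⟩,
    ⟨y, h4, rfl⟩, ?_⟩
  rintro _ ⟨u, hu, rfl⟩ _ ⟨v, hv, rfl⟩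
  exact hr u v (h5 u hu v hv)

/-- Nearby points of one plaque are close inside the leaf. -/
lemma exists_ball_leafConn {e} (he : e ∈ F.atlas) {z : M} (hz : z ∈ e.source) {r : ℝ}
    (hr : 0 < r) : ∃ ε > 0, Metric.ball z ε ⊆ e.source ∧ ∀ x ∈ Metric.ball z ε,
      ∀ y ∈ Metric.ball z ε, (e x).2 = (e y).2 → F.LeafConn r x y := by
  have hc : ContinuousAt e.symm (e z) := by
    have := e.continuousOn_symm
    rw [F.target_eq e he] at this
    exact (continuousOn_univ.1 this).continuousAt
  -- The connected set is a disc of the plaque, on which the chart is a product.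
  have h1 : ∀ᶠ p in 𝓝 (e z), e.symm p ∈ Metric.ball z (r / 2) := by
    have := hc.tendsto
    rw [e.left_inv hz] at this
    exact this (Metric.ball_mem_nhds _ (by linarith))
  obtain ⟨ρ, hρ, hball⟩ := Metric.eventually_nhds_iff_ball.1 h1
  have h2 : ∀ᶠ x in 𝓝 z, x ∈ e.source ∧ e x ∈ Metric.ball (e z) ρ :=
    (e.open_source.eventually_mem hz).and
      ((e.continuousAt hz).eventually (Metric.ball_mem_nhds _ hρ))
  obtain ⟨ε, hε, hε'⟩ := Metric.eventually_nhds_iff_ball.1 h2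
  refine ⟨ε, hε, fun x hx ↦ (hε' x hx).1, fun x hx y hy hxy ↦ ?_⟩
  obtain ⟨hxs, hxb⟩ := hε' x hx
  obtain ⟨hys, hyb⟩ := hε' y hy
  have hprod := ball_prod_same (e z).1 (e z).2 ρ
  have hmem : ∀ u ∈ Metric.ball (e z).1 ρ, (u, (e x).2) ∈ Metric.ball (e z) ρ := fun u hu ↦ by
    rw [← Prod.mk.eta (p := e z), ← hprod]
    rw [← Prod.mk.eta (p := e z), ← hprod] at hxb
    exact ⟨hu, hxb.2⟩
  refine ⟨(fun u ↦ e.symm (u, (e x).2)) '' Metric.ball (e z).1 ρ,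
    isPreconnected_plaque he _ (convex_ball _ _).isPreconnected, ?_, ⟨(e x).1, ?_, ?_⟩,
    ⟨(e y).1, ?_, ?_⟩, ?_⟩
  · rintro _ ⟨u, hu, rfl⟩
    exact mem_leaf_of_level he hxs (symm_mem_source he _) (by rw [apply_symm_eq he])
  · rw [← Prod.mk.eta (p := e z), ← hprod] at hxb; exact hxb.1
  · exact e.left_inv hxs
  · rw [← Prod.mk.eta (p := e z), ← hprod] at hyb; exact hyb.1
  · simp only [hxy]; exact e.left_inv hys
  · rintro _ ⟨u, hu, rfl⟩ _ ⟨v, hv, rfl⟩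
    have := hball _ (hmem u hu)
    have := hball _ (hmem v hv)
    simp only [Metric.mem_ball] at *
    linarith [dist_triangle_right (e.symm (u, (e x).2)) (e.symm (v, (e x).2)) z]

variable [CompactSpace M]

/-- A connected subset of a leaf inside a chart lies in one plaque. -/
lemma level_eq_of_isPreconnected {S : Set M} {x : M} {e} (he : e ∈ F.atlas)
    (hS : IsPreconnected S) (hSx : S ⊆ F.leaf x) (hSe : S ⊆ e.source) {u v : M} (hu : u ∈ S)
    (hv : v ∈ S) : (e u).2 = (e v).2 := by
  refine subsingleton_of_isPreconnected_of_countable (S := (fun y ↦ (e y).2) '' S)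
    (hS.image _ (continuous_snd.comp_continuousOn (e.continuousOn.mono hSe)))
    ((countable_levels_leaf he x).mono ?_) ⟨u, hu, rfl⟩ ⟨v, hv, rfl⟩
  rintro _ ⟨y, hy, rfl⟩
  exact ⟨y, ⟨hSe hy, hSx hy⟩, rfl⟩

lemma LeafConn.level_eq {r : ℝ} {x y : M} (h : F.LeafConn r x y) {e} (he : e ∈ F.atlas)
    (hx : Metric.ball x r ⊆ e.source) : (e x).2 = (e y).2 := by
  obtain ⟨S, h1, h2, h3, h4, h5⟩ := h
  exact level_eq_of_isPreconnected he h1 h2 (fun u hu ↦ hx (h5 u hu x h3)) h3 h4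

variable (F) in
/-- A Lebesgue number of the foliated atlas. -/
lemma exists_lebesgue : ∃ R > 0, ∀ x : M, ∃ e ∈ F.atlas, Metric.ball x R ⊆ e.source := by
  obtain ⟨δ, hδ, h⟩ := lebesgue_number_lemma_of_metric (s := univ) isCompact_univ
    (c := fun e : F.atlas ↦ e.1.source) (fun e ↦ e.1.open_source) (fun y _ ↦ by
      obtain ⟨e, he, hy⟩ := F.covers y
      exact mem_iUnion.2 ⟨⟨e, he⟩, hy⟩)
  exact ⟨δ, hδ, fun x ↦ by
    obtain ⟨i, hi⟩ := h x (mem_univ _)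
    exact ⟨i.1, i.2, hi⟩⟩

/-- Points that are close in `M` and connected inside the leaf at the scale of the atlas are
connected inside the leaf at any smaller scale. -/
lemma exists_leafConn_of_dist_lt {R : ℝ} (hR : 0 < R)
    (hRF : ∀ x : M, ∃ e ∈ F.atlas, Metric.ball x (2 * R) ⊆ e.source) {r : ℝ} (hr : 0 < r) :
    ∃ δ > 0, ∀ x y, F.LeafConn R x y → dist x y < δ → F.LeafConn r x y := by
  choose e he heR using hRF
  have hex := fun z ↦ exists_ball_leafConn (he z)
    (heR z (Metric.mem_ball_self (by linarith))) hr
  choose ε hε hεs hεl using hex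
  obtain ⟨δ, hδ, h⟩ := lebesgue_number_lemma_of_metric (s := univ) isCompact_univ
    (c := fun z : M ↦ Metric.ball z (min (ε z) R)) (fun z ↦ Metric.isOpen_ball)
    (fun y _ ↦ mem_iUnion.2 ⟨y, Metric.mem_ball_self (lt_min (hε y) hR)⟩)
  refine ⟨δ, hδ, fun x y hxy hd ↦ ?_⟩
  obtain ⟨z, hz⟩ := h x (mem_univ _)
  have hx := hz (Metric.mem_ball_self hδ)
  have hy := hz (by rwa [Metric.mem_ball, dist_comm] : y ∈ Metric.ball x δ)
  refine hεl z x (Metric.ball_subset_ball (min_le_left _ _) hx) y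
    (Metric.ball_subset_ball (min_le_left _ _) hy) (hxy.level_eq (he z) fun u hu ↦ heR z ?_)
  have h1 := Metric.ball_subset_ball (min_le_right _ _) hx
  simp only [Metric.mem_ball] at *
  linarith [dist_triangle u x z]

end Metric

end SurfaceFoliation

/-! ### Flow arcs inside the leaves of an invariant foliation -/

section Reparametrization

lemma birkhoffSum_nonneg_of_pos {M : Type*} {G : M → M} {H : M → ℝ} (hH : ∀ x, 0 < H x)
    (n : ℕ) (x : M) : 0 ≤ birkhoffSum G H n x :=
  Finset.sum_nonneg fun _ _ ↦ (hH _).le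

lemma birkhoffSum_le {M : Type*} {G : M → M} {H : M → ℝ} {b : ℝ} (hb : ∀ x, H x ≤ b)
    (n : ℕ) (x : M) : birkhoffSum G H n x ≤ n * b := by
  have := Finset.sum_le_card_nsmul (Finset.range n) (fun k ↦ H (G^[k] x)) b fun k _ ↦ hb _
  simpa [birkhoffSum] using this

lemma le_birkhoffSum {M : Type*} {G : M → M} {H : M → ℝ} {b : ℝ} (hb : ∀ x, b ≤ H x)
    (n : ℕ) (x : M) : n * b ≤ birkhoffSum G H n x := by
  have := Finset.card_nsmul_le_sum (Finset.range n) (fun k ↦ H (G^[k] x)) b fun k _ ↦ hb _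
  simpa [birkhoffSum] using this

variable {M : Type*} [TopologicalSpace M] {G : M → M} {ψ : Flow ℝ M} {H : M → ℝ}

lemma iterate_eq_flow (hGψ : ∀ x, G x = ψ (H x) x) (n : ℕ) (x : M) :
    G^[n] x = ψ (birkhoffSum G H n x) x := by
  induction n with
  | zero => simp
  | succ n ih =>
    rw [Function.iterate_succ_apply', hGψ, ih, birkhoffSum_succ, ih, ← ψ.map_add, add_comm]

/-- The time coordinate, along the orbit of `x`, of the `n`-th image of `ψ s x`. -/
noncomputable def orbitMap (G : M → M) (ψ : Flow ℝ M) (H : M → ℝ) (n : ℕ) (x : M) (s : ℝ) : ℝ :=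
  s + birkhoffSum G H n (ψ s x)

lemma iterate_flow (hGψ : ∀ x, G x = ψ (H x) x) (n : ℕ) (x : M) (s : ℝ) :
    G^[n] (ψ s x) = ψ (orbitMap G ψ H n x s) x := by
  rw [iterate_eq_flow hGψ, ← ψ.map_add, orbitMap, add_comm]

lemma continuous_birkhoffSum (hG : Continuous G) (hH : Continuous H) (n : ℕ) :
    Continuous (birkhoffSum G H n) :=
  continuous_finsetSum _ fun k _ ↦ hH.comp (hG.iterate k)

lemma continuous_orbitMap (hG : Continuous G) (hH : Continuous H) (n : ℕ) (x : M) :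
    Continuous (orbitMap G ψ H n x) := by
  have := continuous_birkhoffSum hG hH n
  unfold orbitMap
  fun_prop

lemma strictMono_orbitMap (hG : Continuous G) (hGi : Function.Injective G) (hH : Continuous H)
    (hHpos : ∀ x, 0 < H x) (hGψ : ∀ x, G x = ψ (H x) x) (n : ℕ) (x : M) :
    StrictMono (orbitMap G ψ H n x) := by
  have hinj : Function.Injective (orbitMap G ψ H n x) := by
    intro s t h
    have h1 : G^[n] (ψ s x) = G^[n] (ψ t x) := by rw [iterate_flow hGψ, iterate_flow hGψ, h]
    have h2 := hGi.iterate n h1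
    simp only [orbitMap, h2] at h
    linarith
  rcases (continuous_orbitMap hG hH n x).strictMono_of_inj hinj with h | h
  · exact h
  · exfalso
    have h1 : orbitMap G ψ H n x (|orbitMap G ψ H n x 0| + 1) < orbitMap G ψ H n x 0 :=
      h (by positivity)
    have h2 : |orbitMap G ψ H n x 0| + 1 ≤ orbitMap G ψ H n x (|orbitMap G ψ H n x 0| + 1) :=
      le_add_of_nonneg_right (birkhoffSum_nonneg_of_pos hHpos n _)
    linarith [le_abs_self (orbitMap G ψ H n x 0)]

/-- The image under `G^n` of an orbit segment of unit length has length bounded independently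
of `n`: the segment lies between `x` and some `G^K x`, and the return times of `G` are bounded. -/
lemma orbitMap_sub_le (hG : Continuous G) (hGi : Function.Injective G) (hH : Continuous H)
    (hGψ : ∀ x, G x = ψ (H x) x) {a b : ℝ} (ha : 0 < a) (hab : ∀ x, a ≤ H x) (hb : ∀ x, H x ≤ b) :
    ∃ B, ∀ n x, ∀ s ∈ Icc (0:ℝ) 1, orbitMap G ψ H n x s - orbitMap G ψ H n x 0 ≤ B := by
  obtain ⟨K, hK⟩ := exists_nat_gt (1 / a)
  refine ⟨K * b, fun n x s hs ↦ ?_⟩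
  have h1 : 1 ≤ birkhoffSum G H K x := by
    refine le_trans ?_ (le_birkhoffSum hab K x)
    rw [div_lt_iff₀ ha] at hK
    exact hK.le
  have h2 := (strictMono_orbitMap hG hGi hH (fun x ↦ ha.trans_le (hab x)) hGψ n x).monotone
    (hs.2.trans h1)
  have h3 : orbitMap G ψ H n x (birkhoffSum G H K x) = birkhoffSum G H (K + n) x := by
    rw [orbitMap, ← iterate_eq_flow hGψ, birkhoffSum_add]
  have h4 : birkhoffSum G H (K + n) x = birkhoffSum G H n x + birkhoffSum G H K (G^[n] x) := by
    rw [add_comm K n, birkhoffSum_add]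
  have h5 : orbitMap G ψ H n x 0 = birkhoffSum G H n x := by simp [orbitMap]
  linarith [birkhoffSum_le (G := G) hb K (G^[n] x)]

end Reparametrization

section Sliding

lemma image_symm_leaf {M : Type*} [TopologicalSpace M] {F : SurfaceFoliation M} {G : M ≃ₜ M}
    (hG : ∀ x, G '' F.leaf x = F.leaf (G x)) (x : M) :
    G.symm '' F.leaf x ⊆ F.leaf (G.symm x) := by
  have := hG (G.symm x)
  rw [G.apply_symm_apply] at this
  rw [← this]
  rintro _ ⟨_, ⟨z, hz, rfl⟩, rfl⟩
  simpa using hz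

/-- A fine chain of points whose `n`-th images stay close to one another is followed by a chain
of points of one leaf, at distance exponentially small in `n`. -/
lemma exists_leaf_chain {M : Type*} [MetricSpace M] {V : Type*} [NormedAddCommGroup V] {ι : M → V}
    {F : SurfaceFoliation M} {G : M ≃ₜ M} (hi : Function.Injective ι)
    (hG : ∀ x, G '' F.leaf x = F.leaf (G x)) {R r δ' ε : ℝ}
    (hloc : ∀ x y, F.LeafConn R x y → dist x y < 3 * δ' → F.LeafConn r x y)
    (hback : ∀ x y, dist x y < r → dist (G.symm x) (G.symm y) < R / 2)
    (hcon : ∀ a c, ‖ι (G a) - ι c‖ ≤ ε →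
      ∃ b, F.LeafConn (R / 4) (G.symm c) b ∧ ‖ι a - ι b‖ ≤ ‖ι (G a) - ι c‖ / 2)
    (hdist : ∀ x y, ‖ι x - ι y‖ ≤ ε → dist x y < δ') (hr : 0 < r) (hε : 0 < ε) (n : ℕ) :
    ∀ w : ℕ → M, (∀ j ≤ n, ∀ i, dist (G^[j] (w i)) (G^[j] (w (i + 1))) < δ') →
      (∀ i, ‖ι (G^[n] (w i)) - ι (G^[n] (w 0))‖ ≤ ε) →
      ∃ b : ℕ → M, b 0 = w 0 ∧ (∀ i, ‖ι (w i) - ι (b i)‖ ≤ ε / 2 ^ n) ∧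
        ∀ i, F.LeafConn r (b i) (b (i + 1)) := by
  induction n with
  | zero =>
    intro w _ h
    exact ⟨fun _ ↦ w 0, rfl, by simpa using h, fun i ↦ SurfaceFoliation.leafConn_self hr _⟩
  | succ n ih =>
    intro w hw h
    -- The leafwise chain `c` follows `G w`; each `b i` is the point of the local leaf of
    -- `G⁻¹ (c i)` that the contraction provides next to `w i`.
    obtain ⟨c, hc0, hc, hcc⟩ := ih (fun i ↦ G (w i))
      (fun j hj i ↦ by simpa using hw (j + 1) (by omega) i) (by simpa using h)
    have hle : ε / 2 ^ n ≤ ε := div_le_self hε.le (one_le_pow₀ (by norm_num))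
    choose b hb hb' using fun i ↦ hcon (w i) (c i) ((hc i).trans hle)
    have hbd : ∀ i, ‖ι (w i) - ι (b i)‖ ≤ ε / 2 ^ (n + 1) := fun i ↦ by
      refine (hb' i).trans ?_
      rw [pow_succ, ← div_div]
      have := hc i
      gcongr
    have hle' : ε / 2 ^ (n + 1) ≤ ε := div_le_self hε.le (one_le_pow₀ (by norm_num))
    refine ⟨b, ?_, hbd, fun i ↦ hloc _ _ ?_ ?_⟩
    · have h0 := hb' 0
      rw [hc0, sub_self, norm_zero, zero_div] at h0
      exact (hi (sub_eq_zero.1 (norm_le_zero_iff.1 h0))).symm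
    · have h1 := (hcc i).map G.symm.continuous (image_symm_leaf hG) (hback · ·)
      exact (((hb i).symm.trans h1).trans (hb (i + 1))).mono (by linarith)
    · have h1 := hdist _ _ ((hbd i).trans hle')
      have h2 := hdist _ _ ((hbd (i + 1)).trans hle')
      have h3 := hw 0 (Nat.zero_le _) i
      simp only [Function.iterate_zero, id] at h3
      linarith [dist_triangle4_right (b i) (b (i+1)) (w i) (w (i+1)), dist_comm (b i) (w i),
        dist_comm (b (i + 1)) (w (i + 1))]

variable {M : Type*} [MetricSpace M] [CompactSpace M]

lemma flow_dist_lt (ψ : Flow ℝ M) {ρ : ℝ} (hρ : 0 < ρ) :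
    ∃ η > 0, ∀ s, |s| ≤ η → ∀ y, dist (ψ s y) y < ρ := by
  have h : ∀ᶠ s in 𝓝 (0:ℝ), ∀ y ∈ (univ : Set M), dist (ψ s y) y < ρ := by
    refine isCompact_univ.eventually_forall_of_forall_eventually fun y _ ↦ ?_
    have hc : Continuous fun p : ℝ × M ↦ dist (ψ p.1 p.2) p.2 := by fun_prop
    refine hc.continuousAt.eventually_lt_const ?_
    simpa using hρ
  obtain ⟨η, hη, h⟩ := Metric.eventually_nhds_iff_ball.1 h
  refine ⟨η / 2, by positivity, fun s hs y ↦ h s ?_ y trivial⟩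
  simp only [Metric.mem_ball, dist_zero_right, Real.norm_eq_abs]
  linarith

variable {V : Type*} [NormedAddCommGroup V] {ι : M → V}

lemma dist_lt_of_norm_lt (hι : Continuous ι) (hi : Function.Injective ι) {ρ : ℝ} (hρ : 0 < ρ) :
    ∃ δ > 0, ∀ x y, ‖ι x - ι y‖ < δ → dist x y < ρ := by
  have hK : IsCompact {p : M × M | ρ ≤ dist p.1 p.2} :=
    (isClosed_le continuous_const continuous_dist).isCompact
  obtain ⟨δ, hδ, h⟩ := hK.exists_forall_le' (f := fun p : M × M ↦ ‖ι p.1 - ι p.2‖) (a := 0)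
    (by fun_prop) (fun p hp ↦ norm_pos_iff.2 (sub_ne_zero.2 fun h ↦ by
      have h2 : ρ ≤ dist p.1 p.2 := hp
      rw [hi h, dist_self] at h2
      linarith))
  refine ⟨δ, hδ, fun x y hxy ↦ ?_⟩
  by_contra! hd
  exact absurd (h (x, y) hd) (not_le.2 hxy)

/-- The foliation is uniformly contracted, in the direction transverse to its leaves, by the
inverse of `G`: a point `a` is at least twice closer to the local leaf of `G⁻¹ c` than `G a` is
to `c`. Distances are measured through an embedding `ι`. -/
def Contracts (F : SurfaceFoliation M) (G : M ≃ₜ M) (ι : M → V) : Prop :=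
  ∀ r > 0, ∃ δ > 0, ∀ a c, ‖ι (G a) - ι c‖ < δ →
    ∃ b, F.LeafConn r (G.symm c) b ∧ ‖ι a - ι b‖ ≤ ‖ι (G a) - ι c‖ / 2

/-- The flow arc that starts at `y` in the positive direction stays in the plaque of `y` for a
while. -/
def RightTangent (F : SurfaceFoliation M) (ψ : Flow ℝ M) (y : M) : Prop :=
  ∀ e ∈ F.atlas, y ∈ e.source → ∃ η > 0, ∀ s ∈ Icc 0 η, (e (ψ s y)).2 = (e y).2

variable {F : SurfaceFoliation M} {G : M ≃ₜ M}

/-- If infinitely many images `G^n` of a short flow arc from `y` stay short, the arc stays in the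
plaque of `y`. -/
lemma exists_rightTangent (hι : Continuous ι) (hi : Function.Injective ι)
    (hG : ∀ x, G '' F.leaf x = F.leaf (G x)) (hcon : Contracts F G ι) (ψ : Flow ℝ M) :
    ∃ ε > 0, ∃ η₀ > 0, ∀ y, ∀ η, 0 < η → η ≤ η₀ →
      (∃ᶠ n in atTop, ∀ s ∈ Icc 0 η, ‖ι (G^[n] (ψ s y)) - ι (G^[n] y)‖ ≤ ε) →
      RightTangent F ψ y := by
  obtain ⟨R', hR', hR'F⟩ := F.exists_lebesgue
  obtain ⟨R, hR, rfl⟩ : ∃ R > 0, R' = 2 * R := ⟨R' / 2, by positivity, by ring⟩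
  obtain ⟨r', hr', hback⟩ := Metric.uniformContinuous_iff.1
    (CompactSpace.uniformContinuous_of_continuous G.symm.continuous) (R / 2) (by positivity)
  set r := min r' (R / 2) with hrdef
  have hr : 0 < r := lt_min hr' (by positivity)
  obtain ⟨δ₁, hδ₁, hloc₁⟩ := SurfaceFoliation.exists_leafConn_of_dist_lt hR hR'F hr
  obtain ⟨δ₂, hδ₂, hloc₂⟩ := SurfaceFoliation.exists_leafConn_of_dist_lt hR hR'F
    (half_pos hR)
  obtain ⟨δ₃, hδ₃, hcon'⟩ := hcon (R / 4) (by positivity)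
  set δ' := min (δ₁ / 3) (δ₂ / 2) with hδ'def
  have hδ' : 0 < δ' := lt_min (by positivity) (by positivity)
  obtain ⟨δ₄, hδ₄, hdist⟩ := dist_lt_of_norm_lt hι hi hδ'
  obtain ⟨η₀, hη₀, hflow⟩ := flow_dist_lt ψ (show 0 < min δ' R from lt_min hδ' hR)
  set ε := min δ₃ δ₄ / 2 with hεdef
  have hε : 0 < ε := half_pos (lt_min hδ₃ hδ₄)
  have hε3 : ε < δ₃ := (half_lt_self (lt_min hδ₃ hδ₄)).trans_le (min_le_left _ _)
  have hε4 : ε < δ₄ := (half_lt_self (lt_min hδ₃ hδ₄)).trans_le (min_le_right _ _)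
  have h3δ : 3 * δ' ≤ δ₁ := by linarith [min_le_left (δ₁ / 3) (δ₂ / 2)]
  have h2δ : 2 * δ' ≤ δ₂ := by linarith [min_le_right (δ₁ / 3) (δ₂ / 2)]
  refine ⟨ε, hε, η₀, hη₀, fun y η hη hηη₀ hfreq ↦ ?_⟩
  have hclose : ∀ s ∈ Icc 0 η, dist (ψ s y) y < min δ' R := fun s hs ↦
    hflow s (by rw [abs_of_nonneg hs.1]; exact hs.2.trans hηη₀) y
  -- for arbitrarily large `n`, the arc is `ε / 2 ^ n`-close to the local leaf of `y`
  have hstep : ∀ s ∈ Icc 0 η, ∃ᶠ n in atTop, ∃ b, F.LeafConn R y b ∧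
      ‖ι (ψ s y) - ι b‖ ≤ ε / 2 ^ n := by
    intro s hs
    refine hfreq.mono fun n hn ↦ ?_
    have huc : ∀ᶠ m : ℕ in atTop, ∀ j ∈ Finset.range (n + 1), ∀ a ∈ Icc 0 s, ∀ b ∈ Icc 0 s,
        |a - b| ≤ s / m → dist (G^[j] (ψ a y)) (G^[j] (ψ b y)) < δ' := by
      rw [Finset.eventually_all]
      intro j _
      have hcj : ContinuousOn (fun a ↦ G^[j] (ψ a y)) (Icc 0 s) :=
        ((G.continuous.iterate j).comp (by fun_prop)).continuousOn
      obtain ⟨θ, hθ, hθ'⟩ := Metric.uniformContinuousOn_iff.1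
        (isCompact_Icc.uniformContinuousOn_of_continuous hcj) δ' hδ'
      have : ∀ᶠ m : ℕ in atTop, s / (m : ℝ) < θ :=
        (tendsto_const_div_atTop_nhds_zero_nat s).eventually_lt_const hθ
      filter_upwards [this] with m hm a ha b hb hab
      exact hθ' a ha b hb (by rw [Real.dist_eq]; exact hab.trans_lt hm)
    -- Cut `[0, s]` into `m` intervals so short that their first `n` images are small.
    obtain ⟨m, hm, hm0⟩ := (huc.and (eventually_gt_atTop 0)).exists
    have hm0' : (0:ℝ) < m := by exact_mod_cast hm0
    let t : ℕ → ℝ := fun i ↦ min s (i * (s / m))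
    have ht : ∀ i, t i ∈ Icc 0 s := fun i ↦
      ⟨le_min hs.1 (mul_nonneg (by positivity) (div_nonneg hs.1 hm0'.le)), min_le_left _ _⟩
    have htt : ∀ i, |t i - t (i + 1)| ≤ s / m := fun i ↦ by
      refine (abs_min_sub_min_le_max _ _ _ _).trans (max_le ?_ ?_)
      · simpa using div_nonneg hs.1 hm0'.le
      · rw [← sub_mul]
        push_cast
        rw [show (i : ℝ) - (i + 1) = -1 by ring, neg_one_mul, abs_neg,
          abs_of_nonneg (div_nonneg hs.1 hm0'.le)]
    have ht0 : t 0 = 0 := by simp [t, hs.1]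
    have htm : t m = s := by
      simp only [t]
      rw [mul_div_cancel₀ _ hm0'.ne', min_self]
    have hw0 : ψ (t 0) y = y := by rw [ht0]; exact ψ.map_zero_apply y
    obtain ⟨b, hb0, hb, hbb⟩ := exists_leaf_chain hi hG
      (fun x y h1 h2 ↦ hloc₁ x y h1 (h2.trans_le h3δ))
      (fun x y h ↦ hback (h.trans_le (min_le_left _ _)))
      (fun a c h ↦ hcon' a c (h.trans_lt hε3))
      (fun x y h ↦ hdist x y (h.trans_lt hε4)) hr hε n (fun i ↦ ψ (t i) y)
      (fun j hj i ↦ hm j (Finset.mem_range.2 (by omega)) _ (ht i) _ (ht (i + 1)) (htt i))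
      (fun i ↦ by
        simp only [hw0]
        exact hn _ ⟨(ht i).1, (ht i).2.trans hs.2⟩)
    simp only [hw0] at hb0
    -- The whole leafwise chain stays near `y`, so that its links add up to a small connection.
    have hchain : ∀ i, F.LeafConn (R / 2) y (b i) := by
      intro i
      induction i with
      | zero => rw [hb0]; exact SurfaceFoliation.leafConn_self (half_pos hR) _
      | succ i ih =>
        refine hloc₂ _ _ ((ih.trans (hbb i)).mono (by linarith [min_le_right r' (R / 2)])) ?_
        have h1 := hdist _ _ (((hb (i + 1)).trans
          (div_le_self hε.le (one_le_pow₀ (by norm_num)))).trans_lt hε4)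
        have h2 := (hclose _ ⟨(ht (i + 1)).1, (ht (i + 1)).2.trans hs.2⟩).trans_le (min_le_left _ _)
        have h3 := dist_triangle y (ψ (t (i + 1)) y) (b (i + 1))
        linarith [dist_comm y (ψ (t (i + 1)) y)]
    refine ⟨b m, (hchain m).mono (by linarith), ?_⟩
    have := hb m
    rwa [htm] at this
  obtain ⟨e, he, hes⟩ := hR'F y
  have hsrc : ∀ s ∈ Icc 0 η, ψ s y ∈ e.source := fun s hs ↦ hes (by
    have := (hclose s hs).trans_le (min_le_right _ _)
    rw [Metric.mem_ball]; linarith)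
  -- In the limit the arc has the level of `y`, in a chart around `y` and hence in any other one.
  have hlevel : ∀ s ∈ Icc 0 η, (e (ψ s y)).2 = (e y).2 := by
    intro s hs
    by_contra hne
    have hev : ∀ᶠ p in 𝓝 (ψ s y), (e p).2 ≠ (e y).2 :=
      (continuous_snd.continuousAt.comp (e.continuousAt (hsrc s hs))).eventually_ne hne
    obtain ⟨ρ, hρ, hball⟩ := Metric.eventually_nhds_iff_ball.1 hev
    obtain ⟨δ₅, hδ₅, hdist₅⟩ := dist_lt_of_norm_lt hι hi hρ
    have hsmall : ∀ᶠ n : ℕ in atTop, ε / 2 ^ n < δ₅ := by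
      have : Tendsto (fun n : ℕ ↦ ε / 2 ^ n) atTop (𝓝 0) :=
        tendsto_const_nhds.div_atTop (tendsto_pow_atTop_atTop_of_one_lt (by norm_num))
      exact this.eventually_lt_const hδ₅
    obtain ⟨n, ⟨b, hb, hbn⟩, hn⟩ := ((hstep s hs).and_eventually hsmall).exists
    refine hball b ?_ (hb.level_eq he fun z hz ↦ hes ?_).symm
    · rw [Metric.mem_ball, dist_comm]
      exact hdist₅ _ _ (hbn.trans_lt hn)
    · exact Metric.ball_subset_ball (by linarith) hz
  intro e' he' hy'
  have hye : y ∈ e.source := hes (Metric.mem_ball_self (by positivity))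
  obtain ⟨U, hU, -, hUe⟩ := F.compatible e he e' he' y ⟨hye, hy'⟩
  have hψc : Tendsto (fun s ↦ ψ s y) (𝓝 0) (𝓝 y) := by
    have : Continuous fun s ↦ ψ s y := by fun_prop
    simpa using this.tendsto 0
  obtain ⟨θ, hθ, hθU⟩ := Metric.eventually_nhds_iff_ball.1 (hψc.eventually_mem hU)
  refine ⟨min η (θ / 2), lt_min hη (half_pos hθ), fun s hs ↦ ?_⟩
  refine hUe _ (hθU s ?_) _ (mem_of_mem_nhds hU) (hlevel s ⟨hs.1, hs.2.trans (min_le_left _ _)⟩)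
  rw [Metric.mem_ball, dist_zero_right, Real.norm_of_nonneg hs.1]
  linarith [hs.2.trans (min_le_right _ _)]

/-- On an orbit segment of unit length the flow leaves the plaques immediately at finitely many
points only. Indeed the arc behind such a point, however short, has all its images under large
iterates of `G` of length bounded below, while the image of the whole segment has bounded
length. -/
lemma finite_not_rightTangent (hι : Continuous ι) (hi : Function.Injective ι)
    (hG : ∀ x, G '' F.leaf x = F.leaf (G x)) (hcon : Contracts F G ι) {ψ : Flow ℝ M} {H : M → ℝ}
    (hH : Continuous H) (hHpos : ∀ x, 0 < H x) (hGψ : ∀ x, G x = ψ (H x) x) (x : M) :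
    {s ∈ Ico (0:ℝ) 1 | ¬ RightTangent F ψ (ψ s x)}.Finite := by
  obtain ⟨ε, hε, η₀, hη₀, hRT⟩ := exists_rightTangent hι hi hG hcon ψ
  obtain ⟨a, ha, hab⟩ := isCompact_univ.exists_forall_le' (f := H) (a := 0) hH.continuousOn
    fun x _ ↦ hHpos x
  obtain ⟨b, hb⟩ := (isCompact_univ.image hH).bddAbove
  obtain ⟨B, hB⟩ := orbitMap_sub_le G.continuous G.injective hH hGψ ha (fun x ↦ hab x trivial)
    (fun x ↦ hb ⟨x, trivial, rfl⟩)
  obtain ⟨ρ, hρ, hρι⟩ := Metric.uniformContinuous_iff.1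
    (CompactSpace.uniformContinuous_of_continuous hι) ε hε
  obtain ⟨κ, hκ, hκψ⟩ := flow_dist_lt ψ hρ
  have hmono := fun n ↦ strictMono_orbitMap (ψ := ψ) G.continuous G.injective hH hHpos hGψ n x
  -- a point where the flow leaves the plaque carries an arc that is long at all large times
  have hlong : ∀ s, ¬ RightTangent F ψ (ψ s x) → ∀ η, 0 < η → η ≤ η₀ → ∀ᶠ n in atTop,
      κ < orbitMap G ψ H n x (s + η) - orbitMap G ψ H n x s := by
    intro s hs η hη hηη₀
    by_contra hcontra
    refine hs (hRT _ η hη hηη₀ ?_)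
    rw [not_eventually] at hcontra
    refine hcontra.mono fun n hn u hu ↦ ?_
    have h1 : orbitMap G ψ H n x (s + u) - orbitMap G ψ H n x s ≤ κ :=
      (sub_le_sub_right ((hmono n).monotone (by linarith [hu.2])) _).trans (not_lt.1 hn)
    have h2 : 0 ≤ orbitMap G ψ H n x (s + u) - orbitMap G ψ H n x s :=
      sub_nonneg.2 ((hmono n).monotone (by linarith [hu.1]))
    have h3 : G^[n] (ψ u (ψ s x)) = ψ (orbitMap G ψ H n x (s + u) - orbitMap G ψ H n x s)
        (G^[n] (ψ s x)) := by
      rw [← ψ.map_add, add_comm u s, iterate_flow hGψ, iterate_flow hGψ, ← ψ.map_add,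
        sub_add_cancel]
    rw [h3, ← dist_eq_norm]
    exact (hρι (hκψ _ (by rwa [abs_of_nonneg h2]) _)).le
  by_contra hinf
  -- Take more such points than arcs of length `κ` fit into a segment of length `B`; under a large
  -- iterate their images are `κ`-separated, and the integers `q` below are distinct.
  obtain ⟨A, hAsub, hAcard⟩ := Set.Infinite.exists_subset_card_eq hinf (⌊B / κ⌋₊ + 2)
  have hgap : ∀ᶠ η in 𝓝[>] (0:ℝ), ∀ s ∈ A, ∀ t ∈ A, s < t → s + η ≤ t := by
    rw [Finset.eventually_all]
    intro s _
    rw [Finset.eventually_all]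
    intro t _
    by_cases hst : s < t
    · filter_upwards [Ioo_mem_nhdsGT (sub_pos.2 hst)] with η hη _
      linarith [hη.2]
    · exact Eventually.of_forall fun _ h ↦ absurd h hst
  obtain ⟨η, hηgap, hη⟩ := (hgap.and (Ioc_mem_nhdsGT hη₀)).exists
  have hn : ∀ᶠ n in atTop, ∀ s ∈ A, κ < orbitMap G ψ H n x (s + η) - orbitMap G ψ H n x s := by
    rw [Finset.eventually_all]
    exact fun s hs ↦ hlong s (hAsub hs).2 η hη.1 hη.2
  obtain ⟨n, hn⟩ := hn.exists
  let q : ℝ → ℕ := fun s ↦ ⌊(orbitMap G ψ H n x s - orbitMap G ψ H n x 0) / κ⌋₊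
  have hsep : ∀ s ∈ A, ∀ t ∈ A, s < t → q s < q t := by
    intro s hs t ht hst
    have h1 := hn s hs
    have h2 := (hmono n).monotone (hηgap s hs t ht hst)
    have h0 : 0 ≤ orbitMap G ψ H n x s - orbitMap G ψ H n x 0 :=
      sub_nonneg.2 ((hmono n).monotone (hAsub hs).1.1)
    rw [← Nat.add_one_le_iff]
    refine Nat.le_floor ?_
    have h3 := Nat.floor_le (div_nonneg h0 hκ.le)
    have h4 : (orbitMap G ψ H n x s - orbitMap G ψ H n x 0) / κ + 1 ≤
        (orbitMap G ψ H n x t - orbitMap G ψ H n x 0) / κ := by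
      rw [div_add_one hκ.ne']
      gcongr
      linarith
    push_cast
    exact (add_le_add_left h3 1).trans h4
  have hinj : Set.InjOn q A := by
    intro s hs t ht hq
    rcases lt_trichotomy s t with h | h | h
    · exact absurd hq (hsep s hs t ht h).ne
    · exact h
    · exact absurd hq (hsep t ht s hs h).ne'
  have hmaps : Set.MapsTo q A (Finset.range (⌊B / κ⌋₊ + 1)) := by
    intro s hs
    rw [Finset.coe_range, Set.mem_Iio, Nat.lt_add_one_iff]
    refine Nat.floor_mono ?_
    gcongr
    exact hB n x s ⟨(hAsub hs).1.1, (hAsub hs).1.2.le⟩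
  have := Finset.card_le_card_of_injOn q hmaps hinj
  rw [hAcard, Finset.card_range] at this
  omega

/-- The orbits of a flow are contained in the leaves of a foliation as soon as some homeomorphism
`G` moves points along the orbits by positive bounded times, preserves the foliation, and
expands it transversally. -/
lemma orbit_subset_leaf (hι : Continuous ι) (hi : Function.Injective ι)
    (hG : ∀ x, G '' F.leaf x = F.leaf (G x)) (hcon : Contracts F G ι) {ψ : Flow ℝ M} {H : M → ℝ}
    (hH : Continuous H) (hHpos : ∀ x, 0 < H x) (hGψ : ∀ x, G x = ψ (H x) x) (x : M) (t : ℝ) :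
    ψ t x ∈ F.leaf x := by
  have hcount : {s : ℝ | ¬ RightTangent F ψ (ψ s x)}.Countable := by
    refine (countable_iUnion fun k : ℤ ↦ ((finite_not_rightTangent hι hi hG hcon hH hHpos hGψ
      (ψ k x)).countable.image fun s ↦ s + k)).mono fun s hs ↦ ?_
    refine mem_iUnion.2 ⟨⌊s⌋, s - ⌊s⌋, ⟨⟨Int.fract_nonneg s, Int.fract_lt_one s⟩, ?_⟩, ?_⟩
    · rwa [← ψ.map_add, sub_add_cancel]
    · exact sub_add_cancel _ _
  have hψc : Continuous fun s ↦ ψ s x := by fun_prop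
  have hlocal : ∀ s₀ ∈ (univ : Set ℝ), ∀ᶠ s in 𝓝[univ] s₀, ψ s x ∈ F.leaf (ψ s₀ x) := by
    intro s₀ _
    rw [nhdsWithin_univ]
    obtain ⟨e, he, hes⟩ := F.covers (ψ s₀ x)
    obtain ⟨θ, hθ, hball⟩ := Metric.eventually_nhds_iff_ball.1
      (hψc.continuousAt.eventually_mem (e.open_source.mem_nhds hes))
    let g : ℝ → ℝ := fun s ↦ (e (ψ s x)).2
    have hgc : ContinuousOn g (Metric.ball s₀ θ) := continuous_snd.comp_continuousOn
      (e.continuousOn.comp hψc.continuousOn hball)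
    -- at a point where the flow stays in its plaque, the level is also taken at a rational time
    have hgcount : (g '' Metric.ball s₀ θ).Countable := by
      refine (((countable_range ((↑) : ℚ → ℝ)).image g).union (hcount.image g)).mono ?_
      rintro _ ⟨s, hs, rfl⟩
      by_cases hsT : RightTangent F ψ (ψ s x)
      · obtain ⟨η, hη, hη'⟩ := hsT e he (hball s hs)
        obtain ⟨q, hq1, hq2⟩ := exists_rat_btwn (show s < s + η by linarith)
        refine .inl ⟨q, ⟨q, rfl⟩, ?_⟩
        have := hη' (q - s) ⟨by linarith, by linarith⟩
        rwa [← ψ.map_add, sub_add_cancel] at this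
      · exact .inr ⟨s, hsT, rfl⟩
    -- The level is continuous along the orbit and takes countably many values, hence is constant.
    have hsub := SurfaceFoliation.subsingleton_of_isPreconnected_of_countable
      ((convex_ball s₀ θ).isPreconnected.image g hgc) hgcount
    filter_upwards [Metric.ball_mem_nhds s₀ hθ] with s hs
    exact SurfaceFoliation.mem_leaf_of_level he hes (hball s hs)
      (hsub ⟨s₀, Metric.mem_ball_self hθ, rfl⟩ ⟨s, hs, rfl⟩)
  have := isPreconnected_univ.induction₂ (fun s t ↦ ψ t x ∈ F.leaf (ψ s x)) hlocal
    (fun _ _ _ _ _ _ h1 h2 ↦ by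
      rw [← SurfaceFoliation.leaf_eq_of_mem h1]; exact h2)
    (fun _ _ _ _ h ↦ by
      rw [SurfaceFoliation.leaf_eq_of_mem h]; exact F.mem_leaf_self _)
    (mem_univ (0:ℝ)) (mem_univ t)
  simpa using this

end Sliding

/-! ### Transverse lines cross the plaques -/

/-- The function `g` has strictly different signs of increment on the two sides of `t`. -/
def CrossesAt (g : ℝ → ℝ) (t : ℝ) : Prop :=
  (∀ᶠ s in 𝓝[>] (0:ℝ), g t < g (t + s) ∧ g (t - s) < g t) ∨
    (∀ᶠ s in 𝓝[>] (0:ℝ), g (t + s) < g t ∧ g t < g (t - s))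

lemma CrossesAt.not_isLocalExtr {g : ℝ → ℝ} {t : ℝ} (h : CrossesAt g t) : ¬ IsLocalExtr g t := by
  have h1 : Tendsto (fun s ↦ t + s) (𝓝[>] (0:ℝ)) (𝓝 t) := by
    have : Tendsto (fun s ↦ t + s) (𝓝 (0:ℝ)) (𝓝 (t + 0)) := Continuous.tendsto (by fun_prop) 0
    rw [add_zero] at this
    exact this.mono_left nhdsWithin_le_nhds
  have h2 : Tendsto (fun s ↦ t - s) (𝓝[>] (0:ℝ)) (𝓝 t) := by
    have : Tendsto (fun s ↦ t - s) (𝓝 (0:ℝ)) (𝓝 (t - 0)) := Continuous.tendsto (by fun_prop) 0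
    rw [sub_zero] at this
    exact this.mono_left nhdsWithin_le_nhds
  rintro (he | he)
  · rcases h with h | h
    · obtain ⟨s, hs, hs'⟩ := (h.and (h2.eventually he)).exists
      exact absurd hs.2 (not_lt.2 hs')
    · obtain ⟨s, hs, hs'⟩ := (h.and (h1.eventually he)).exists
      exact absurd hs.1 (not_lt.2 hs')
  · rcases h with h | h
    · obtain ⟨s, hs, hs'⟩ := (h.and (h1.eventually he)).exists
      exact absurd hs.1 (not_lt.2 hs')
    · obtain ⟨s, hs, hs'⟩ := (h.and (h2.eventually he)).exists
      exact absurd hs.2 (not_lt.2 hs')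

lemma continuousOn_sign_const {X : Type*} [TopologicalSpace X] {S : Set X} (hS : IsPreconnected S)
    {g : X → ℝ} (hg : ContinuousOn g S) {c : ℝ} (h0 : ∀ p ∈ S, g p ≠ c) :
    (∀ p ∈ S, c < g p) ∨ (∀ p ∈ S, g p < c) := by
  by_contra! h
  obtain ⟨⟨p, hp, hpc⟩, q, hq, hqc⟩ := h
  obtain ⟨m, hm, hmc⟩ := hS.intermediate_value hp hq hg ⟨hpc, hqc⟩
  exact h0 m hm hmc

/-- If a local homeomorphism of `ℝ² × ℝ` maps a disc of `ℝ² × {0}` into a horizontal plane, then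
the image of the vertical line through the origin crosses this plane. By invariance of domain the
image of the disc is a neighbourhood in the plane, so that no other point near the origin is
mapped into the plane. -/
lemma crossesAt_of_disc (Ψ : OpenPartialHomeomorph (EuclideanSpace ℝ (Fin 2) × ℝ)
      (EuclideanSpace ℝ (Fin 2) × ℝ)) (h0 : (0, 0) ∈ Ψ.source)
    (hlev : ∀ᶠ u in 𝓝 (0 : EuclideanSpace ℝ (Fin 2)), (Ψ (u, 0)).2 = (Ψ (0, 0)).2) :
    CrossesAt (fun t ↦ (Ψ (0, t)).2) 0 := by
  set τ := (Ψ (0, 0)).2 with hτ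
  have hemb : Tendsto (fun u : EuclideanSpace ℝ (Fin 2) ↦ (u, (0:ℝ))) (𝓝 0) (𝓝 (0, 0)) :=
    (Continuous.prodMk_left (0:ℝ)).tendsto 0
  obtain ⟨r₀, hr₀, hr₀'⟩ := Metric.eventually_nhds_iff_ball.1
    (hlev.and (hemb.eventually_mem (Ψ.open_source.mem_nhds h0)))
  set r := r₀ / 2
  have hr : 0 < r := half_pos hr₀
  have hsub : Metric.closedBall (0 : EuclideanSpace ℝ (Fin 2)) r ⊆ Metric.ball 0 r₀ :=
    Metric.closedBall_subset_ball (half_lt_self hr₀)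
  have hdisc : (fun u ↦ (Ψ (u, 0)).1) '' Metric.closedBall 0 r ∈ 𝓝 (Ψ (0, 0)).1 := by
    refine image_closedBall_mem_nhds (f := fun u ↦ (Ψ (u, 0)).1) hr ?_ ?_
    · exact continuous_fst.comp_continuousOn (Ψ.continuousOn.comp (by fun_prop)
        fun u hu ↦ (hr₀' u (hsub hu)).2)
    · intro u hu u' hu' h
      have h2 : Ψ (u, 0) = Ψ (u', 0) := Prod.ext h
        ((hr₀' u (hsub hu)).1.trans (hr₀' u' (hsub hu')).1.symm)
      exact congrArg Prod.fst (Ψ.injOn (hr₀' u (hsub hu)).2 (hr₀' u' (hsub hu')).2 h2)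
  have hev : ∀ᶠ p in 𝓝 ((0 : EuclideanSpace ℝ (Fin 2)), (0:ℝ)), p ∈ Ψ.source ∧
      (Ψ p).1 ∈ (fun u ↦ (Ψ (u, 0)).1) '' Metric.closedBall 0 r :=
    (Ψ.open_source.eventually_mem h0).and
      (((continuous_fst.tendsto _).comp (Ψ.continuousAt h0)).eventually_mem hdisc)
  obtain ⟨ρ₁, hρ₁, hball₁⟩ := Metric.eventually_nhds_iff_ball.1 hev
  set ρ := min ρ₁ r₀
  have hρ : 0 < ρ := lt_min hρ₁ hr₀
  have hball := fun p hp ↦ hball₁ p (Metric.ball_subset_ball (min_le_left ρ₁ r₀) hp)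
  rw [← ball_prod_same] at hball
  -- only the disc itself reaches the level of the origin
  have hne : ∀ p ∈ Metric.ball (0 : EuclideanSpace ℝ (Fin 2)) ρ ×ˢ Metric.ball (0:ℝ) ρ,
      p.2 ≠ 0 → (Ψ p).2 ≠ τ := by
    intro p hp hp2 hpτ
    obtain ⟨hps, u, hu, hup⟩ := hball p hp
    have h2 : Ψ (u, 0) = Ψ p := Prod.ext hup ((hr₀' u (hsub hu)).1.trans hpτ.symm)
    exact hp2 (congrArg Prod.snd (Ψ.injOn (hr₀' u (hsub hu)).2 hps h2)).symm
  have hcont : ContinuousOn (fun p ↦ (Ψ p).2) (Metric.ball 0 ρ ×ˢ Metric.ball (0:ℝ) ρ) :=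
    continuous_snd.comp_continuousOn (Ψ.continuousOn.mono fun p hp ↦ (hball p hp).1)
  have hposS : Metric.ball (0 : EuclideanSpace ℝ (Fin 2)) ρ ×ˢ Ioo 0 ρ ⊆
      Metric.ball 0 ρ ×ˢ Metric.ball (0:ℝ) ρ := prod_mono le_rfl fun t ht ↦ by
    simp [abs_of_pos ht.1, ht.2]
  have hnegS : Metric.ball (0 : EuclideanSpace ℝ (Fin 2)) ρ ×ˢ Ioo (-ρ) 0 ⊆
      Metric.ball 0 ρ ×ˢ Metric.ball (0:ℝ) ρ := prod_mono le_rfl fun t ht ↦ by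
    rw [mem_ball_zero_iff, Real.norm_eq_abs, abs_of_neg ht.2]; linarith [ht.1]
  have hpos := continuousOn_sign_const
    ((convex_ball (0 : EuclideanSpace ℝ (Fin 2)) ρ).prod (convex_Ioo 0 ρ)).isPreconnected
    (hcont.mono hposS) fun p hp ↦ hne p (hposS hp) hp.2.1.ne'
  have hneg := continuousOn_sign_const
    ((convex_ball (0 : EuclideanSpace ℝ (Fin 2)) ρ).prod (convex_Ioo (-ρ) 0)).isPreconnected
    (hcont.mono hnegS) fun p hp ↦ hne p (hnegS hp) hp.2.2.ne
  -- both sides of the level are reached near the origin, because the map is open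
  have hboth : ∀ s : ℝ, s ≠ 0 → ∃ θ > 0, ∃ p ∈ Metric.ball (0 : EuclideanSpace ℝ (Fin 2)) ρ ×ˢ
      Metric.ball (0:ℝ) ρ, p.2 ≠ 0 ∧ (Ψ p).2 = τ + θ * s := by
    intro s hs
    have himg : Ψ '' (Metric.ball (0 : EuclideanSpace ℝ (Fin 2)) ρ ×ˢ Metric.ball (0:ℝ) ρ) ∈
        𝓝 (Ψ (0, 0)) := by
      refine Ψ.image_mem_nhds h0 ?_
      rw [ball_prod_same]
      exact Metric.ball_mem_nhds _ hρ
    have hpath : Tendsto (fun θ : ℝ ↦ ((Ψ (0, 0)).1, τ + θ * s)) (𝓝[>] 0) (𝓝 (Ψ (0, 0))) := by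
      have : Tendsto (fun θ : ℝ ↦ ((Ψ (0, 0)).1, τ + θ * s)) (𝓝 0)
          (𝓝 ((Ψ (0, 0)).1, τ + 0 * s)) := Continuous.tendsto (by fun_prop) 0
      rw [zero_mul, add_zero] at this
      exact this.mono_left nhdsWithin_le_nhds
    obtain ⟨θ, ⟨p, hp, hpθ⟩, hθ⟩ := ((hpath.eventually_mem himg).and self_mem_nhdsWithin).exists
    have hp2 : (Ψ p).2 = τ + θ * s := by rw [hpθ]
    refine ⟨θ, hθ, p, hp, fun h ↦ ?_, hp2⟩
    have h3 := (hr₀' p.1 (Metric.ball_subset_ball (min_le_right _ _) hp.1)).1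
    rw [← h, Prod.mk.eta, hp2] at h3
    exact mul_ne_zero (ne_of_gt hθ) hs (by linarith)
  have hsplit : ∀ p ∈ Metric.ball (0 : EuclideanSpace ℝ (Fin 2)) ρ ×ˢ Metric.ball (0:ℝ) ρ,
      p.2 ≠ 0 → p ∈ Metric.ball (0 : EuclideanSpace ℝ (Fin 2)) ρ ×ˢ Ioo 0 ρ ∨
        p ∈ Metric.ball (0 : EuclideanSpace ℝ (Fin 2)) ρ ×ˢ Ioo (-ρ) 0 := by
    intro p hp hp2
    have h2 := hp.2
    rw [mem_ball_zero_iff, Real.norm_eq_abs, abs_lt] at h2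
    rcases lt_or_gt_of_ne hp2 with h | h
    · exact .inr ⟨hp.1, h2.1, h⟩
    · exact .inl ⟨hp.1, h, h2.2⟩
  have h0ρ : (0 : EuclideanSpace ℝ (Fin 2)) ∈ Metric.ball (0 : EuclideanSpace ℝ (Fin 2)) ρ :=
    Metric.mem_ball_self hρ
  have hs : ∀ᶠ s in 𝓝[>] (0:ℝ), s ∈ Ioo 0 ρ := Ioo_mem_nhdsGT hρ
  rcases hpos with hpos | hpos <;> rcases hneg with hneg | hneg
  · exfalso
    obtain ⟨θ, hθ, p, hp, hp2, hpτ⟩ := hboth (-1) (by norm_num)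
    rcases hsplit p hp hp2 with h | h
    · linarith [hpos p h]
    · linarith [hneg p h]
  · left
    filter_upwards [hs] with s hs
    rw [zero_add, zero_sub]
    exact ⟨hpos (0, s) ⟨h0ρ, hs⟩, hneg (0, -s) ⟨h0ρ, by linarith [hs.2], by linarith [hs.1]⟩⟩
  · right
    filter_upwards [hs] with s hs
    rw [zero_add, zero_sub]
    exact ⟨hpos (0, s) ⟨h0ρ, hs⟩, hneg (0, -s) ⟨h0ρ, by linarith [hs.2], by linarith [hs.1]⟩⟩
  · exfalso
    obtain ⟨θ, hθ, p, hp, hp2, hpτ⟩ := hboth 1 one_ne_zero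
    rcases hsplit p hp hp2 with h | h
    · linarith [hpos p h]
    · linarith [hneg p h]

section Crossing

lemma injective_of_finrank_range {V W : Type*} [AddCommGroup V] [Module ℝ V]
    [FiniteDimensional ℝ V] [AddCommGroup W] [Module ℝ W] (f : V →ₗ[ℝ] W)
    (h : Module.finrank ℝ (LinearMap.range f) = Module.finrank ℝ V) : Function.Injective f := by
  rw [← LinearMap.ker_eq_bot, ← Submodule.finrank_eq_zero (R := ℝ)]
  have := f.finrank_range_add_finrank_ker
  omega

variable {M : Type*} [MetricSpace M] [CompactSpace M]
  [ChartedSpace (EuclideanSpace ℝ (Fin 3)) M] [IsManifold (𝓡 3) ∞ M]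

lemma CrossesAt.of_comp_add {g : ℝ → ℝ} {t : ℝ} (h : CrossesAt (fun s ↦ g (t + s)) 0) :
    CrossesAt g t := by
  simpa [CrossesAt, sub_eq_add_neg] using h

/-- The image of a plane of the tangent space in the chart at `z`. -/
noncomputable def chartPlane (P : ∀ x : M, Submodule ℝ (TangentSpace (𝓡 3) x)) (z w : M) :
    Submodule ℝ (EuclideanSpace ℝ (Fin 3)) :=
  (P w).map (mfderiv (𝓡 3) 𝓘(ℝ, EuclideanSpace ℝ (Fin 3)) (extChartAt (𝓡 3) z) w).toLinearMap

variable {F : SurfaceFoliation M} {P : ∀ x : M, Submodule ℝ (TangentSpace (𝓡 3) x)}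

/-- A line of a chart that is transverse at `w` to the plane field crosses the plaque of `w`. -/
lemma crossesAt_line (hT : F.IsTangentTo P) (hP : ∀ x, Module.finrank ℝ (P x) = 2) {z w : M}
    (hw : w ∈ (extChartAt (𝓡 3) z).source) {e} (he : e ∈ F.atlas) (hwe : w ∈ e.source)
    {v : EuclideanSpace ℝ (Fin 3)} (hv : v ∉ chartPlane P z w) :
    CrossesAt (fun t ↦ (e ((extChartAt (𝓡 3) z).symm (extChartAt (𝓡 3) z w + t • v))).2) 0 := by
  obtain ⟨c, hc, hc0, hcl, hcr⟩ := hT w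
  set κ := extChartAt (𝓡 3) z with hκ
  have hwc : w ∈ (chartAt (EuclideanSpace ℝ (Fin 3)) z).source := by
    rwa [extChartAt_source] at hw
  let φ : EuclideanSpace ℝ (Fin 2) → EuclideanSpace ℝ (Fin 3) := fun u ↦ κ (c u)
  have hκc : ContMDiffAt (𝓡 3) 𝓘(ℝ, EuclideanSpace ℝ (Fin 3)) 1 κ (c 0) := by
    rw [hc0]; exact contMDiffAt_extChartAt' hwc
  have hφm : ContMDiffAt (𝓡 2) 𝓘(ℝ, EuclideanSpace ℝ (Fin 3)) 1 φ 0 := hκc.comp 0 (hc 0)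
  have hφc : ContDiffAt ℝ 1 φ 0 := hφm.contDiffAt
  have hA : fderiv ℝ φ 0 = (mfderiv (𝓡 3) 𝓘(ℝ, EuclideanSpace ℝ (Fin 3)) κ (c 0)).comp
      (mfderiv (𝓡 2) (𝓡 3) c 0) := by
    rw [← mfderiv_eq_fderiv]
    exact mfderiv_comp 0 (hκc.mdifferentiableAt one_ne_zero)
      ((hc 0).mdifferentiableAt one_ne_zero)
  set A := fderiv ℝ φ 0 with hAdef
  have hstrict : HasStrictFDerivAt φ A 0 := hφc.hasStrictFDerivAt one_ne_zero
  have hAu : ∀ u, A u = mfderiv (𝓡 3) 𝓘(ℝ, EuclideanSpace ℝ (Fin 3)) κ (c 0)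
      (mfderiv (𝓡 2) (𝓡 3) c 0 u) := fun u ↦ DFunLike.congr_fun hA u
  have hmem : ∀ u, A u ∈ chartPlane P z w := by
    intro u
    rw [hAu, chartPlane, ← hc0]
    exact Submodule.mem_map_of_mem (hcr ▸ LinearMap.mem_range_self _ u)
  have hAinj : Function.Injective A := by
    have h1 : Function.Injective (mfderiv (𝓡 2) (𝓡 3) c 0) := by
      have : FiniteDimensional ℝ (TangentSpace (𝓡 2) (0 : EuclideanSpace ℝ (Fin 2))) :=
        inferInstanceAs (FiniteDimensional ℝ (EuclideanSpace ℝ (Fin 2)))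
      refine injective_of_finrank_range (mfderiv (𝓡 2) (𝓡 3) c 0).toLinearMap ?_
      rw [hcr, hP]
      exact (finrank_euclideanSpace_fin (𝕜 := ℝ) (n := 2)).symm
    have h2 : Function.Injective (mfderiv (𝓡 3) 𝓘(ℝ, EuclideanSpace ℝ (Fin 3)) κ (c 0)) :=
      (isInvertible_mfderiv_extChartAt (hc0 ▸ hw)).injective
    intro u u' h
    rw [hAu, hAu] at h
    exact h1 (h2 h)
  -- The immersed surface `φ` and the direction `v` together give the local diffeomorphism
  -- `Γ (u, t) = φ u + t v`, by the inverse function theorem.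
  let D : EuclideanSpace ℝ (Fin 2) × ℝ →L[ℝ] EuclideanSpace ℝ (Fin 3) :=
    A.comp (ContinuousLinearMap.fst ℝ _ _) + (ContinuousLinearMap.snd ℝ _ _).smulRight v
  have hDapp : ∀ p, D p = A p.1 + p.2 • v := fun p ↦ rfl
  have hDinj : Function.Injective D.toLinearMap := by
    rw [← LinearMap.ker_eq_bot, LinearMap.ker_eq_bot']
    intro p hp
    have hp' : A p.1 + p.2 • v = 0 := hp
    have hp2 : p.2 = 0 := by
      by_contra h
      refine hv ?_
      have : v = -(p.2⁻¹ • A p.1) := by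
        rw [eq_neg_of_add_eq_zero_left hp', smul_neg, neg_neg, smul_smul, inv_mul_cancel₀ h,
          one_smul]
      rw [this]
      exact Submodule.neg_mem _ (Submodule.smul_mem _ _ (hmem _))
    rw [hp2, zero_smul, add_zero] at hp'
    exact Prod.ext (hAinj (by rw [hp', Prod.fst_zero, map_zero])) hp2
  have hDsurj : Function.Surjective D.toLinearMap :=
    (LinearMap.injective_iff_surjective_of_finrank_eq_finrank (by simp)).1 hDinj
  let D' : (EuclideanSpace ℝ (Fin 2) × ℝ) ≃L[ℝ] EuclideanSpace ℝ (Fin 3) :=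
    ContinuousLinearEquiv.ofBijective D (LinearMap.ker_eq_bot.2 hDinj)
      (LinearMap.range_eq_top.2 hDsurj)
  let Γ : EuclideanSpace ℝ (Fin 2) × ℝ → EuclideanSpace ℝ (Fin 3) := fun p ↦ φ p.1 + p.2 • v
  have hΓ : HasStrictFDerivAt Γ (D' : _ →L[ℝ] _) (0, 0) := by
    have h1 : HasStrictFDerivAt (fun p : EuclideanSpace ℝ (Fin 2) × ℝ ↦ φ p.1)
        (A.comp (ContinuousLinearMap.fst ℝ _ _)) (0, 0) :=
      HasStrictFDerivAt.comp (0, 0) (f := Prod.fst) hstrict hasStrictFDerivAt_fst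
    exact h1.add (ContinuousLinearMap.hasStrictFDerivAt
      ((ContinuousLinearMap.snd ℝ (EuclideanSpace ℝ (Fin 2)) ℝ).smulRight v))
  have hφ0 : φ 0 = κ w := by simp only [φ, hc0]
  have hΓ0 : Γ (0, 0) = κ w := by simp only [Γ, hφ0, zero_smul, add_zero]
  let Ψ := (hΓ.toOpenPartialHomeomorph Γ).trans
    ((chartAt (EuclideanSpace ℝ (Fin 3)) z).symm.trans e)
  have hΨ : ∀ p, Ψ p = e (κ.symm (Γ p)) := fun p ↦ rfl
  have hκw : κ.symm (κ w) = w := κ.left_inv hw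
  have h0 : ((0 : EuclideanSpace ℝ (Fin 2)), (0:ℝ)) ∈ Ψ.source := by
    refine ⟨hΓ.mem_toOpenPartialHomeomorph_source, ?_, ?_⟩
    · change Γ (0, 0) ∈ (chartAt (EuclideanSpace ℝ (Fin 3)) z).target
      rw [hΓ0]
      exact (chartAt (EuclideanSpace ℝ (Fin 3)) z).map_source hwc
    · change κ.symm (Γ (0, 0)) ∈ e.source
      rwa [hΓ0, hκw]
  -- The surface `c` lies in one leaf, and a connected part of it inside the chart in one plaque.
  have hlev : ∀ᶠ u in 𝓝 (0 : EuclideanSpace ℝ (Fin 2)), (Ψ (u, 0)).2 = (Ψ (0, 0)).2 := by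
    have hcc : Continuous c := hc.continuous
    have hev : ∀ᶠ u in 𝓝 (0 : EuclideanSpace ℝ (Fin 2)), c u ∈ e.source ∧ c u ∈ κ.source := by
      refine (hcc.continuousAt.eventually_mem (e.open_source.mem_nhds (by rwa [hc0]))).and
        (hcc.continuousAt.eventually_mem ((isOpen_extChartAt_source z).mem_nhds (by rwa [hc0])))
    obtain ⟨ρ, hρ, hball⟩ := Metric.eventually_nhds_iff_ball.1 hev
    filter_upwards [Metric.ball_mem_nhds _ hρ] with u hu
    have hΓu : ∀ u ∈ Metric.ball (0 : EuclideanSpace ℝ (Fin 2)) ρ, Ψ (u, 0) = e (c u) := by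
      intro u hu
      rw [hΨ]
      simp only [Γ, zero_smul, add_zero]
      exact congrArg e (κ.left_inv (hball u hu).2)
    rw [hΓu u hu, hΓu 0 (Metric.mem_ball_self hρ)]
    refine SurfaceFoliation.level_eq_of_isPreconnected (S := c '' Metric.ball 0 ρ) (x := w) he
      ((convex_ball _ _).isPreconnected.image _ hcc.continuousOn) ?_ ?_ ⟨u, hu, rfl⟩
      ⟨0, Metric.mem_ball_self hρ, rfl⟩
    · rintro _ ⟨u, -, rfl⟩
      exact hcl u
    · rintro _ ⟨u, hu, rfl⟩
      exact (hball u hu).1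
  have := crossesAt_of_disc Ψ h0 hlev
  simpa only [hΨ, Γ, hφ0] using this

end Crossing

/-! ### Secant directions -/

section Strict

variable {E V : Type*} [NormedAddCommGroup E] [NormedSpace ℝ E] [NormedAddCommGroup V]
  [NormedSpace ℝ V] {φ : E → V} {D : E →L[ℝ] V} {x : E}

/-- A strict derivative acts on limits of secant directions. -/
lemma _root_.HasStrictFDerivAt.tendsto_secant (h : HasStrictFDerivAt φ D x) {α : Type*}
    {l : Filter α} {p q : α → E} {r : α → ℝ} {v : E} (hp : Tendsto p l (𝓝 x))
    (hq : Tendsto q l (𝓝 x)) (hv : Tendsto (fun k ↦ (r k)⁻¹ • (p k - q k)) l (𝓝 v)) :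
    Tendsto (fun k ↦ (r k)⁻¹ • (φ (p k) - φ (q k))) l (𝓝 (D v)) := by
  have h1 := h.isLittleO.comp_tendsto (hp.prodMk_nhds hq)
  have h2 : (fun k ↦ (r k)⁻¹ • (φ (p k) - φ (q k) - D (p k - q k))) =o[l]
      fun k ↦ (r k)⁻¹ • (p k - q k) :=
    (Asymptotics.isBigO_refl (fun k ↦ (r k)⁻¹) l).smul_isLittleO h1
  have h3 : (fun k ↦ (r k)⁻¹ • (φ (p k) - φ (q k) - D (p k - q k))) =o[l] fun _ ↦ (1:ℝ) :=
    h2.trans_isBigO (hv.isBigO_one ℝ)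
  have h4 := (Asymptotics.isLittleO_one_iff ℝ).1 h3
  have h5 := h4.add ((D.continuous.tendsto v).comp hv)
  rw [zero_add] at h5
  refine h5.congr fun k ↦ ?_
  simp only [Function.comp, map_smul, ← smul_add, sub_add_cancel]

/-- A map with an injective strict derivative does not contract distances too much near
the point. -/
lemma _root_.HasStrictFDerivAt.eventually_norm_sub_le [FiniteDimensional ℝ E]
    (h : HasStrictFDerivAt φ D x)
    (hD : Function.Injective D) : ∃ K : ℝ, ∀ᶠ p in 𝓝 (x, x),
      ‖p.1 - p.2‖ ≤ K * ‖φ p.1 - φ p.2‖ := by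
  obtain ⟨K, hK, hanti⟩ := D.toLinearMap.exists_antilipschitzWith (LinearMap.ker_eq_bot.2 hD)
  have hK' : (0:ℝ) < K := hK
  refine ⟨2 * K, ?_⟩
  have h1 := h.isLittleO.def (show 0 < (2 * (K:ℝ))⁻¹ by positivity)
  filter_upwards [h1] with p hp
  have h2 : ‖p.1 - p.2‖ ≤ K * ‖D (p.1 - p.2)‖ := by
    have := hanti.le_mul_dist p.1 p.2
    rw [dist_eq_norm, dist_eq_norm] at this
    rw [map_sub]; exact this
  have h3 : ‖D (p.1 - p.2)‖ ≤ ‖φ p.1 - φ p.2‖ + (2 * (K:ℝ))⁻¹ * ‖p.1 - p.2‖ := by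
    have := norm_sub_norm_le (D (p.1 - p.2)) (φ p.1 - φ p.2)
    rw [norm_sub_rev (D (p.1 - p.2)) (φ p.1 - φ p.2)] at this
    linarith
  have h4 : ‖p.1 - p.2‖ ≤ K * ‖φ p.1 - φ p.2‖ + ‖p.1 - p.2‖ / 2 := by
    calc ‖p.1 - p.2‖ ≤ K * (‖φ p.1 - φ p.2‖ + (2 * (K:ℝ))⁻¹ * ‖p.1 - p.2‖) := by
          refine h2.trans ?_; gcongr
      _ = _ := by field_simp
  linarith

end Strict

section SecantMap

variable {E H M E' H' N : Type*} [NormedAddCommGroup E] [NormedSpace ℝ E] [TopologicalSpace H]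
  {I : ModelWithCorners ℝ E H} [TopologicalSpace M] [ChartedSpace H M]
  [NormedAddCommGroup E'] [NormedSpace ℝ E'] [TopologicalSpace H'] {J : ModelWithCorners ℝ E' H'}
  [TopologicalSpace N] [ChartedSpace H' N] {G : M → N} {z : M}

lemma _root_.ContMDiffAt.hasStrictFDerivAt_written [I.Boundaryless] (hG : ContMDiffAt I J 1 G z) :
    HasStrictFDerivAt (writtenInExtChartAt I J z G) (mfderiv I J G z : E →L[ℝ] E')
      (extChartAt I z z) := by
  have h1 := (contMDiffAt_iff.1 hG).2
  rw [I.range_eq_univ, contDiffWithinAt_univ] at h1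
  have h2 := h1.hasStrictFDerivAt one_ne_zero
  have h3 : HasFDerivWithinAt (writtenInExtChartAt I J z G) (mfderiv I J G z : E →L[ℝ] E')
      (range I) (extChartAt I z z) := (hG.mdifferentiableAt one_ne_zero).hasMFDerivAt.2
  have h4 := h3.hasFDerivAt (by rw [I.range_eq_univ]; exact univ_mem)
  have h5 : HasStrictFDerivAt (writtenInExtChartAt I J z G) _ (extChartAt I z z) := h2
  exact (h5.hasFDerivAt.unique h4) ▸ h5

lemma eventually_written_eq {α : Type*} {l : Filter α} {a : α → M} (ha : Tendsto a l (𝓝 z)) :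
    ∀ᶠ k in l, writtenInExtChartAt I J z G (extChartAt I z (a k)) =
      extChartAt J (G z) (G (a k)) := by
  filter_upwards [ha.eventually_mem (extChartAt_source_mem_nhds (I := I) z)] with k hk
  simp only [writtenInExtChartAt, Function.comp, (extChartAt I z).left_inv hk]

lemma tendsto_extChartAt {α : Type*} {l : Filter α} {a : α → M} (ha : Tendsto a l (𝓝 z)) :
    Tendsto (fun k ↦ extChartAt I z (a k)) l (𝓝 (extChartAt I z z)) :=
  (continuousAt_extChartAt z).tendsto.comp ha

/-- The derivative of a `C¹` map acts on limits of secant directions. -/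
lemma tendsto_secant_map [I.Boundaryless] (hG : ContMDiffAt I J 1 G z)
    {α : Type*} {l : Filter α} {a b : α → M}
    {r : α → ℝ} {v : TangentSpace I z} (ha : Tendsto a l (𝓝 z)) (hb : Tendsto b l (𝓝 z))
    (hv : Tendsto (fun k ↦ (r k)⁻¹ • (extChartAt I z (a k) - extChartAt I z (b k))) l
      (𝓝 (v : E))) :
    Tendsto (fun k ↦ (r k)⁻¹ • (extChartAt J (G z) (G (a k)) - extChartAt J (G z) (G (b k)))) l
      (𝓝 (mfderiv I J G z v : E')) := by
  have h := hG.hasStrictFDerivAt_written.tendsto_secant (tendsto_extChartAt ha)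
    (tendsto_extChartAt hb) hv
  refine h.congr' ?_
  filter_upwards [eventually_written_eq (I := I) (J := J) (G := G) ha,
    eventually_written_eq (I := I) (J := J) (G := G) hb] with k h1 h2
  rw [h1, h2]

lemma eventually_chart_sub_le [I.Boundaryless] [FiniteDimensional ℝ E] (hG : ContMDiffAt I J 1 G z)
    (hi : Function.Injective (mfderiv I J G z)) {α : Type*} {l : Filter α} {a b : α → M}
    (ha : Tendsto a l (𝓝 z)) (hb : Tendsto b l (𝓝 z)) :
    ∃ K : ℝ, ∀ᶠ k in l, ‖extChartAt I z (a k) - extChartAt I z (b k)‖ ≤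
      K * ‖extChartAt J (G z) (G (a k)) - extChartAt J (G z) (G (b k))‖ := by
  obtain ⟨K, hK⟩ := hG.hasStrictFDerivAt_written.eventually_norm_sub_le hi
  refine ⟨K, ?_⟩
  have := ((tendsto_extChartAt (I := I) ha).prodMk_nhds (tendsto_extChartAt (I := I) hb)).eventually
    hK
  filter_upwards [this, eventually_written_eq (I := I) (J := J) (G := G) ha,
    eventually_written_eq (I := I) (J := J) (G := G) hb] with k h0 h1 h2
  rw [← h1, ← h2]
  exact h0

end SecantMap

lemma exists_ball_chart {M : Type*} [TopologicalSpace M]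
    [ChartedSpace (EuclideanSpace ℝ (Fin 3)) M] (z : M) {U : Set M} (hU : U ∈ 𝓝 z) : ∃ ρ > 0,
    ∀ p ∈ Metric.ball (extChartAt (𝓡 3) z z) ρ, p ∈ (extChartAt (𝓡 3) z).target ∧
      (extChartAt (𝓡 3) z).symm p ∈ U := by
  have h1 : ∀ᶠ p in 𝓝 (extChartAt (𝓡 3) z z), p ∈ (extChartAt (𝓡 3) z).target ∧
      (extChartAt (𝓡 3) z).symm p ∈ U := by
    refine Filter.Eventually.and (extChartAt_target_mem_nhds z) ?_
    have := (continuousAt_extChartAt_symm (I := 𝓡 3) z).tendsto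
    rw [extChartAt_to_inv] at this
    exact this hU
  obtain ⟨ρ, hρ, h⟩ := Metric.eventually_nhds_iff_ball.1 h1
  exact ⟨ρ, hρ, h⟩

section Plaques

variable {M : Type*} [MetricSpace M]
  [ChartedSpace (EuclideanSpace ℝ (Fin 3)) M] [IsManifold (𝓡 3) ∞ M]
  {F : SurfaceFoliation M} {P : ∀ x : M, Submodule ℝ (TangentSpace (𝓡 3) x)}

/-- The plane field is continuous, in the form: not to belong to the plane is an open condition
in the charts. -/
def IsClosedPlaneField (P : ∀ x : M, Submodule ℝ (TangentSpace (𝓡 3) x)) : Prop :=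
  ∀ (z : M) (v : EuclideanSpace ℝ (Fin 3)), v ∉ chartPlane P z z →
    ∀ᶠ p in 𝓝 (z, v), p.2 ∉ chartPlane P z p.1

lemma mem_chartPlane_self {z : M} {v : TangentSpace (𝓡 3) z} : v ∈ chartPlane P z z ↔ v ∈ P z := by
  rw [chartPlane, mfderiv_extChartAt_self]
  constructor
  · rintro ⟨w, hw, rfl⟩
    exact hw
  · exact fun h ↦ ⟨v, h, rfl⟩

/-- The chord between two points of a plaque, in a chart, is tangent to the plane field at some
point of this chord: otherwise the level of the plaques would be strictly monotone along the
chord. -/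
lemma exists_chord_mem [CompactSpace M] (hT : F.IsTangentTo P)
    (hP : ∀ x, Module.finrank ℝ (P x) = 2) {z : M}
    {e} (he : e ∈ F.atlas) {S : Set (EuclideanSpace ℝ (Fin 3))} (hS : Convex ℝ S)
    (hSt : ∀ p ∈ S, p ∈ (extChartAt (𝓡 3) z).target ∧ (extChartAt (𝓡 3) z).symm p ∈ e.source)
    {p q : EuclideanSpace ℝ (Fin 3)} (hp : p ∈ S) (hq : q ∈ S)
    (hlev : (e ((extChartAt (𝓡 3) z).symm p)).2 = (e ((extChartAt (𝓡 3) z).symm q)).2) :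
    ∃ m ∈ S, p - q ∈ chartPlane P z ((extChartAt (𝓡 3) z).symm m) := by
  set κ := extChartAt (𝓡 3) z
  have hline : ∀ t ∈ Icc (0:ℝ) 1, q + t • (p - q) ∈ S := fun t ht ↦
    hS.add_smul_sub_mem hq hp ht
  let g : ℝ → ℝ := fun t ↦ (e (κ.symm (q + t • (p - q)))).2
  have hgc : ContinuousOn g (Icc 0 1) := by
    refine continuous_snd.comp_continuousOn (e.continuousOn.comp
      ((continuousOn_extChartAt_symm z).comp (by fun_prop) fun t ht ↦ (hSt _ (hline t ht)).1)
      fun t ht ↦ (hSt _ (hline t ht)).2)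
  -- Rolle: the level takes equal values at the ends of the chord, so it has a local extremum.
  obtain ⟨t, ht, hext⟩ := exists_isLocalExtr_Ioo zero_lt_one hgc (by simp [g, hlev])
  have htI := Ioo_subset_Icc_self ht
  refine ⟨_, hline t htI, ?_⟩
  by_contra hv
  have hw := hSt _ (hline t htI)
  have hcr := crossesAt_line hT hP (κ.map_target hw.1) he hw.2 hv
  refine CrossesAt.not_isLocalExtr (g := g) (t := t) (CrossesAt.of_comp_add ?_) hext
  have hr : κ (κ.symm (q + t • (p - q))) = q + t • (p - q) := κ.right_inv hw.1
  rw [hr] at hcr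
  simpa only [g, add_smul, add_assoc] using hcr

/-- Limits of secant directions of the leaves are tangent to the plane field. -/
lemma secant_mem [CompactSpace M] (hT : F.IsTangentTo P) (hP : ∀ x, Module.finrank ℝ (P x) = 2)
    (hPc : IsClosedPlaneField P) {R : ℝ} (hR : 0 < R)
    (hRF : ∀ x : M, ∃ e ∈ F.atlas, Metric.ball x (2 * R) ⊆ e.source) {z : M}
    {α : Type*} {l : Filter α} [l.NeBot] {a b : α → M} {r : α → ℝ} {v : TangentSpace (𝓡 3) z}
    (ha : Tendsto a l (𝓝 z)) (hb : Tendsto b l (𝓝 z))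
    (hab : ∀ᶠ k in l, F.LeafConn R (a k) (b k))
    (hv : Tendsto (fun k ↦ (r k)⁻¹ • (extChartAt (𝓡 3) z (a k) - extChartAt (𝓡 3) z (b k))) l
      (𝓝 (v : EuclideanSpace ℝ (Fin 3)))) : v ∈ P z := by
  by_contra hvP
  rw [← mem_chartPlane_self] at hvP
  obtain ⟨e, he, hes⟩ := hRF z
  obtain ⟨U, hU, W, hW, hUW⟩ := mem_nhds_prod_iff.1 (hPc z v hvP)
  obtain ⟨ρ, hρ, hball⟩ := exists_ball_chart z
    (Filter.inter_mem hU (Metric.ball_mem_nhds z (show 0 < 2 * R by positivity)))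
  have hBn := Metric.ball_mem_nhds (extChartAt (𝓡 3) z z) hρ
  have hsrc := extChartAt_source_mem_nhds (I := 𝓡 3) z
  obtain ⟨k, hk, hkW, hka, hkb, hsa, hsb, hkR⟩ := (hab.and ((hv.eventually_mem hW).and
    (((tendsto_extChartAt (I := 𝓡 3) ha).eventually_mem hBn).and
    (((tendsto_extChartAt (I := 𝓡 3) hb).eventually_mem hBn).and ((ha.eventually_mem hsrc).and
    ((hb.eventually_mem hsrc).and
      (ha.eventually_mem (Metric.ball_mem_nhds z hR)))))))).exists
  have hlev : (e (a k)).2 = (e (b k)).2 := hk.level_eq he fun u hu ↦ hes (by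
    simp only [Metric.mem_ball] at *
    linarith [dist_triangle u (a k) z])
  obtain ⟨m, hm, hmem⟩ := exists_chord_mem hT hP he (convex_ball (extChartAt (𝓡 3) z z) ρ)
    (fun p hp ↦ ⟨(hball p hp).1, hes (hball p hp).2.2⟩) hka hkb
    (by rw [(extChartAt (𝓡 3) z).left_inv hsa, (extChartAt (𝓡 3) z).left_inv hsb, hlev])
  exact hUW (Set.mk_mem_prod (hball m hm).2.1 hkW) (Submodule.smul_mem _ _ hmem)

/-- Lines of a chart in a direction transverse to the foliation meet all nearby plaques. -/
lemma eventually_exists_foot [CompactSpace M] (hT : F.IsTangentTo P)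
    (hP : ∀ x, Module.finrank ℝ (P x) = 2)
    {z : M} {e} (he : e ∈ F.atlas) (hz : z ∈ e.source) {ν : EuclideanSpace ℝ (Fin 3)}
    (hν : ν ∉ chartPlane P z z) {ρ : ℝ} (hρ : 0 < ρ) :
    ∀ᶠ p in 𝓝 (z, z), ∃ t : ℝ, |t| < ρ ∧
      (e ((extChartAt (𝓡 3) z).symm (extChartAt (𝓡 3) z p.1 + t • ν))).2 = (e p.2).2 := by
  have hcr := crossesAt_line hT hP (mem_extChartAt_source z) he hz hν
  set κ := extChartAt (𝓡 3) z
  obtain ⟨σ, hσ, hball⟩ := exists_ball_chart z (e.open_source.mem_nhds hz)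
  have hκz : κ.symm (κ z) = z := extChartAt_to_inv z
  -- The line through `z` crosses the plaque of `z`: at the times `± s` its levels lie on the two
  -- sides of that of `z`. This persists nearby, and the intermediate value theorem applies.
  obtain ⟨s, hs0, hsρ, hs1, hs2, hcross⟩ : ∃ s > 0, s < ρ ∧ s * ‖ν‖ < σ / 2 ∧ 0 ≤ s * ‖ν‖ ∧
      (((e z).2 < (e (κ.symm (κ z + s • ν))).2 ∧ (e (κ.symm (κ z + (-s) • ν))).2 < (e z).2) ∨
      ((e (κ.symm (κ z + s • ν))).2 < (e z).2 ∧ (e z).2 < (e (κ.symm (κ z + (-s) • ν))).2)) := by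
    have h1 : ∀ᶠ s in 𝓝[>] (0:ℝ), s * ‖ν‖ < σ / 2 := by
      have : Tendsto (fun s : ℝ ↦ s * ‖ν‖) (𝓝 0) (𝓝 (0 * ‖ν‖)) :=
        Continuous.tendsto (by fun_prop) 0
      rw [zero_mul] at this
      exact nhdsWithin_le_nhds (this.eventually_lt_const (half_pos hσ))
    have h2 : ∀ᶠ s in 𝓝[>] (0:ℝ), s ∈ Ioo 0 ρ := Ioo_mem_nhdsGT hρ
    rcases hcr with h | h
    · obtain ⟨s, ha, hb, hc⟩ := (h.and (h1.and h2)).exists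
      refine ⟨s, hc.1, hc.2, hb, mul_nonneg hc.1.le (norm_nonneg _), .inl ?_⟩
      simpa [hκz] using ha
    · obtain ⟨s, ha, hb, hc⟩ := (h.and (h1.and h2)).exists
      refine ⟨s, hc.1, hc.2, hb, mul_nonneg hc.1.le (norm_nonneg _), .inr ?_⟩
      simpa [hκz] using ha
  have hin : ∀ t ∈ Icc (-s) s, ∀ p ∈ Metric.ball (κ z) (σ / 2), p + t • ν ∈
      Metric.ball (κ z) σ := by
    intro t ht p hp
    rw [mem_ball_iff_norm] at hp ⊢
    have h1 : ‖t • ν‖ ≤ s * ‖ν‖ := by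
      rw [norm_smul, Real.norm_eq_abs]
      gcongr
      exact abs_le.2 ht
    calc ‖p + t • ν - κ z‖ = ‖(p - κ z) + t • ν‖ := by congr 1; abel
      _ ≤ ‖p - κ z‖ + ‖t • ν‖ := norm_add_le _ _
      _ < σ := by linarith
  have hcontE : ∀ q ∈ Metric.ball (κ z) σ, ContinuousAt (fun q ↦ (e (κ.symm q)).2) q :=
    fun q hq ↦ continuous_snd.continuousAt.comp
      ((e.continuousAt (hball q hq).2).comp (continuousAt_extChartAt_symm'' (hball q hq).1))
  have hlim : ∀ t ∈ Icc (-s) s, Tendsto (fun p : M × M ↦ (e (κ.symm (κ p.1 + t • ν))).2)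
      (𝓝 (z, z)) (𝓝 (e (κ.symm (κ z + t • ν))).2) := by
    intro t ht
    have h1 : Tendsto (fun p : M × M ↦ κ p.1 + t • ν) (𝓝 (z, z)) (𝓝 (κ z + t • ν)) :=
      (tendsto_extChartAt (I := 𝓡 3) (continuous_fst.tendsto (z, z))).add_const _
    exact (hcontE _ (hin t ht _ (Metric.mem_ball_self (half_pos hσ)))).tendsto.comp h1
  have hlim2 : Tendsto (fun p : M × M ↦ (e p.2).2) (𝓝 (z, z)) (𝓝 (e z).2) :=
    ((continuous_snd.continuousAt.comp (e.continuousAt hz)).tendsto).comp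
      (continuous_snd.tendsto (z, z))
  have hnear : ∀ᶠ p : M × M in 𝓝 (z, z), κ p.1 ∈ Metric.ball (κ z) (σ / 2) :=
    (tendsto_extChartAt (I := 𝓡 3) (continuous_fst.tendsto (z, z))).eventually_mem
      (Metric.ball_mem_nhds _ (half_pos hσ))
  have hsI : s ∈ Icc (-s) s := ⟨by linarith, le_rfl⟩
  have hsI' : -s ∈ Icc (-s) s := ⟨le_rfl, by linarith⟩
  have hgc : ∀ p : M × M, κ p.1 ∈ Metric.ball (κ z) (σ / 2) →
      ContinuousOn (fun t : ℝ ↦ (e (κ.symm (κ p.1 + t • ν))).2) (Icc (-s) s) := by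
    intro p hp t ht
    exact ((hcontE _ (hin t ht _ hp)).comp (f := fun t : ℝ ↦ κ p.1 + t • ν)
      (by fun_prop)).continuousWithinAt
  have hfin : ∀ p : M × M, (∃ t ∈ Icc (-s) s, (e (κ.symm (κ p.1 + t • ν))).2 = (e p.2).2) →
      ∃ t : ℝ, |t| < ρ ∧ (e (κ.symm (κ p.1 + t • ν))).2 = (e p.2).2 := by
    rintro p ⟨t, ht, h⟩
    exact ⟨t, (abs_le.2 ht).trans_lt hsρ, h⟩
  rcases hcross with ⟨h1, h2⟩ | ⟨h1, h2⟩
  · filter_upwards [hlim2.eventually_lt (hlim s hsI) h1, (hlim (-s) hsI').eventually_lt hlim2 h2,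
      hnear] with p hp1 hp2 hp3
    exact hfin p (isPreconnected_Icc.intermediate_value hsI' hsI (hgc p hp3) ⟨hp2.le, hp1.le⟩)
  · filter_upwards [(hlim s hsI).eventually_lt hlim2 h1, hlim2.eventually_lt (hlim (-s) hsI') h2,
      hnear] with p hp1 hp2 hp3
    exact hfin p (isPreconnected_Icc.intermediate_value hsI hsI' (hgc p hp3) ⟨hp1.le, hp2.le⟩)

end Plaques

/-! ### Infinitesimal expansion transverse to a foliation -/

/-- The derivative of a map at a point, as a linear map between the model vector spaces, to which
the tangent spaces are equal by definition. Norms and limits of tangent vectors at varying points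
make sense there. -/
noncomputable def modelDeriv {E H M E' H' N : Type*} [NormedAddCommGroup E] [NormedSpace ℝ E]
    [TopologicalSpace H] (I : ModelWithCorners ℝ E H) [TopologicalSpace M] [ChartedSpace H M]
    [NormedAddCommGroup E'] [NormedSpace ℝ E'] [TopologicalSpace H'] (J : ModelWithCorners ℝ E' H')
    [TopologicalSpace N] [ChartedSpace H' N] (G : M → N) (z : M) : E →L[ℝ] E' :=
  mfderiv I J G z

section Expansion

variable {M : Type*} [MetricSpace M] [CompactSpace M]
  [ChartedSpace (EuclideanSpace ℝ (Fin 3)) M] [IsManifold (𝓡 3) ∞ M]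
  {F : SurfaceFoliation M} {P : ∀ x : M, Submodule ℝ (TangentSpace (𝓡 3) x)}
  {V : Type*} [NormedAddCommGroup V] [NormedSpace ℝ V] {ι : M → V}

/-- If small triangles `a`, `b`, `c`, with `b - a` in the direction `ν` and with `c` in the plaque
of `G b`, violate the expansion of distances by the factor two, then so does, in the limit, the
vector `ν` modulo the plane field. -/
lemma exists_mem_norm_le (hT : F.IsTangentTo P) (hP : ∀ x, Module.finrank ℝ (P x) = 2)
    (hPc : IsClosedPlaneField P) {R : ℝ} (hR : 0 < R)
    (hRF : ∀ x : M, ∃ e ∈ F.atlas, Metric.ball x (2 * R) ⊆ e.source)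
    (hι : ContMDiff (𝓡 3) 𝓘(ℝ, V) 1 ι)
    (hιd : ∀ x, Function.Injective (modelDeriv (𝓡 3) 𝓘(ℝ, V) ι x))
    {G : M → M} (hG : ContMDiff (𝓡 3) (𝓡 3) 1 G) {z : M} {ν : EuclideanSpace ℝ (Fin 3)}
    {a b c : ℕ → M} {t : ℕ → ℝ} (ha : Tendsto a atTop (𝓝 z)) (hb : Tendsto b atTop (𝓝 z))
    (hc : Tendsto c atTop (𝓝 (G z))) (ht : ∀ᶠ k in atTop, t k ≠ 0)
    (hab : ∀ᶠ k in atTop, extChartAt (𝓡 3) z (b k) - extChartAt (𝓡 3) z (a k) =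
      t k • ν)
    (hcb : ∀ᶠ k in atTop, F.LeafConn R (c k) (G (b k)))
    (hle : ∀ᶠ k in atTop, ‖ι (G (a k)) - ι (c k)‖ ≤ 2 * ‖ι (a k) - ι (b k)‖) :
    ∃ p : EuclideanSpace ℝ (Fin 3), p ∈ P (G z) ∧
      ‖modelDeriv (𝓡 3) 𝓘(ℝ, V) ι (G z) (modelDeriv (𝓡 3) (𝓡 3) G z ν + p)‖ ≤
      2 * ‖modelDeriv (𝓡 3) 𝓘(ℝ, V) ι z ν‖ := by
  have hGa := (hG.continuous.tendsto z).comp ha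
  have hGb := (hG.continuous.tendsto z).comp hb
  have s0 : Tendsto (fun k ↦ (t k)⁻¹ • (extChartAt (𝓡 3) z (b k) - extChartAt (𝓡 3) z (a k)))
      atTop (𝓝 ν) := by
    refine tendsto_const_nhds.congr' ?_
    filter_upwards [ht, hab] with k h1 h2
    rw [h2, smul_smul, inv_mul_cancel₀ h1, one_smul]
  have s1 := tendsto_secant_map (hG z) hb ha s0
  have s2 : Tendsto (fun k ↦ (t k)⁻¹ • (ι (b k) - ι (a k))) atTop
      (𝓝 (modelDeriv (𝓡 3) 𝓘(ℝ, V) ι z ν)) := tendsto_secant_map (hι z) hb ha s0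
  have s3 : Tendsto (fun k ↦ (t k)⁻¹ • (ι (G (b k)) - ι (G (a k)))) atTop
      (𝓝 (modelDeriv (𝓡 3) 𝓘(ℝ, V) ι (G z) (modelDeriv (𝓡 3) (𝓡 3) G z ν))) :=
    tendsto_secant_map (hι (G z)) hGb hGa s1
  obtain ⟨K, hK⟩ := eventually_chart_sub_le (hι (G z)) (hιd (G z)) hc hGb
  -- the secants from `G b` to `c` are bounded, hence accumulate on some tangent vector
  let B : ℕ → ℝ := fun k ↦ |K| * (2 * ‖(t k)⁻¹ • (ι (b k) - ι (a k))‖ +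
    ‖(t k)⁻¹ • (ι (G (b k)) - ι (G (a k)))‖)
  obtain ⟨B0, hB0⟩ : ∃ B0, ∀ᶠ k in atTop, B k < B0 := by
    have : Tendsto B atTop (𝓝 _) := ((s2.norm.const_mul 2).add s3.norm).const_mul |K|
    exact ⟨_, this.eventually_lt_const (lt_add_one _)⟩
  let u : ℕ → EuclideanSpace ℝ (Fin 3) := fun k ↦
    (t k)⁻¹ • (extChartAt (𝓡 3) (G z) (c k) - extChartAt (𝓡 3) (G z) (G (b k)))
  have hu : ∀ᶠ k in atTop, u k ∈ Metric.closedBall 0 B0 := by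
    filter_upwards [hB0, hK, hle] with k h1 h2 h3
    rw [mem_closedBall_zero_iff]
    refine le_trans ?_ h1.le
    simp only [u, B, norm_smul]
    have h4 : ‖ι (c k) - ι (G (b k))‖ ≤ 2 * ‖ι (b k) - ι (a k)‖ + ‖ι (G (b k)) - ι (G (a k))‖ := by
      have h5 := norm_sub_le_norm_sub_add_norm_sub (ι (c k)) (ι (G (a k))) (ι (G (b k)))
      rw [norm_sub_rev (ι (c k)) (ι (G (a k))), norm_sub_rev (ι (G (a k))) (ι (G (b k)))] at h5
      rw [norm_sub_rev (ι (a k))] at h3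
      linarith
    calc ‖(t k)⁻¹‖ * ‖extChartAt (𝓡 3) (G z) (c k) - extChartAt (𝓡 3) (G z) (G (b k))‖
        ≤ ‖(t k)⁻¹‖ * (|K| * (2 * ‖ι (b k) - ι (a k)‖ + ‖ι (G (b k)) - ι (G (a k))‖)) := by
          gcongr
          refine h2.trans ?_
          refine (mul_le_mul_of_nonneg_right (le_abs_self K) (norm_nonneg _)).trans ?_
          exact mul_le_mul_of_nonneg_left h4 (abs_nonneg K)
      _ = _ := by ring
  obtain ⟨p, -, φ, hφ, hp⟩ :=
    tendsto_subseq_of_frequently_bounded Metric.isBounded_closedBall hu.frequently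
  have hφt := hφ.tendsto_atTop
  have hpP : p ∈ P (G z) := secant_mem (v := p) hT hP hPc hR hRF (hc.comp hφt) (hGb.comp hφt)
    (hφt.eventually hcb) hp
  refine ⟨p, hpP, ?_⟩
  have s4 : Tendsto (fun k ↦ (t (φ k))⁻¹ • (extChartAt (𝓡 3) (G z) (c (φ k)) -
      extChartAt (𝓡 3) (G z) (G (a (φ k))))) atTop
      (𝓝 ((modelDeriv (𝓡 3) (𝓡 3) G z ν) + p)) := by
    refine ((Tendsto.comp s1 hφt).add hp).congr fun k ↦ ?_
    simp only [Function.comp, u, ← smul_add]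
    congr 1
    abel
  have s5 : Tendsto (fun k ↦ (t (φ k))⁻¹ • (ι (c (φ k)) - ι (G (a (φ k))))) atTop
      (𝓝 (modelDeriv (𝓡 3) 𝓘(ℝ, V) ι (G z) (modelDeriv (𝓡 3) (𝓡 3) G z ν + p))) :=
    tendsto_secant_map (v := modelDeriv (𝓡 3) (𝓡 3) G z ν + p) (hι (G z)) (hc.comp hφt)
      (hGa.comp hφt) s4
  refine le_of_tendsto_of_tendsto s5.norm ((s2.comp hφt).norm.const_mul 2) ?_
  filter_upwards [hφt.eventually hle] with k h
  simp only [Function.comp, norm_smul]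
  rw [norm_sub_rev (ι (b (φ k))), norm_sub_rev (ι (c (φ k)))]
  calc _ ≤ ‖(t (φ k))⁻¹‖ * (2 * ‖ι (a (φ k)) - ι (b (φ k))‖) := by gcongr
    _ = _ := by ring

/-- Infinitesimal expansion transverse to the leaves, modulo their tangent planes, makes the
inverse map contract the distances to leaves. -/
lemma contracts_of_expands (hT : F.IsTangentTo P) (hP : ∀ x, Module.finrank ℝ (P x) = 2)
    (hPc : IsClosedPlaneField P) (hι : ContMDiff (𝓡 3) 𝓘(ℝ, V) 1 ι)
    (hιi : Function.Injective ι)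
    (hιd : ∀ x, Function.Injective (modelDeriv (𝓡 3) 𝓘(ℝ, V) ι x))
    {G : M ≃ₜ M} (hG : ContMDiff (𝓡 3) (𝓡 3) 1 G) (hGF : ∀ x, G '' F.leaf x = F.leaf (G x))
    (hE : ∀ z, ∃ ν : EuclideanSpace ℝ (Fin 3), ν ∉ P z ∧
      ∀ p : EuclideanSpace ℝ (Fin 3), p ∈ P (G z) →
      2 * ‖modelDeriv (𝓡 3) 𝓘(ℝ, V) ι z ν‖ <
        ‖modelDeriv (𝓡 3) 𝓘(ℝ, V) ι (G z) (modelDeriv (𝓡 3) (𝓡 3) G z ν + p)‖) :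
    Contracts F G ι := by
  intro r hr
  by_contra! hcon
  -- A sequence of counterexamples accumulates at some `z`. The point `b k` is the foot of `a k`, in
  -- the direction `ν` of a chart at `z`, on the plaque of `G⁻¹ (c k)`.
  choose a c hac hbad using fun k : ℕ ↦ hcon (1 / ((k : ℝ) + 1)) (by positivity)
  obtain ⟨R0, hR0, hRF⟩ := F.exists_lebesgue
  obtain ⟨z, -, φ, hφ, hz⟩ := isCompact_univ.tendsto_subseq (x := a) fun _ ↦ mem_univ _
  obtain ⟨ν, hνP, hν⟩ := hE z
  have hGz : Tendsto (fun k ↦ G (a (φ k))) atTop (𝓝 (G z)) := (G.continuous.tendsto z).comp hz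
  have hcz : Tendsto (fun k ↦ c (φ k)) atTop (𝓝 (G z)) := by
    refine hGz.congr_dist ?_
    rw [Metric.tendsto_atTop]
    intro ε hε
    obtain ⟨δ, hδ, h⟩ := dist_lt_of_norm_lt hι.continuous hιi hε
    obtain ⟨n, hn⟩ := exists_nat_one_div_lt hδ
    refine ⟨n, fun k hk ↦ ?_⟩
    rw [Real.dist_0_eq_abs, abs_of_nonneg dist_nonneg]
    refine h _ _ ((hac _).trans (lt_of_le_of_lt ?_ hn))
    gcongr
    exact hk.trans hφ.le_apply
  have hbz : Tendsto (fun k ↦ G.symm (c (φ k))) atTop (𝓝 z) := by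
    have := (G.symm.continuous.tendsto (G z)).comp hcz
    rwa [G.symm_apply_apply] at this
  obtain ⟨δ, hδ, hδG⟩ := Metric.uniformContinuous_iff.1
    (CompactSpace.uniformContinuous_of_continuous G.continuous) (R0 / 2) (half_pos hR0)
  obtain ⟨e, he, hes⟩ := hRF z
  have hez := hes (Metric.mem_ball_self hR0)
  obtain ⟨ε, hε, hεs, hεl⟩ := SurfaceFoliation.exists_ball_leafConn he hez (lt_min hr hδ)
  have hfoot : ∀ n : ℕ, ∀ᶠ k in atTop, ∃ t : ℝ, |t| < 1 / ((n : ℝ) + 1) ∧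
      (e ((extChartAt (𝓡 3) z).symm (extChartAt (𝓡 3) z (a (φ k)) +
        t • ν))).2 = (e (G.symm (c (φ k)))).2 := fun n ↦
    (hz.prodMk_nhds hbz).eventually (eventually_exists_foot (ν := ν) hT hP he hez
      (fun h ↦ hνP (mem_chartPlane_self.1 h)) (by positivity))
  obtain ⟨θ, hθ, hfoot⟩ := extraction_forall_of_eventually hfoot
  choose t ht hlev using hfoot
  have hθt := hθ.tendsto_atTop
  have ht0 : Tendsto t atTop (𝓝 0) :=
    squeeze_zero_norm (fun n ↦ (ht n).le) tendsto_one_div_add_atTop_nhds_zero_nat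
  have hp : Tendsto (fun k ↦ extChartAt (𝓡 3) z (a (φ (θ k))) +
      t k • ν) atTop (𝓝 (extChartAt (𝓡 3) z z)) := by
    have := (tendsto_extChartAt (I := 𝓡 3) (hz.comp hθt)).add
      (ht0.smul_const ν)
    rwa [zero_smul, add_zero] at this
  let b : ℕ → M := fun k ↦ (extChartAt (𝓡 3) z).symm (extChartAt (𝓡 3) z (a (φ (θ k))) +
      t k • ν)
  have hb : Tendsto b atTop (𝓝 z) := by
    have := (continuousAt_extChartAt_symm (I := 𝓡 3) z).tendsto.comp hp
    rwa [extChartAt_to_inv] at this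
  have hconn : ∀ᶠ k in atTop, F.LeafConn (min r δ) (G.symm (c (φ (θ k)))) (b k) := by
    filter_upwards [(hbz.comp hθt).eventually_mem (Metric.ball_mem_nhds z hε),
      hb.eventually_mem (Metric.ball_mem_nhds z hε)] with k h1 h2
    exact hεl _ h1 _ h2 (hlev k).symm
  have hlt : ∀ᶠ k in atTop, ‖ι (G (a (φ (θ k)))) - ι (c (φ (θ k)))‖ / 2 <
      ‖ι (a (φ (θ k))) - ι (b k)‖ := by
    filter_upwards [hconn] with k h
    exact hbad _ _ (h.mono (min_le_left _ _))
  -- The foot differs from `a k` (`t k ≠ 0`), since the contraction fails at the pair.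
  obtain ⟨p, hpP, hpl⟩ := exists_mem_norm_le (ν := ν) (t := t) hT hP hPc (half_pos hR0)
    (by rwa [mul_div_cancel₀ _ two_ne_zero]) hι hιd hG (hz.comp hθt) hb (hcz.comp hθt) (by
      filter_upwards [hlt, (hz.comp hθt).eventually_mem (extChartAt_source_mem_nhds (I := 𝓡 3) z)]
        with k h1 h2 h3
      have h4 : b k = a (φ (θ k)) := by
        simp only [b, h3, zero_smul, add_zero]
        exact (extChartAt (𝓡 3) z).left_inv h2
      rw [h4, sub_self, norm_zero] at h1
      linarith [norm_nonneg (ι (G (a (φ (θ k)))) - ι (c (φ (θ k))))]) (by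
      filter_upwards [hp.eventually_mem (extChartAt_target_mem_nhds (I := 𝓡 3) z)] with k h
      simp only [b, Function.comp]
      rw [(extChartAt (𝓡 3) z).right_inv h, add_sub_cancel_left]) (by
      filter_upwards [hconn] with k h
      have := h.map G.continuous (fun x ↦ (hGF x).le) (r' := R0 / 2)
        fun u v huv ↦ hδG (huv.trans_le (min_le_right _ _))
      rwa [G.apply_symm_apply] at this) (by
      filter_upwards [hlt] with k h
      simp only [Function.comp]
      linarith)
  exact (hν p hpP).not_ge hpl

end Expansion

/-! ### Continuous line fields -/

section Sections

variable {M : Type*} [MetricSpace M] [ChartedSpace (EuclideanSpace ℝ (Fin 3)) M]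
  [IsManifold (𝓡 3) ∞ M]

lemma continuous_modelDeriv_bundle {V : Type*} [NormedAddCommGroup V] [NormedSpace ℝ V] {ι : M → V}
    (hι : ContMDiff (𝓡 3) 𝓘(ℝ, V) 1 ι) :
    Continuous fun p : TangentBundle (𝓡 3) M ↦ modelDeriv (𝓡 3) 𝓘(ℝ, V) ι p.1 p.2 := by
  have h := hι.continuous_tangentMap le_rfl
  exact continuous_snd.comp ((tangentBundleModelSpaceHomeomorph 𝓘(ℝ, V)).continuous.comp h)

lemma continuous_inner_bundle (ρ : RiemMetric M) :
    Continuous fun p : TangentBundle (𝓡 3) M ↦ ρ.inner p.1 p.2 p.2 := by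
  have h : Continuous fun p : TangentBundle (𝓡 3) M ↦ (⟨p.1, ρ.inner p.1 p.2 p.2⟩ :
      Bundle.TotalSpace ℝ (Bundle.Trivial M ℝ)) :=
    Continuous.clm_bundle_apply₂ (F₁ := EuclideanSpace ℝ (Fin 3))
      (F₂ := EuclideanSpace ℝ (Fin 3)) (b := fun p : TangentBundle (𝓡 3) M ↦ p.1)
      (ρ.contMDiff.continuous.comp (FiberBundle.continuous_proj _ _)) continuous_id continuous_id
  exact continuous_snd.comp ((Bundle.Trivial.homeomorphProd M ℝ).continuous.comp h)

lemma continuousAt_modelDeriv_extChartAt {z : M} {v : ∀ y : M, TangentSpace (𝓡 3) y}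
    (hv : ContinuousAt (fun y ↦ (⟨y, v y⟩ : TangentBundle (𝓡 3) M)) z) :
    ContinuousAt (fun y ↦ modelDeriv (𝓡 3) 𝓘(ℝ, EuclideanSpace ℝ (Fin 3)) (extChartAt (𝓡 3) z) y
      (v y)) z := by
  have h1 := (FiberBundle.continuousAt_totalSpace (EuclideanSpace ℝ (Fin 3)) _).1 hv
  refine h1.2.congr ?_
  filter_upwards [(chartAt (EuclideanSpace ℝ (Fin 3)) z).open_source.mem_nhds
    (mem_chart_source _ z)] with y hy
  have h2 := TangentBundle.continuousLinearMapAt_trivializationAt (I := 𝓡 3) hy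
  rw [modelDeriv]
  have h3 := DFunLike.congr_fun h2 (v y)
  refine Eq.trans ?_ h3
  rw [Bundle.Trivialization.continuousLinearMapAt_apply,
    Bundle.Trivialization.coe_linearMapAt_of_mem]
  exact hy

lemma modelDeriv_extChartAt_self (z : M) (x : EuclideanSpace ℝ (Fin 3)) :
    modelDeriv (𝓡 3) 𝓘(ℝ, EuclideanSpace ℝ (Fin 3)) (extChartAt (𝓡 3) z) z x = x := by
  rw [modelDeriv, mfderiv_extChartAt_self]
  rfl

end Sections

section Frames

/-- The coefficients of a vector in a linearly independent family are bounded by its norm, uniformly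
under small perturbations of the family. -/
lemma exists_norm_le_of_linearIndependent {V κ : Type*} [NormedAddCommGroup V] [NormedSpace ℝ V]
    [Fintype κ] {f : κ → V} (hf : LinearIndependent ℝ f) :
    ∃ C : ℝ, ∀ᶠ g in 𝓝 f, ∀ s : κ → ℝ, ‖s‖ ≤ C * ‖∑ i, s i • g i‖ := by
  have hker : LinearMap.ker (Fintype.linearCombination ℝ f) = ⊥ := by
    rwa [LinearMap.ker_eq_bot, ← linearIndependent_iff_injective_fintypeLinearCombination]
  obtain ⟨K, hK, hanti⟩ := (Fintype.linearCombination ℝ f).exists_antilipschitzWith hker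
  have hK' : (0:ℝ) < K := hK
  let c : ℝ := Fintype.card κ + 1
  have hc : 0 < c := by positivity
  refine ⟨2 * K, ?_⟩
  filter_upwards [Metric.ball_mem_nhds f (show 0 < (2 * (K:ℝ) * c)⁻¹ by positivity)] with g hg s
  rw [mem_ball_iff_norm] at hg
  have h1 : ‖s‖ ≤ K * ‖∑ i, s i • f i‖ := by
    have := hanti.le_mul_dist s 0
    rwa [map_zero, dist_zero_right, dist_zero_right, Fintype.linearCombination_apply] at this
  have h2 : ‖∑ i, s i • (f i - g i)‖ ≤ c * (‖s‖ * (2 * (K:ℝ) * c)⁻¹) := by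
    calc ‖∑ i, s i • (f i - g i)‖ ≤ ∑ i : κ, ‖s‖ * (2 * (K:ℝ) * c)⁻¹ := by
          refine norm_sum_le_of_le _ fun i _ ↦ ?_
          rw [norm_smul, norm_sub_rev]
          exact mul_le_mul (norm_le_pi_norm s i) ((norm_le_pi_norm (g - f) i).trans hg.le)
            (norm_nonneg _) (norm_nonneg _)
      _ = Fintype.card κ * (‖s‖ * (2 * (K:ℝ) * c)⁻¹) := by simp
      _ ≤ _ := by
          gcongr
          simp [c]
  have h3 : ‖∑ i, s i • f i‖ ≤ ‖∑ i, s i • g i‖ + ‖∑ i, s i • (f i - g i)‖ := by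
    refine le_trans (le_of_eq ?_) (norm_add_le _ _)
    rw [← Finset.sum_add_distrib]
    simp [smul_sub]
  have h4 : K * (c * (‖s‖ * (2 * (K:ℝ) * c)⁻¹)) = ‖s‖ / 2 := by field_simp
  have h5 := mul_le_mul_of_nonneg_left (h3.trans (add_le_add_right h2 _)) hK'.le
  rw [mul_add, h4] at h5
  linarith

lemma linearIndependent_of_span_sup_eq_top {v a b : EuclideanSpace ℝ (Fin 3)}
    (h : Submodule.span ℝ {v} ⊔ (Submodule.span ℝ {a} ⊔ Submodule.span ℝ {b}) = ⊤) :
    LinearIndependent ℝ ![v, a, b] := by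
  refine linearIndependent_of_top_le_span_of_card_eq_finrank ?_ (by simp)
  rw [← h, ← Submodule.span_union, ← Submodule.span_union]
  refine Submodule.span_mono ?_
  rintro x (h | h | h)
  · exact ⟨0, h.symm⟩
  · exact ⟨1, h.symm⟩
  · exact ⟨2, h.symm⟩

lemma notMem_span_of_linearIndependent {v a b : EuclideanSpace ℝ (Fin 3)}
    (h : LinearIndependent ℝ ![v, a, b]) :
    v ∉ Submodule.span ℝ {a} ⊔ Submodule.span ℝ {b} := by
  have h2 := (linearIndependent_finCons.1 h).2
  rwa [Matrix.range_cons, Matrix.range_cons, Matrix.range_empty, union_empty,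
    Submodule.span_union] at h2

lemma chartPlane_span_sup {M : Type*} [MetricSpace M] [ChartedSpace (EuclideanSpace ℝ (Fin 3)) M]
    {K₁ K₂ : ∀ x : M, Submodule ℝ (TangentSpace (𝓡 3) x)} {z y : M} {a b : EuclideanSpace ℝ (Fin 3)}
    (h₁ : K₁ y = Submodule.span ℝ {a}) (h₂ : K₂ y = Submodule.span ℝ {b}) :
    chartPlane (fun x ↦ K₁ x ⊔ K₂ x) z y =
      Submodule.span ℝ {modelDeriv (𝓡 3) 𝓘(ℝ, EuclideanSpace ℝ (Fin 3)) (extChartAt (𝓡 3) z) y a} ⊔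
      Submodule.span ℝ
        {modelDeriv (𝓡 3) 𝓘(ℝ, EuclideanSpace ℝ (Fin 3)) (extChartAt (𝓡 3) z) y b} := by
  have h (D : EuclideanSpace ℝ (Fin 3) →L[ℝ] EuclideanSpace ℝ (Fin 3)) :
      (Submodule.span ℝ {a} ⊔ Submodule.span ℝ {b}).map D.toLinearMap =
        Submodule.span ℝ {D a} ⊔ Submodule.span ℝ {D b} := by
    rw [Submodule.map_sup, Submodule.map_span, Submodule.map_span, image_singleton,
      image_singleton]
    rfl
  rw [chartPlane, h₁, h₂]
  exact h (modelDeriv (𝓡 3) 𝓘(ℝ, EuclideanSpace ℝ (Fin 3)) (extChartAt (𝓡 3) z) y)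

lemma eventually_notMem_span {X : Type*} [TopologicalSpace X] {z : X}
    {α β : X → EuclideanSpace ℝ (Fin 3)} (hα : ContinuousAt α z) (hβ : ContinuousAt β z)
    (hab : LinearIndependent ℝ ![α z, β z]) {w : EuclideanSpace ℝ (Fin 3)}
    (hw : w ∉ Submodule.span ℝ {α z} ⊔ Submodule.span ℝ {β z})
    {Q : X → Submodule ℝ (EuclideanSpace ℝ (Fin 3))}
    (hQ : ∀ᶠ y in 𝓝 z, Q y = Submodule.span ℝ {α y} ⊔ Submodule.span ℝ {β y}) :
    ∀ᶠ p in 𝓝 (z, w), p.2 ∉ Q p.1 := by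
  have hfst : Tendsto Prod.fst (𝓝 (z, w)) (𝓝 z) := continuous_fst.tendsto (z, w)
  have hind : LinearIndependent ℝ ![w, α z, β z] := by
    refine linearIndependent_finCons.2 ⟨hab, ?_⟩
    rwa [Matrix.range_cons, Matrix.range_cons, Matrix.range_empty, union_empty,
      Submodule.span_union]
  have hcont : Tendsto (fun p : X × EuclideanSpace ℝ (Fin 3) ↦ ![p.2, α p.1, β p.1]) (𝓝 (z, w))
      (𝓝 ![w, α z, β z]) :=
    (continuous_snd.tendsto (z, w)).matrixVecCons ((hα.tendsto.comp hfst).matrixVecCons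
      ((hβ.tendsto.comp hfst).matrixVecCons tendsto_const_nhds))
  filter_upwards [hcont.eventually hind.eventually, hfst.eventually hQ] with p h1 h2
  rw [h2]
  exact notMem_span_of_linearIndependent h1

variable {M : Type*} [MetricSpace M] [ChartedSpace (EuclideanSpace ℝ (Fin 3)) M]
  [IsManifold (𝓡 3) ∞ M] {L K₁ K₂ : ∀ x : M, Submodule ℝ (TangentSpace (𝓡 3) x)}

/-- A continuous line field has local generators, continuous at the given point. -/
lemma IsContinuousLineField.exists_generator (hL : IsContinuousLineField L) (z : M) :
    ∃ v : M → EuclideanSpace ℝ (Fin 3),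
      ContinuousAt (fun y ↦ (⟨y, v y⟩ : TangentBundle (𝓡 3) M)) z ∧
      ∀ᶠ y in 𝓝 z, v y ≠ 0 ∧ L y = Submodule.span ℝ {v y} := by
  obtain ⟨U, hU, v, hv, h⟩ := hL z
  exact ⟨v, hv.continuousAt hU, Filter.eventually_of_mem hU h⟩

/-- Two of three complementary line fields span a plane field. -/
lemma finrank_sup_eq_two (hL : IsContinuousLineField L) (h₁ : IsContinuousLineField K₁)
    (h₂ : IsContinuousLineField K₂) (hs : ∀ x, L x ⊔ (K₁ x ⊔ K₂ x) = ⊤) (z : M) :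
    Module.finrank ℝ (K₁ z ⊔ K₂ z : Submodule ℝ (TangentSpace (𝓡 3) z)) = 2 := by
  obtain ⟨v, -, hv⟩ := hL.exists_generator z
  obtain ⟨a, -, ha⟩ := h₁.exists_generator z
  obtain ⟨b, -, hb⟩ := h₂.exists_generator z
  have h := hs z
  rw [hv.self_of_nhds.2, ha.self_of_nhds.2, hb.self_of_nhds.2] at h
  have h1 := (linearIndependent_finCons.1 (linearIndependent_of_span_sup_eq_top h)).1
  have h2 := finrank_span_eq_card h1
  rw [Matrix.range_cons, Matrix.range_cons, Matrix.range_empty, union_empty,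
    Submodule.span_union] at h2
  rw [ha.self_of_nhds.2, hb.self_of_nhds.2]
  exact h2

/-- The plane field spanned by two of three complementary line fields is continuous. -/
lemma isClosedPlaneField_sup (hL : IsContinuousLineField L) (h₁ : IsContinuousLineField K₁)
    (h₂ : IsContinuousLineField K₂) (hs : ∀ x, L x ⊔ (K₁ x ⊔ K₂ x) = ⊤) :
    IsClosedPlaneField fun x ↦ K₁ x ⊔ K₂ x := by
  intro z w hw
  obtain ⟨v, -, hv⟩ := hL.exists_generator z
  obtain ⟨a, hac, ha⟩ := h₁.exists_generator z
  obtain ⟨b, hbc, hb⟩ := h₂.exists_generator z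
  have hac' := continuousAt_modelDeriv_extChartAt (v := a) hac
  have hbc' := continuousAt_modelDeriv_extChartAt (v := b) hbc
  have h := hs z
  rw [hv.self_of_nhds.2, ha.self_of_nhds.2, hb.self_of_nhds.2] at h
  have hab := (linearIndependent_finCons.1 (linearIndependent_of_span_sup_eq_top h)).1
  rw [chartPlane_span_sup ha.self_of_nhds.2 hb.self_of_nhds.2] at hw
  have hplane : ∀ᶠ y in 𝓝 z, chartPlane (fun x ↦ K₁ x ⊔ K₂ x) z y = _ :=
    (ha.and hb).mono fun y hy ↦ chartPlane_span_sup hy.1.2 hy.2.2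
  refine eventually_notMem_span hac' hbc' ?_ hw hplane
  rw [modelDeriv_extChartAt_self, modelDeriv_extChartAt_self]
  exact hab

end Frames

/-! ### Uniform estimates on line fields -/

/-- On a compact space, a locally uniform bound is uniform. -/
lemma exists_forall_of_eventually {X β : Type*} [TopologicalSpace X] [CompactSpace X]
    [SemilatticeSup β] [Nonempty β] {p : β → X → Prop}
    (hmono : ∀ c d x, c ≤ d → p c x → p d x) (h : ∀ x, ∃ c, ∀ᶠ y in 𝓝 x, p c y) :
    ∃ c, ∀ x, p c x := by
  obtain ⟨c, hc⟩ := isCompact_univ.induction_on (p := fun s : Set X ↦ ∃ c, ∀ x ∈ s, p c x)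
    ⟨Classical.arbitrary β, by simp⟩ (fun s t hst ⟨c, hc⟩ ↦ ⟨c, fun x hx ↦ hc x (hst hx)⟩)
    (fun s t ⟨c, hc⟩ ⟨d, hd⟩ ↦ ⟨c ⊔ d, fun x hx ↦ hx.elim
      (fun hx ↦ hmono _ _ _ le_sup_left (hc x hx)) fun hx ↦ hmono _ _ _ le_sup_right (hd x hx)⟩)
    (fun x _ ↦ by
      obtain ⟨c, hc⟩ := h x
      exact ⟨_, nhdsWithin_le_nhds hc, c, fun y hy ↦ hy⟩)
  exact ⟨c, fun x ↦ hc x (mem_univ x)⟩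

section Norms

variable {M : Type*} [MetricSpace M] [ChartedSpace (EuclideanSpace ℝ (Fin 3)) M]
  [IsManifold (𝓡 3) ∞ M]

/-- A continuous family of absolutely homogeneous functions on the tangent spaces. -/
structure IsContinuousGauge (q : M → EuclideanSpace ℝ (Fin 3) → ℝ) : Prop where
  continuous : Continuous fun p : TangentBundle (𝓡 3) M ↦ q p.1 p.2
  map_smul : ∀ x s v, q x (s • v) = |s| * q x v

lemma isContinuousGauge_norm {V : Type*} [NormedAddCommGroup V] [NormedSpace ℝ V] {ι : M → V}
    (hι : ContMDiff (𝓡 3) 𝓘(ℝ, V) 1 ι) :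
    IsContinuousGauge fun x v ↦ ‖modelDeriv (𝓡 3) 𝓘(ℝ, V) ι x v‖ where
  continuous := (continuous_modelDeriv_bundle hι).norm
  map_smul x s v := by rw [map_smul, norm_smul, Real.norm_eq_abs]

lemma length_smul (ρ : RiemMetric M) {x : M} (s : ℝ) (v : TangentSpace (𝓡 3) x) :
    ρ.length (s • v) = |s| * ρ.length v := by
  rw [RiemMetric.length, RiemMetric.length, map_smul, map_smul]
  simp only [smul_eq_mul, smul_apply]
  rw [← mul_assoc, Real.sqrt_mul (mul_self_nonneg s), Real.sqrt_mul_self_eq_abs]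

lemma length_pos (ρ : RiemMetric M) {x : M} {v : TangentSpace (𝓡 3) x} (hv : v ≠ 0) :
    0 < ρ.length v :=
  Real.sqrt_pos.2 (ρ.pos x v hv)

lemma isContinuousGauge_length (ρ : RiemMetric M) :
    IsContinuousGauge fun (x : M) v ↦ ρ.length (x := x) v where
  continuous := Real.continuous_sqrt.comp (continuous_inner_bundle ρ)
  map_smul _ s v := length_smul ρ s v

lemma IsContinuousGauge.comp {q : M → EuclideanSpace ℝ (Fin 3) → ℝ} (hq : IsContinuousGauge q)
    {A : M → M} (hA : ContMDiff (𝓡 3) (𝓡 3) 1 A) :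
    IsContinuousGauge fun x v ↦ q (A x) (modelDeriv (𝓡 3) (𝓡 3) A x v) where
  continuous := hq.continuous.comp (hA.continuous_tangentMap le_rfl)
  map_smul x s v := by rw [_root_.map_smul, hq.map_smul]

variable {L K₁ K₂ : ∀ x : M, Submodule ℝ (TangentSpace (𝓡 3) x)}
  {q₁ q₂ : M → EuclideanSpace ℝ (Fin 3) → ℝ}

lemma IsContinuousLineField.eventually_le (hL : IsContinuousLineField L)
    (h₁ : IsContinuousGauge q₁) (h₂ : IsContinuousGauge q₂) {x : M} {c : ℝ}
    (h : ∀ w : EuclideanSpace ℝ (Fin 3), w ∈ L x → w ≠ 0 → q₁ x w < c * q₂ x w) :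
    ∀ᶠ y in 𝓝 x, ∀ w : EuclideanSpace ℝ (Fin 3), w ∈ L y → q₁ y w ≤ c * q₂ y w := by
  obtain ⟨v, hvc, hv⟩ := hL.exists_generator x
  have h1 : ContinuousAt (fun y ↦ q₁ y (v y)) x :=
    ContinuousAt.comp (f := fun y ↦ (⟨y, v y⟩ : TangentBundle (𝓡 3) M)) h₁.continuous.continuousAt
      hvc
  have h2 : ContinuousAt (fun y ↦ q₂ y (v y)) x :=
    ContinuousAt.comp (f := fun y ↦ (⟨y, v y⟩ : TangentBundle (𝓡 3) M)) h₂.continuous.continuousAt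
      hvc
  have h3 : q₁ x (v x) < c * q₂ x (v x) := by
    refine h (v x) ?_ hv.self_of_nhds.1
    rw [hv.self_of_nhds.2]
    exact Submodule.mem_span_singleton_self _
  filter_upwards [h1.tendsto.eventually_lt (h2.tendsto.const_mul c) h3, hv] with y hy hvy w hw
  rw [hvy.2] at hw
  obtain ⟨s, hs⟩ := Submodule.mem_span_singleton.1 hw
  have hs' : w = s • v y := hs.symm
  rw [hs', h₁.map_smul, h₂.map_smul, mul_left_comm]
  exact mul_le_mul_of_nonneg_left hy.le (abs_nonneg s)

lemma IsContinuousLineField.lt_mul_of_lt_mul (hL : IsContinuousLineField L)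
    (h₁ : IsContinuousGauge q₁) (h₂ : IsContinuousGauge q₂) {x : M} {c : ℝ}
    {v : EuclideanSpace ℝ (Fin 3)} (hvL : v ∈ L x) (hv : v ≠ 0) (h : q₁ x v < c * q₂ x v)
    {w : EuclideanSpace ℝ (Fin 3)} (hw : w ∈ L x) (hw0 : w ≠ 0) : q₁ x w < c * q₂ x w := by
  obtain ⟨u, -, hu⟩ := hL.exists_generator x
  have hu := hu.self_of_nhds
  rw [hu.2] at hvL hw
  obtain ⟨s, hs⟩ := Submodule.mem_span_singleton.1 hvL
  obtain ⟨t, ht⟩ := Submodule.mem_span_singleton.1 hw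
  have hs' : v = s • u x := hs.symm
  have ht' : w = t • u x := ht.symm
  have hs0 : s ≠ 0 := by
    rintro rfl
    exact hv (by rw [hs', zero_smul])
  have ht0 : t ≠ 0 := by
    rintro rfl
    exact hw0 (by rw [ht', zero_smul])
  rw [hs', h₁.map_smul, h₂.map_smul, mul_left_comm] at h
  rw [ht', h₁.map_smul, h₂.map_smul, mul_left_comm]
  exact mul_lt_mul_of_pos_left (lt_of_mul_lt_mul_left h (abs_nonneg s)) (abs_pos.2 ht0)

variable [CompactSpace M]

/-- On a line field over a compact manifold, a gauge is at most a multiple of a positive one. -/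
lemma IsContinuousLineField.exists_forall_le (hL : IsContinuousLineField L)
    (h₁ : IsContinuousGauge q₁) (h₂ : IsContinuousGauge q₂)
    (hpos : ∀ x v, v ≠ 0 → 0 < q₂ x v) :
    ∃ C > 0, ∀ x, ∀ w : EuclideanSpace ℝ (Fin 3), w ∈ L x → q₁ x w ≤ C * q₂ x w := by
  have hq : ∀ x v, 0 ≤ q₂ x v := by
    intro x v
    rcases eq_or_ne v 0 with rfl | hv
    · have := h₂.map_smul x 0 0
      simp only [smul_zero, abs_zero, zero_mul] at this
      exact this.ge
    · exact (hpos x v hv).le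
  obtain ⟨C, hC⟩ := exists_forall_of_eventually (β := ℝ) (p := fun C x ↦
    ∀ w : EuclideanSpace ℝ (Fin 3), w ∈ L x → q₁ x w ≤ C * q₂ x w)
    (fun c d x hcd h w hw ↦ (h w hw).trans (mul_le_mul_of_nonneg_right hcd (hq x w))) (fun x ↦ by
      obtain ⟨v, -, hv⟩ := hL.exists_generator x
      have hv := hv.self_of_nhds
      have hvL : v x ∈ L x := by
        rw [hv.2]
        exact Submodule.mem_span_singleton_self _
      have hp := hpos x (v x) hv.1
      refine ⟨q₁ x (v x) / q₂ x (v x) + 1, hL.eventually_le h₁ h₂ fun w hw hw0 ↦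
        hL.lt_mul_of_lt_mul h₁ h₂ hvL hv.1 ?_ hw hw0⟩
      rw [add_mul, div_mul_cancel₀ _ hp.ne', one_mul]
      linarith)
  exact ⟨max C 1, by positivity, fun x w hw ↦
    (hC x w hw).trans (mul_le_mul_of_nonneg_right (le_max_left _ _) (hq x w))⟩

/-- On a line field over a compact manifold, a strict inequality of gauges holds with a uniform
factor. -/
lemma IsContinuousLineField.exists_forall_le_of_lt (hL : IsContinuousLineField L)
    (h₁ : IsContinuousGauge q₁) (h₂ : IsContinuousGauge q₂)
    (hq : ∀ x v, 0 ≤ q₁ x v) (hq₂ : ∀ x v, 0 ≤ q₂ x v)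
    (hlt : ∀ x, ∀ w : EuclideanSpace ℝ (Fin 3), w ∈ L x → w ≠ 0 → q₁ x w < q₂ x w) :
    ∃ μ < 1, 0 < μ ∧ ∀ x, ∀ w : EuclideanSpace ℝ (Fin 3), w ∈ L x → q₁ x w ≤ μ * q₂ x w := by
  have : Nonempty (Ioo (0:ℝ) 1) := ⟨⟨1 / 2, by norm_num⟩⟩
  obtain ⟨⟨μ, h0, h1⟩, h⟩ := exists_forall_of_eventually (β := Ioo (0:ℝ) 1) (p := fun C x ↦
    ∀ w : EuclideanSpace ℝ (Fin 3), w ∈ L x → q₁ x w ≤ C * q₂ x w)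
    (fun c d x hcd h w hw ↦ (h w hw).trans (mul_le_mul_of_nonneg_right hcd (hq₂ x w))) (fun x ↦ by
      obtain ⟨v, -, hv⟩ := hL.exists_generator x
      have hv := hv.self_of_nhds
      have hvL : v x ∈ L x := by
        rw [hv.2]
        exact Submodule.mem_span_singleton_self _
      have h := hlt x (v x) hvL hv.1
      have hp := (hq x (v x)).trans_lt h
      obtain ⟨μ, hμ, hμ1⟩ := exists_between ((div_lt_one hp).2 h)
      exact ⟨⟨μ, (div_nonneg (hq _ _) hp.le).trans_lt hμ, hμ1⟩, hL.eventually_le h₁ h₂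
        fun w hw hw0 ↦ hL.lt_mul_of_lt_mul h₁ h₂ hvL hv.1 ((div_lt_iff₀ hp).1 hμ) hw hw0⟩)
  exact ⟨μ, h1, h0, h⟩

/-- The complementary line and plane fields make a uniform angle. -/
lemma exists_norm_le_norm_add {V : Type*} [NormedAddCommGroup V] [NormedSpace ℝ V] {ι : M → V}
    (hι : ContMDiff (𝓡 3) 𝓘(ℝ, V) 1 ι)
    (hιd : ∀ x, Function.Injective (modelDeriv (𝓡 3) 𝓘(ℝ, V) ι x))
    (hL : IsContinuousLineField L) (h₁ : IsContinuousLineField K₁)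
    (h₂ : IsContinuousLineField K₂) (hs : ∀ x, L x ⊔ (K₁ x ⊔ K₂ x) = ⊤) :
    ∃ C > 0, ∀ x, ∀ w : EuclideanSpace ℝ (Fin 3), w ∈ L x → ∀ p : EuclideanSpace ℝ (Fin 3),
      p ∈ K₁ x ⊔ K₂ x → ‖modelDeriv (𝓡 3) 𝓘(ℝ, V) ι x w‖ ≤
        C * ‖modelDeriv (𝓡 3) 𝓘(ℝ, V) ι x (w + p)‖ := by
  obtain ⟨C, hC⟩ := exists_forall_of_eventually (β := ℝ) (p := fun C x ↦
    ∀ w : EuclideanSpace ℝ (Fin 3), w ∈ L x → ∀ p : EuclideanSpace ℝ (Fin 3),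
      p ∈ K₁ x ⊔ K₂ x → ‖modelDeriv (𝓡 3) 𝓘(ℝ, V) ι x w‖ ≤
        C * ‖modelDeriv (𝓡 3) 𝓘(ℝ, V) ι x (w + p)‖)
    (fun c d x hcd h w hw p hp ↦
      (h w hw p hp).trans (mul_le_mul_of_nonneg_right hcd (norm_nonneg _))) (fun x ↦ by
      obtain ⟨v, hvc, hv⟩ := hL.exists_generator x
      obtain ⟨a, hac, ha⟩ := h₁.exists_generator x
      obtain ⟨b, hbc, hb⟩ := h₂.exists_generator x
      have hcont : ∀ {u : M → EuclideanSpace ℝ (Fin 3)},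
          ContinuousAt (fun y ↦ (⟨y, u y⟩ : TangentBundle (𝓡 3) M)) x →
          Tendsto (fun y ↦ modelDeriv (𝓡 3) 𝓘(ℝ, V) ι y (u y)) (𝓝 x)
            (𝓝 (modelDeriv (𝓡 3) 𝓘(ℝ, V) ι x (u x))) := fun {u} hu ↦
        ContinuousAt.comp (f := fun y ↦ (⟨y, u y⟩ : TangentBundle (𝓡 3) M))
          (continuous_modelDeriv_bundle hι).continuousAt hu
      have h := hs x
      rw [hv.self_of_nhds.2, ha.self_of_nhds.2, hb.self_of_nhds.2] at h
      have hind := (linearIndependent_of_span_sup_eq_top h).map' _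
        (LinearMap.ker_eq_bot.2 (hιd x))
      obtain ⟨C, hC⟩ := exists_norm_le_of_linearIndependent hind
      have hlim : Tendsto (fun y ↦ ![modelDeriv (𝓡 3) 𝓘(ℝ, V) ι y (v y),
          modelDeriv (𝓡 3) 𝓘(ℝ, V) ι y (a y), modelDeriv (𝓡 3) 𝓘(ℝ, V) ι y (b y)]) (𝓝 x)
          (𝓝 ((modelDeriv (𝓡 3) 𝓘(ℝ, V) ι x).toLinearMap ∘ ![v x, a x, b x])) := by
        have : (modelDeriv (𝓡 3) 𝓘(ℝ, V) ι x).toLinearMap ∘ ![v x, a x, b x] =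
            ![modelDeriv (𝓡 3) 𝓘(ℝ, V) ι x (v x), modelDeriv (𝓡 3) 𝓘(ℝ, V) ι x (a x),
              modelDeriv (𝓡 3) 𝓘(ℝ, V) ι x (b x)] := by
          ext i
          fin_cases i <;> rfl
        rw [this]
        exact (hcont hvc).matrixVecCons ((hcont hac).matrixVecCons ((hcont hbc).matrixVecCons
          tendsto_const_nhds))
      let B := ‖modelDeriv (𝓡 3) 𝓘(ℝ, V) ι x (v x)‖ + 1
      refine ⟨B * C, ?_⟩
      filter_upwards [hlim.eventually hC, hv, ha, hb,
        (hcont hvc).norm.eventually_lt_const (lt_add_one _)] with y hy hvy hay hby hBy w hw p hp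
      rw [hvy.2] at hw
      rw [hay.2, hby.2] at hp
      obtain ⟨s, hs⟩ := Submodule.mem_span_singleton.1 hw
      obtain ⟨p₁, hp₁, p₂, hp₂, hp⟩ := Submodule.mem_sup.1 hp
      obtain ⟨s₁, hs₁⟩ := Submodule.mem_span_singleton.1 hp₁
      obtain ⟨s₂, hs₂⟩ := Submodule.mem_span_singleton.1 hp₂
      have hw' : w = s • v y := hs.symm
      have hp' : p = s₁ • a y + s₂ • b y := by rw [← hp, ← hs₁, ← hs₂]
      have h3 := hy ![s, s₁, s₂]
      have h4 : |s| ≤ ‖![s, s₁, s₂]‖ := norm_le_pi_norm ![s, s₁, s₂] 0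
      simp only [Fin.sum_univ_three, Matrix.cons_val_zero, Matrix.cons_val_one,
        Matrix.cons_val] at h3
      rw [hw', hp', map_add, map_add, map_smul, map_smul, map_smul, norm_smul, Real.norm_eq_abs,
        mul_comm, mul_assoc, ← add_assoc]
      exact mul_le_mul hBy.le (h4.trans h3) (abs_nonneg s) (by positivity))
  exact ⟨max C 1, by positivity, fun x w hw p hp ↦
    (hC x w hw p hp).trans (mul_le_mul_of_nonneg_right (le_max_left _ _) (norm_nonneg _))⟩

end Norms

/-! ### Orbits lie in the leaves transverse to the expanded direction -/

/-- The iterates of a homeomorphism, as homeomorphisms. -/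
def iterateHomeomorph {X : Type*} [TopologicalSpace X] (B : X ≃ₜ X) (n : ℕ) : X ≃ₜ X where
  toFun := B^[n]
  invFun := B.symm^[n]
  left_inv := Function.LeftInverse.iterate B.symm_apply_apply n
  right_inv := Function.LeftInverse.iterate B.apply_symm_apply n
  continuous_toFun := B.continuous.iterate n
  continuous_invFun := B.symm.continuous.iterate n

lemma image_iterate_leaf {X : Type*} [TopologicalSpace X] {F : SurfaceFoliation X} {B : X → X}
    (hB : ∀ x, B '' F.leaf x = F.leaf (B x)) (n : ℕ) (x : X) :
    B^[n] '' F.leaf x = F.leaf (B^[n] x) := by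
  induction n with
  | zero => simp
  | succ n ih => rw [Function.iterate_succ', image_comp, ih, hB, Function.comp_apply]

section Expansion

variable {M : Type*} [MetricSpace M] [ChartedSpace (EuclideanSpace ℝ (Fin 3)) M]
  {L K₁ K₂ : ∀ x : M, Submodule ℝ (TangentSpace (𝓡 3) x)} {A B : M → M}

lemma contMDiff_iterate (hA : ContMDiff (𝓡 3) (𝓡 3) 1 A) (n : ℕ) :
    ContMDiff (𝓡 3) (𝓡 3) 1 A^[n] := by
  induction n with
  | zero => exact contMDiff_id
  | succ n ih => exact ih.comp hA

lemma modelDeriv_comp (hA : ContMDiff (𝓡 3) (𝓡 3) 1 A) (hB : ContMDiff (𝓡 3) (𝓡 3) 1 B)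
    (x : M) (v : EuclideanSpace ℝ (Fin 3)) : modelDeriv (𝓡 3) (𝓡 3) (B ∘ A) x v =
      modelDeriv (𝓡 3) (𝓡 3) B (A x) (modelDeriv (𝓡 3) (𝓡 3) A x v) :=
  DFunLike.congr_fun (mfderiv_comp x (hB.mdifferentiable one_ne_zero (A x))
    (hA.mdifferentiable one_ne_zero x)) v

lemma modelDeriv_iterate_mem (hA : ContMDiff (𝓡 3) (𝓡 3) 1 A)
    (hLA : ∀ x, ∀ w : EuclideanSpace ℝ (Fin 3), w ∈ L x → modelDeriv (𝓡 3) (𝓡 3) A x w ∈ L (A x))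
    (n : ℕ) : ∀ x, ∀ w : EuclideanSpace ℝ (Fin 3), w ∈ L x →
      modelDeriv (𝓡 3) (𝓡 3) A^[n] x w ∈ L (A^[n] x) := by
  induction n with
  | zero =>
    intro x w hw
    have : modelDeriv (𝓡 3) (𝓡 3) A^[0] x w = w := DFunLike.congr_fun (mfderiv_id (x := x)) w
    rw [this]
    exact hw
  | succ n ih =>
    intro x w hw
    rw [Function.iterate_succ, modelDeriv_comp hA (contMDiff_iterate hA n)]
    exact ih _ _ (hLA x w hw)

lemma le_pow_mul_iterate (hA : ContMDiff (𝓡 3) (𝓡 3) 1 A)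
    (hLA : ∀ x, ∀ w : EuclideanSpace ℝ (Fin 3), w ∈ L x → modelDeriv (𝓡 3) (𝓡 3) A x w ∈ L (A x))
    {q : M → EuclideanSpace ℝ (Fin 3) → ℝ} {μ : ℝ} (hμ : 0 < μ)
    (h : ∀ x, ∀ w : EuclideanSpace ℝ (Fin 3), w ∈ L x →
      q x w ≤ μ * q (A x) (modelDeriv (𝓡 3) (𝓡 3) A x w)) (n : ℕ) :
    ∀ x, ∀ w : EuclideanSpace ℝ (Fin 3), w ∈ L x →
      q x w ≤ μ ^ n * q (A^[n] x) (modelDeriv (𝓡 3) (𝓡 3) A^[n] x w) := by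
  induction n with
  | zero =>
    intro x w hw
    have : modelDeriv (𝓡 3) (𝓡 3) A^[0] x w = w := DFunLike.congr_fun (mfderiv_id (x := x)) w
    rw [this, pow_zero, one_mul]
    rfl
  | succ n ih =>
    intro x w hw
    rw [Function.iterate_succ, modelDeriv_comp hA (contMDiff_iterate hA n), pow_succ', mul_assoc]
    exact (h x w hw).trans (mul_le_mul_of_nonneg_left (ih _ _ (hLA x w hw)) hμ.le)

variable [IsManifold (𝓡 3) ∞ M] [CompactSpace M]

/-- High iterates of a map that expands `L` for some Riemannian metric expand the distances to the
complementary planes as much as desired, for the metric induced by an immersion. -/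
lemma exists_iterate_expands {V : Type*} [NormedAddCommGroup V] [NormedSpace ℝ V] {ι : M → V}
    (hι : ContMDiff (𝓡 3) 𝓘(ℝ, V) 1 ι)
    (hιd : ∀ x, Function.Injective (modelDeriv (𝓡 3) 𝓘(ℝ, V) ι x))
    (hL : IsContinuousLineField L) (h₁ : IsContinuousLineField K₁)
    (h₂ : IsContinuousLineField K₂) (hs : ∀ x, L x ⊔ (K₁ x ⊔ K₂ x) = ⊤)
    (hA : ContMDiff (𝓡 3) (𝓡 3) 1 A)
    (hLA : ∀ x, ∀ w : EuclideanSpace ℝ (Fin 3), w ∈ L x → modelDeriv (𝓡 3) (𝓡 3) A x w ∈ L (A x))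
    (ρ : RiemMetric M) (hlt : ∀ x, ∀ w : EuclideanSpace ℝ (Fin 3), w ∈ L x → w ≠ 0 →
      ρ.length (x := x) w < ρ.length (x := A x) (modelDeriv (𝓡 3) (𝓡 3) A x w)) :
    ∃ N, 0 < N ∧ ∀ z, ∃ ν : EuclideanSpace ℝ (Fin 3), ν ∉ K₁ z ⊔ K₂ z ∧
      ∀ p : EuclideanSpace ℝ (Fin 3), p ∈ K₁ (A^[N] z) ⊔ K₂ (A^[N] z) →
        2 * ‖modelDeriv (𝓡 3) 𝓘(ℝ, V) ι z ν‖ <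
          ‖modelDeriv (𝓡 3) 𝓘(ℝ, V) ι (A^[N] z) (modelDeriv (𝓡 3) (𝓡 3) A^[N] z ν + p)‖ := by
  have hg := isContinuousGauge_length ρ
  have hgι := isContinuousGauge_norm hι
  have hιpos : ∀ x v, v ≠ 0 → 0 < ‖modelDeriv (𝓡 3) 𝓘(ℝ, V) ι x v‖ := fun x v hv ↦
    norm_pos_iff.2 fun h ↦ hv (hιd x (h.trans (map_zero _).symm))
  obtain ⟨μ, hμ1, hμ0, hμ⟩ := hL.exists_forall_le_of_lt hg (hg.comp hA)
    (fun _ _ ↦ Real.sqrt_nonneg _) (fun _ _ ↦ Real.sqrt_nonneg _) hlt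
  obtain ⟨C₁, hC₁, h1⟩ := hL.exists_forall_le hgι hg fun x v hv ↦ length_pos ρ hv
  obtain ⟨C₂, hC₂, h2⟩ := hL.exists_forall_le hg hgι hιpos
  obtain ⟨C₃, hC₃, h3⟩ := exists_norm_le_norm_add hι hιd hL h₁ h₂ hs
  obtain ⟨N, hN⟩ := exists_pow_lt_of_lt_one (show 0 < 1 / (2 * (C₁ * C₂ * C₃)) by positivity) hμ1
  refine ⟨N + 1, N.succ_pos, fun z ↦ ?_⟩
  obtain ⟨v, -, hv⟩ := hL.exists_generator z
  have hv := hv.self_of_nhds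
  have hvL : v z ∈ L z := by
    rw [hv.2]
    exact Submodule.mem_span_singleton_self _
  -- The generator of `L z` serves as the expanded vector. The constants compare the two metrics on
  -- `L`, in both directions, and the norms on `L` with those modulo the complementary plane.
  refine ⟨v z, fun hvK ↦ ?_, fun p hp ↦ ?_⟩
  · have := h3 z (v z) hvL (-v z) (Submodule.neg_mem _ hvK)
    rw [add_neg_cancel, map_zero, norm_zero, mul_zero] at this
    exact (hιpos z _ hv.1).not_ge this
  · have hmem := modelDeriv_iterate_mem hA hLA (N + 1) z (v z) hvL
    have e1 := h1 z _ hvL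
    have e2 := le_pow_mul_iterate (q := fun x v ↦ ρ.length (x := x) v) hA hLA hμ0 hμ (N + 1) z _ hvL
    have e3 := h2 _ _ hmem
    have e4 := h3 _ _ hmem p hp
    have hpos := hιpos z _ hv.1
    generalize ‖modelDeriv (𝓡 3) 𝓘(ℝ, V) ι z (v z)‖ = a at *
    generalize ‖modelDeriv (𝓡 3) 𝓘(ℝ, V) ι (A^[N + 1] z)
      (modelDeriv (𝓡 3) (𝓡 3) A^[N + 1] z (v z) + p)‖ = d at *
    have hle : a ≤ (C₁ * C₂ * C₃ * μ ^ (N + 1)) * d := by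
      calc a ≤ C₁ * (μ ^ (N + 1) * (C₂ * (C₃ * d))) := by
            refine e1.trans (mul_le_mul_of_nonneg_left (e2.trans ?_) hC₁.le)
            refine mul_le_mul_of_nonneg_left (e3.trans ?_) (by positivity)
            exact mul_le_mul_of_nonneg_left e4 hC₂.le
        _ = _ := by ring
    have hd : 0 < d := by
      by_contra hd
      have : (C₁ * C₂ * C₃ * μ ^ (N + 1)) * d ≤ 0 :=
        mul_nonpos_of_nonneg_of_nonpos (by positivity) (not_lt.1 hd)
      linarith
    have hN' : μ ^ (N + 1) < 1 / (2 * (C₁ * C₂ * C₃)) :=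
      (pow_le_pow_of_le_one hμ0.le hμ1.le (Nat.le_succ N)).trans_lt hN
    rw [lt_div_iff₀ (by positivity)] at hN'
    have : (C₁ * C₂ * C₃ * μ ^ (N + 1)) * 2 < 1 := by linarith
    have := mul_lt_mul_of_pos_right this hd
    linarith

/-- If an iterate of `B` expands the line field `L`, and `B` moves points along the orbits of the
flow `ψ` in positive time, then the orbits of `ψ` lie in the leaves of the invariant foliation
transverse to `L`. -/
lemma orbit_subset_leaf_of_expands {F : SurfaceFoliation M} {B : M ≃ₜ M}
    (hB : ContMDiff (𝓡 3) (𝓡 3) 1 B) (hBF : ∀ x, B '' F.leaf x = F.leaf (B x))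
    (hL : IsContinuousLineField L) (h₁ : IsContinuousLineField K₁)
    (h₂ : IsContinuousLineField K₂) (hs : ∀ x, L x ⊔ (K₁ x ⊔ K₂ x) = ⊤)
    (hT : F.IsTangentTo fun x ↦ K₁ x ⊔ K₂ x)
    (hLB : ∀ x, ∀ w : EuclideanSpace ℝ (Fin 3), w ∈ L x → modelDeriv (𝓡 3) (𝓡 3) B x w ∈ L (B x))
    (ρ : RiemMetric M) {n : ℕ} (hn : 0 < n)
    (hlt : ∀ x, ∀ w : EuclideanSpace ℝ (Fin 3), w ∈ L x → w ≠ 0 →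
      ρ.length (x := x) w < ρ.length (x := B^[n] x) (modelDeriv (𝓡 3) (𝓡 3) B^[n] x w))
    {ψ : Flow ℝ M} {H : M → ℝ} (hH : Continuous H) (hHpos : ∀ x, 0 < H x)
    (hBψ : ∀ x, B x = ψ (H x) x) (x : M) (t : ℝ) : ψ t x ∈ F.leaf x := by
  obtain ⟨m, ι, hι, hιc, hιd⟩ := exists_embedding_euclidean_of_compact (I := 𝓡 3) (M := M)
  have hι1 : ContMDiff (𝓡 3) 𝓘(ℝ, EuclideanSpace ℝ (Fin m)) 1 ι := hι.of_le (by simp)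
  obtain ⟨N, hN, hE⟩ := exists_iterate_expands hι1 hιd hL h₁ h₂ hs (contMDiff_iterate hB n)
    (modelDeriv_iterate_mem hB hLB n) ρ hlt
  rw [← Function.iterate_mul] at hE
  have hnN : n * N ≠ 0 := (Nat.mul_pos hn hN).ne'
  have hG := image_iterate_leaf hBF (n * N)
  refine orbit_subset_leaf (G := iterateHomeomorph B (n * N)) hι.continuous hιc.injective hG
    (contracts_of_expands hT (finrank_sup_eq_two hL h₁ h₂ hs) (isClosedPlaneField_sup hL h₁ h₂ hs)
      hι1 hιc.injective hιd (contMDiff_iterate hB _) hG hE)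
    (continuous_birkhoffSum B.continuous hH (n * N)) (fun y ↦ ?_)
    (fun y ↦ iterate_eq_flow hBψ (n * N) y) x t
  exact Finset.sum_pos (fun k _ ↦ hHpos _) (Finset.nonempty_range_iff.2 hnN)

end Expansion

/-! ### The orbits of the flow lie in the center leaves -/

section Splitting

variable {M : Type*} [MetricSpace M] [ChartedSpace (EuclideanSpace ℝ (Fin 3)) M]

lemma mem_of_point_eq {L : ∀ x : M, Submodule ℝ (TangentSpace (𝓡 3) x)} {x y : M} (h : x = y)
    {w : EuclideanSpace ℝ (Fin 3)} (hw : w ∈ L x) : w ∈ L y := by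
  subst h
  exact hw

lemma modelDeriv_of_leftInverse {A B : M → M} (hA : ContMDiff (𝓡 3) (𝓡 3) 1 A)
    (hB : ContMDiff (𝓡 3) (𝓡 3) 1 B) (h : Function.LeftInverse B A) (x : M)
    (w : EuclideanSpace ℝ (Fin 3)) :
    modelDeriv (𝓡 3) (𝓡 3) B (A x) (modelDeriv (𝓡 3) (𝓡 3) A x w) = w := by
  rw [← modelDeriv_comp hA hB, h.comp_eq_id]
  exact DFunLike.congr_fun (mfderiv_id (I := 𝓡 3) (x := x)) w

variable {f : M ≃ₘ⟮𝓡 3, 𝓡 3⟯ M}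

lemma modelDeriv_symm_mem {E : ∀ x : M, Submodule ℝ (TangentSpace (𝓡 3) x)}
    (hE : ∀ x, (E x).map (mfderiv (𝓡 3) (𝓡 3) f x).toLinearMap = E (f x)) (x : M)
    {w : EuclideanSpace ℝ (Fin 3)} (hw : w ∈ E x) :
    modelDeriv (𝓡 3) (𝓡 3) f.symm x w ∈ E (f.symm x) := by
  obtain ⟨y, rfl⟩ : ∃ y, f y = x := ⟨f.symm x, f.apply_symm_apply x⟩
  rw [← hE] at hw
  obtain ⟨u, hu, rfl⟩ := hw
  have h1 : modelDeriv (𝓡 3) (𝓡 3) f.symm (f y) (modelDeriv (𝓡 3) (𝓡 3) f y u) = u :=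
    modelDeriv_of_leftInverse (f.contMDiff.of_le (by simp)) (f.symm.contMDiff.of_le (by simp))
      f.symm_apply_apply y u
  have h2 := mem_of_point_eq (f.symm_apply_apply y).symm hu
  rw [← h1] at h2
  exact h2

variable [IsManifold (𝓡 3) ∞ M]

lemma IsContinuousLineField.exists_length_eq_one {L : ∀ x : M, Submodule ℝ (TangentSpace (𝓡 3) x)}
    (hL : IsContinuousLineField L) (ρ : RiemMetric M) (x : M) : ∃ v ∈ L x, ρ.length v = 1 := by
  obtain ⟨U, hU, v, -, hv⟩ := hL x
  obtain ⟨hv0, hv⟩ := hv x (mem_of_mem_nhds hU)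
  have hp := length_pos ρ hv0
  refine ⟨(ρ.length (v x))⁻¹ • v x, ?_, ?_⟩
  · rw [hv]
    exact Submodule.smul_mem _ _ (Submodule.mem_span_singleton_self _)
  · rw [length_smul, abs_of_pos (inv_pos.2 hp), inv_mul_cancel₀ hp.ne']

/-- Compare the lengths of a vector and of its image, from the case of unit vectors. -/
lemma length_modelDeriv_eq (ρ : RiemMetric M) (A : M → M) {x : M} {w : EuclideanSpace ℝ (Fin 3)}
    (hw : w ≠ 0) : ∃ u : EuclideanSpace ℝ (Fin 3),
      (∀ S : Submodule ℝ (TangentSpace (𝓡 3) x), w ∈ S → u ∈ S) ∧ ρ.length (x := x) u = 1 ∧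
      ρ.length (x := A x) (modelDeriv (𝓡 3) (𝓡 3) A x w) =
        ρ.length (x := x) w * ρ.length (x := A x) (modelDeriv (𝓡 3) (𝓡 3) A x u) := by
  have hp := length_pos ρ (x := x) (v := w) hw
  refine ⟨(ρ.length (x := x) w)⁻¹ • w, fun S h ↦ Submodule.smul_mem S _ h, ?_, ?_⟩
  · have := length_smul ρ (x := x) (ρ.length (x := x) w)⁻¹ w
    rw [abs_of_pos (inv_pos.2 hp), inv_mul_cancel₀ hp.ne'] at this
    exact this
  · rw [map_smul]
    have := length_smul ρ (x := A x) (ρ.length (x := x) w)⁻¹ (modelDeriv (𝓡 3) (𝓡 3) A x w)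
    rw [abs_of_pos (inv_pos.2 hp)] at this
    refine Eq.trans ?_ (congrArg (ρ.length (x := x) w * ·) this).symm
    rw [mul_inv_cancel_left₀ hp.ne']

/-- The expansion of `Eu` and the contraction of `Es`, for arbitrary nonzero vectors. -/
lemma PartiallyHyperbolicSplitting.exists_length_lt (S : PartiallyHyperbolicSplitting f) :
    ∃ ρ : RiemMetric M, ∃ n, 0 < n ∧ ∀ x, ∀ w : EuclideanSpace ℝ (Fin 3), w ≠ 0 →
      (w ∈ S.Eu x →
        ρ.length (x := x) w < ρ.length (x := f^[n] x) (modelDeriv (𝓡 3) (𝓡 3) f^[n] x w)) ∧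
      (w ∈ S.Es x →
        ρ.length (x := f^[n] x) (modelDeriv (𝓡 3) (𝓡 3) f^[n] x w) < ρ.length (x := x) w) := by
  obtain ⟨ρ, n, hn, h⟩ := S.dominated
  refine ⟨ρ, n, hn, fun x w hw ↦ ?_⟩
  obtain ⟨vs, hvs, hvs1⟩ := S.continuous_Es.exists_length_eq_one ρ x
  obtain ⟨vc, hvc, hvc1⟩ := S.continuous_Ec.exists_length_eq_one ρ x
  obtain ⟨vu, hvu, hvu1⟩ := S.continuous_Eu.exists_length_eq_one ρ x
  have hp := length_pos ρ (x := x) (v := w) hw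
  obtain ⟨u, hu, hu1, hu2⟩ := length_modelDeriv_eq ρ f^[n] (x := x) hw
  refine ⟨fun hwu ↦ ?_, fun hws ↦ ?_⟩
  · have h1 : 1 < ρ.length (x := f^[n] x) (modelDeriv (𝓡 3) (𝓡 3) f^[n] x u) :=
      (h x vs hvs vc hvc u (hu _ hwu) hvs1 hvc1 hu1).2.1
    rw [hu2]
    exact lt_mul_of_one_lt_right hp h1
  · have h1 : ρ.length (x := f^[n] x) (modelDeriv (𝓡 3) (𝓡 3) f^[n] x u) < 1 :=
      (h x u (hu _ hws) vc hvc vu hvu hu1 hvc1 hvu1).1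
    rw [hu2]
    exact mul_lt_of_lt_one_right hp h1

lemma length_lt_iterate_symm (S : PartiallyHyperbolicSplitting f) {ρ : RiemMetric M} {n : ℕ}
    (h : ∀ x, ∀ w : EuclideanSpace ℝ (Fin 3), w ≠ 0 → w ∈ S.Es x →
      ρ.length (x := f^[n] x) (modelDeriv (𝓡 3) (𝓡 3) f^[n] x w) < ρ.length (x := x) w)
    (x : M) (w : EuclideanSpace ℝ (Fin 3)) (hw : w ∈ S.Es x) (hw0 : w ≠ 0) :
    ρ.length (x := x) w <
      ρ.length (x := f.symm^[n] x) (modelDeriv (𝓡 3) (𝓡 3) f.symm^[n] x w) := by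
  have hf : ContMDiff (𝓡 3) (𝓡 3) 1 f := f.contMDiff.of_le (by simp)
  have hf' : ContMDiff (𝓡 3) (𝓡 3) 1 f.symm := f.symm.contMDiff.of_le (by simp)
  have hinv : Function.LeftInverse f^[n] f.symm^[n] :=
    Function.LeftInverse.iterate f.apply_symm_apply n
  have h1 := modelDeriv_of_leftInverse (contMDiff_iterate hf' n) (contMDiff_iterate hf n) hinv x w
  have hmem := modelDeriv_iterate_mem hf' (fun x w hw ↦ modelDeriv_symm_mem S.invariant_Es x hw) n
    x w hw
  have h2 := h _ _ (fun h0 ↦ hw0 (by rw [← h1, h0, map_zero])) hmem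
  rw [h1] at h2
  have hq : ∀ y, y = x → ρ.length (x := y) w = ρ.length (x := x) w := by
    rintro y rfl
    rfl
  rw [← hq _ (hinv x)]
  exact h2

variable [CompactSpace M]

/-- The orbits of any flow along which `f` moves all points in positive time lie in the leaves of
both foliations: `f` expands `Eu`, which is transverse to `Wcs`, and its inverse, which moves points
in positive time along the reversed flow, expands `Es`, which is transverse to `Wcu`. -/
lemma flow_mem_leaves (W : CenterFoliations f) {ψ : Flow ℝ M} {h : M → ℝ} (hc : Continuous h)
    (hpos : ∀ x, 0 < h x) (hψ : ∀ x, f x = ψ (h x) x) (x : M) (t : ℝ) :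
    ψ t x ∈ W.Wcs.leaf x ∩ W.Wcu.leaf x := by
  obtain ⟨ρ, n, hn, hlt⟩ := W.splitting.exists_length_lt
  have hf : ContMDiff (𝓡 3) (𝓡 3) 1 f := f.contMDiff.of_le (by simp)
  have hf' : ContMDiff (𝓡 3) (𝓡 3) 1 f.symm := f.symm.contMDiff.of_le (by simp)
  constructor
  · refine orbit_subset_leaf_of_expands (B := f.toHomeomorph) hf W.invariant_Wcs
      W.splitting.continuous_Eu W.splitting.continuous_Es W.splitting.continuous_Ec (fun y ↦ ?_)
      W.tangent_Wcs (fun y w hw ↦ ?_) ρ hn (fun y w hw hw0 ↦ (hlt y w hw0).1 hw) hc hpos hψ x t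
    · rw [sup_comm, W.splitting.span_eq_top]
    · have := W.splitting.invariant_Eu y
      change _ ∈ W.splitting.Eu (f y)
      rw [← this]
      exact ⟨w, hw, rfl⟩
  · have hleaf : ∀ y, f.toHomeomorph.symm '' W.Wcu.leaf y =
        W.Wcu.leaf (f.toHomeomorph.symm y) := by
      intro y
      have := W.invariant_Wcu (f.symm y)
      rw [f.apply_symm_apply] at this
      rw [← this, image_image]
      simp
    have := orbit_subset_leaf_of_expands (B := f.toHomeomorph.symm) hf' hleaf
      W.splitting.continuous_Es W.splitting.continuous_Ec W.splitting.continuous_Eu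
      (fun y ↦ by rw [← sup_assoc, W.splitting.span_eq_top]) W.tangent_Wcu
      (fun y w hw ↦ modelDeriv_symm_mem W.splitting.invariant_Es y hw) ρ hn
      (length_lt_iterate_symm W.splitting fun y w hw0 hw ↦ (hlt y w hw0).2 hw)
      (ψ := ψ.reverse) (H := fun y ↦ h (f.symm y)) (hc.comp f.symm.continuous)
      (fun y ↦ hpos _) (fun y ↦ ?_) x (-t)
    · simpa using this
    · obtain ⟨u, rfl⟩ : ∃ u, f u = y := ⟨f.symm y, f.apply_symm_apply y⟩
      simp only [Flow.reverse_apply, Diffeomorph.coe_toHomeomorph_symm]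
      rw [f.symm_apply_apply, hψ u, ← ψ.map_add, neg_add_cancel, ψ.map_zero_apply]

lemma orbit_subset_centerLeaf (W : CenterFoliations f) {ψ : Flow ℝ M} {h : M → ℝ}
    (hc : Continuous h) (hpos : ∀ x, 0 < h x) (hψ : ∀ x, f x = ψ (h x) x) (x : M) (t : ℝ) :
    ψ t x ∈ W.centerLeaf x := by
  have h1 : IsPathConnected (range fun s ↦ ψ s x) :=
    isPathConnected_range (by fun_prop)
  refine (h1.joinedIn x ⟨0, by simp⟩ _ ⟨t, rfl⟩).mono ?_
  rintro _ ⟨s, rfl⟩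
  exact flow_mem_leaves W hc hpos hψ x s

end Splitting

/-! ### Center leaves are orbits of the flow -/

/-- A real function that changes sign at `0` along `u · z` still has a zero near `0` after a small
perturbation of `z`. -/
lemma eventually_exists_zero {Y : Type*} [TopologicalSpace Y] {z : Y} {u : ℝ → Y → ℝ}
    (hu : ∀ᶠ p : ℝ × Y in 𝓝 (0, z), ContinuousAt (fun p : ℝ × Y ↦ u p.1 p.2) p)
    (hz : ∀ᶠ s in 𝓝[>] (0:ℝ), 0 < u s z ∧ u (-s) z < 0) {η : ℝ} (hη : 0 < η) :
    ∀ᶠ y in 𝓝 z, ∃ t : ℝ, |t| < η ∧ u t y = 0 := by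
  obtain ⟨V, hV, U, hU, hVU⟩ := mem_nhds_prod_iff.1 hu
  obtain ⟨θ, hθ, hball⟩ := Metric.mem_nhds_iff.1 hV
  obtain ⟨s, ⟨hs, hs0⟩, hs1, hs2⟩ := (hz.and (Ioo_mem_nhdsGT (lt_min hη hθ))).exists
  have hsη := hs2.trans_le (min_le_left _ _)
  have hsV : ∀ t ∈ Icc (-s) s, t ∈ V := fun t ht ↦ hball (by
    rw [Metric.mem_ball, Real.dist_0_eq_abs]
    exact (abs_le.2 ht).trans_lt (hs2.trans_le (min_le_right _ _)))
  have hzU := mem_of_mem_nhds hU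
  have hc : ∀ t ∈ Icc (-s) s, ContinuousAt (fun y ↦ u t y) z := fun t ht ↦
    ContinuousAt.comp (g := fun p : ℝ × Y ↦ u p.1 p.2) (f := fun y ↦ (t, y))
      (hVU (Set.mk_mem_prod (hsV t ht) hzU)) (by fun_prop)
  have h1 : s ∈ Icc (-s) s := ⟨by linarith, le_rfl⟩
  have h2 : -s ∈ Icc (-s) s := ⟨le_rfl, by linarith⟩
  filter_upwards [hU, (hc s h1).eventually_const_lt hs, (hc (-s) h2).eventually_lt_const hs0]
    with y hy hy1 hy2
  have hcy : ContinuousOn (fun t ↦ u t y) (Icc (-s) s) := fun t ht ↦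
    (ContinuousAt.comp (g := fun p : ℝ × Y ↦ u p.1 p.2) (f := fun t ↦ (t, y))
      (hVU (Set.mk_mem_prod (hsV t ht) hy)) (by fun_prop)).continuousWithinAt
  obtain ⟨t, ht, h⟩ := isPreconnected_Icc.intermediate_value h2 h1 hcy ⟨hy2.le, hy1.le⟩
  exact ⟨t, (abs_le.2 ht).trans_lt hsη, h⟩

section Orbits

variable {M : Type*} [MetricSpace M]

lemma SurfaceFoliation.exists_leafConn_flow [CompactSpace M] {F : SurfaceFoliation M} {ψ : Flow ℝ M}
    (hψ : ∀ x t, ψ t x ∈ F.leaf x) {r : ℝ} (hr : 0 < r) :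
    ∃ η > 0, ∀ s, |s| ≤ η → ∀ y, F.LeafConn r y (ψ s y) := by
  obtain ⟨η, hη, h⟩ := flow_dist_lt ψ (half_pos hr)
  refine ⟨η, hη, fun s hs y ↦ ⟨(fun t ↦ ψ t y) '' uIcc 0 s, ?_, ?_, ⟨0, by simp, by simp⟩,
    ⟨s, by simp, rfl⟩, ?_⟩⟩
  · exact isPreconnected_uIcc.image _ (by fun_prop)
  · rintro _ ⟨t, -, rfl⟩
    exact hψ y t
  · have hle : ∀ t ∈ uIcc 0 s, |t| ≤ η := fun t ht ↦ by
      refine le_trans ?_ hs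
      have := abs_sub_left_of_mem_uIcc ht
      simpa using this
    rintro _ ⟨t, ht, rfl⟩ _ ⟨t', ht', rfl⟩
    have h1 := h t (hle t ht) y
    have h2 := h t' (hle t' ht') y
    change dist (ψ t y) (ψ t' y) < r
    linarith [dist_triangle_right (ψ t y) (ψ t' y) y]

lemma SurfaceFoliation.exists_leafConn_path {F : SurfaceFoliation M} {x : M} {γ : ℝ → M} {s : Set ℝ}
    (hs : s.OrdConnected) (hγ : ContinuousOn γ s) (hF : ∀ t ∈ s, γ t ∈ F.leaf x) {r : ℝ}
    (hr : 0 < r) {t₀ : ℝ} (ht₀ : t₀ ∈ s) : ∀ᶠ t in 𝓝[s] t₀, F.LeafConn r (γ t₀) (γ t) := by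
  obtain ⟨θ, hθ, hball⟩ := Metric.mem_nhdsWithin_iff.1
    ((hγ t₀ ht₀).eventually_mem (Metric.ball_mem_nhds _ (half_pos hr)))
  filter_upwards [inter_mem_nhdsWithin s (Metric.ball_mem_nhds t₀ hθ)] with t ht
  have hsub : uIcc t₀ t ⊆ s := hs.uIcc_subset ht₀ ht.1
  have hsub' : ∀ u ∈ uIcc t₀ t, dist (γ u) (γ t₀) < r / 2 := fun u hu ↦
    hball ⟨(Real.dist_le_of_mem_uIcc hu left_mem_uIcc).trans_lt (by
      have := ht.2
      rwa [Metric.mem_ball, dist_comm] at this), hsub hu⟩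
  refine ⟨γ '' uIcc t₀ t, isPreconnected_uIcc.image _ (hγ.mono hsub), ?_,
    ⟨t₀, left_mem_uIcc, rfl⟩, ⟨t, right_mem_uIcc, rfl⟩, ?_⟩
  · rintro _ ⟨u, hu, rfl⟩
    rw [leaf_eq_of_mem (hF t₀ ht₀)]
    exact hF u (hsub hu)
  · rintro _ ⟨u, hu, rfl⟩ _ ⟨u', hu', rfl⟩
    linarith [dist_triangle_right (γ u) (γ u') (γ t₀), hsub' u hu, hsub' u' hu']

/-- The flow moves points close to `z` to the level set of the linear form `ℓ`, transverse to the
flow, through any other point close to `z`. -/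
lemma eventually_exists_flow_foot {ψ : Flow ℝ M} {z : M} {E : Type*} [NormedAddCommGroup E]
    [NormedSpace ℝ E] {κ : M → E} (hκ : ∀ᶠ x in 𝓝 z, ContinuousAt κ x) {Y : E} {ℓ : E →L[ℝ] ℝ}
    (hder : HasDerivAt (fun t ↦ κ (ψ t z)) Y 0) (hℓ : 0 < ℓ Y) {η : ℝ} (hη : 0 < η) :
    ∀ᶠ p in 𝓝 (z, z), ∃ t : ℝ, |t| < η ∧ ℓ (κ (ψ t p.1) - κ p.2) = 0 := by
  have hsign : ∀ᶠ s in 𝓝[>] (0:ℝ), 0 < ℓ (κ (ψ s z) - κ z) ∧ ℓ (κ (ψ (-s) z) - κ z) < 0 := by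
    have h1 := (ℓ.continuous.tendsto Y).comp hder.tendsto_slope_zero
    simp only [zero_add, ψ.map_zero_apply, Function.comp_def, map_smul, smul_eq_mul] at h1
    have h2 : ∀ᶠ t in 𝓝[≠] (0:ℝ), 0 < t⁻¹ * ℓ (κ (ψ t z) - κ z) := h1.eventually_const_lt hℓ
    have hneg : Tendsto (fun s : ℝ ↦ -s) (𝓝[>] 0) (𝓝[≠] 0) := by
      have h3 : Tendsto (fun s : ℝ ↦ -s) (𝓝[>] 0) (𝓝[<] (-0)) := tendsto_neg_nhdsGT
      rw [neg_zero] at h3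
      exact h3.mono_right (nhdsWithin_mono _ fun _ h ↦ ne_of_lt h)
    filter_upwards [nhdsWithin_mono _ (fun _ h ↦ ne_of_gt h) h2, hneg.eventually h2,
      self_mem_nhdsWithin] with s h4 h5 (h6 : 0 < s)
    refine ⟨(pos_iff_pos_of_mul_pos h4).1 (inv_pos.2 h6), ?_⟩
    exact (neg_iff_neg_of_mul_pos h5).1 (inv_lt_zero.2 (neg_lt_zero.2 h6))
  refine eventually_exists_zero (u := fun t (p : M × M) ↦ ℓ (κ (ψ t p.1) - κ p.2)) ?_ hsign hη
  have h1 : Tendsto (fun p : ℝ × (M × M) ↦ ψ p.1 p.2.1) (𝓝 (0, (z, z))) (𝓝 z) := by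
    have : Continuous fun p : ℝ × (M × M) ↦ ψ p.1 p.2.1 := by fun_prop
    simpa using this.tendsto (0, (z, z))
  have h2 : Tendsto (fun p : ℝ × (M × M) ↦ p.2.2) (𝓝 (0, (z, z))) (𝓝 z) :=
    (continuous_snd.comp continuous_snd).tendsto (0, (z, z))
  filter_upwards [h1.eventually hκ, h2.eventually hκ] with p hp1 hp2
  refine ℓ.continuous.continuousAt.comp (ContinuousAt.sub ?_ ?_)
  · exact ContinuousAt.comp (f := fun p : ℝ × (M × M) ↦ ψ p.1 p.2.1)
      hp1 (by fun_prop)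
  · exact ContinuousAt.comp (f := fun p : ℝ × (M × M) ↦ p.2.2)
      hp2 (by fun_prop)

variable [ChartedSpace (EuclideanSpace ℝ (Fin 3)) M] [IsManifold (𝓡 3) ∞ M]

lemma hasDerivAt_extChartAt_flow {ψ : Flow ℝ M} {X : ∀ x : M, TangentSpace (𝓡 3) x} {z : M}
    (hX : IsMIntegralCurve (I := 𝓡 3) (fun t ↦ ψ t z) X) :
    HasDerivAt (fun t ↦ extChartAt (𝓡 3) z (ψ t z)) (X z : EuclideanSpace ℝ (Fin 3)) 0 := by
  have h := (hX.isMIntegralCurveAt 0).eventually_hasDerivAt.self_of_nhds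
  have h2 : HasDerivAt (extChartAt (𝓡 3) (ψ 0 z) ∘ fun t ↦ ψ t z)
      (X (ψ 0 z) : EuclideanSpace ℝ (Fin 3)) 0 :=
    (tangentCoordChange_self (I := 𝓡 3) (v := X (ψ 0 z)) (mem_extChartAt_source (ψ 0 z))) ▸ h
  have h3 : ∀ y, y = z → HasDerivAt (extChartAt (𝓡 3) y ∘ fun t ↦ ψ t z)
      (X y : EuclideanSpace ℝ (Fin 3)) 0 →
      HasDerivAt (fun t ↦ extChartAt (𝓡 3) z (ψ t z)) (X z : EuclideanSpace ℝ (Fin 3)) 0 := by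
    rintro y rfl h
    exact h
  exact h3 _ (ψ.map_zero_apply z) h2

/-- The vector field that generates the flow is tangent to the leaves that contain the orbits. -/
lemma vectorField_mem [CompactSpace M] {F : SurfaceFoliation M}
    {P : ∀ x : M, Submodule ℝ (TangentSpace (𝓡 3) x)} (hT : F.IsTangentTo P)
    (hP : ∀ x, Module.finrank ℝ (P x) = 2) (hPc : IsClosedPlaneField P) {ψ : Flow ℝ M}
    (hψ : ∀ x t, ψ t x ∈ F.leaf x) {X : ∀ x : M, TangentSpace (𝓡 3) x} {z : M}
    (hX : IsMIntegralCurve (I := 𝓡 3) (fun t ↦ ψ t z) X) : X z ∈ P z := by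
  obtain ⟨R, hR, hRF⟩ := F.exists_lebesgue
  obtain ⟨η, hη, h⟩ := SurfaceFoliation.exists_leafConn_flow hψ (half_pos hR)
  have hlim : Tendsto (fun t ↦ ψ t z) (𝓝[≠] 0) (𝓝 z) := by
    have : Continuous fun t ↦ ψ t z := by fun_prop
    have := this.tendsto 0
    rw [ψ.map_zero_apply] at this
    exact this.mono_left nhdsWithin_le_nhds
  have hder := (hasDerivAt_extChartAt_flow hX).tendsto_slope_zero
  simp only [zero_add, ψ.map_zero_apply] at hder
  refine secant_mem (v := X z) hT hP hPc (half_pos hR)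
    (by rwa [mul_div_cancel₀ _ two_ne_zero]) hlim tendsto_const_nhds ?_ hder
  have : ∀ᶠ t in 𝓝[≠] (0:ℝ), t ∈ Metric.closedBall 0 η :=
    nhdsWithin_le_nhds (Metric.closedBall_mem_nhds 0 hη)
  filter_upwards [this] with t ht
  exact (h t (by simpa using ht) z).symm

variable [CompactSpace M] {F₁ F₂ : SurfaceFoliation M}
  {P₁ P₂ : ∀ x : M, Submodule ℝ (TangentSpace (𝓡 3) x)}

/-- Two nearby points in a common plaque of each of two transverse foliations, which both contain
the orbits of the flow, lie on one orbit: otherwise the secant directions from one of them to its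
projection along the flow onto a transverse plane through the other one would accumulate on a
vector tangent to both foliations and transverse to the flow. -/
lemma exists_flow_eq_of_leafConn (hT₁ : F₁.IsTangentTo P₁)
    (hP₁ : ∀ x, Module.finrank ℝ (P₁ x) = 2) (hPc₁ : IsClosedPlaneField P₁)
    (hT₂ : F₂.IsTangentTo P₂) (hP₂ : ∀ x, Module.finrank ℝ (P₂ x) = 2)
    (hPc₂ : IsClosedPlaneField P₂) {ψ : Flow ℝ M} (hψ₁ : ∀ x t, ψ t x ∈ F₁.leaf x)
    (hψ₂ : ∀ x t, ψ t x ∈ F₂.leaf x) {X : ∀ x : M, TangentSpace (𝓡 3) x}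
    (hX : ∀ z, IsMIntegralCurve (I := 𝓡 3) (fun t ↦ ψ t z) X) (hX0 : ∀ z, X z ≠ 0)
    (hline : ∀ z, ∀ w : EuclideanSpace ℝ (Fin 3), w ∈ P₁ z → w ∈ P₂ z →
      ∃ c : ℝ, w = c • (show EuclideanSpace ℝ (Fin 3) from X z)) :
    ∃ R > 0, ∀ a b, F₁.LeafConn R a b → F₂.LeafConn R a b → ∃ τ, ψ τ a = b := by
  obtain ⟨R₁, hR₁, hRF₁⟩ := F₁.exists_lebesgue
  obtain ⟨R₂, hR₂, hRF₂⟩ := F₂.exists_lebesgue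
  by_contra! hcon
  -- A sequence of pairs on different orbits accumulates at some `z`. In a chart at `z`, the flow
  -- moves `a k` to a point `a' k` with `a' k - b k` orthogonal to the vector field at `z`.
  choose a b hab₁ hab₂ hne using fun k : ℕ ↦ hcon (1 / ((k : ℝ) + 1)) (by positivity)
  obtain ⟨z, -, φ, hφ, hz⟩ := isCompact_univ.tendsto_subseq (x := a) fun _ ↦ mem_univ _
  have hε : Tendsto (fun k ↦ 1 / ((φ k : ℝ) + 1)) atTop (𝓝 0) :=
    tendsto_one_div_add_atTop_nhds_zero_nat.comp hφ.tendsto_atTop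
  have hdist : ∀ k, dist (a k) (b k) < 1 / ((k : ℝ) + 1) := fun k ↦ by
    obtain ⟨S, -, -, h1, h2, h3⟩ := hab₁ k
    exact h3 _ h1 _ h2
  have hbz : Tendsto (fun k ↦ b (φ k)) atTop (𝓝 z) :=
    hz.congr_dist (squeeze_zero (fun _ ↦ dist_nonneg) (fun k ↦ (hdist (φ k)).le) hε)
  set κ := extChartAt (𝓡 3) z
  let Y : EuclideanSpace ℝ (Fin 3) := X z
  have hY0 : Y ≠ 0 := hX0 z
  let ℓ : EuclideanSpace ℝ (Fin 3) →L[ℝ] ℝ := innerSL ℝ Y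
  have hℓ : 0 < ℓ Y := by
    simp only [ℓ, innerSL_apply_apply]
    exact real_inner_self_pos.2 hY0
  have hder : HasDerivAt (fun t ↦ κ (ψ t z)) Y 0 := hasDerivAt_extChartAt_flow (hX z)
  have hfoot : ∀ n : ℕ, ∀ᶠ k in atTop, ∃ t : ℝ, |t| < 1 / ((n : ℝ) + 1) ∧
      ℓ (κ (ψ t (a (φ k))) - κ (b (φ k))) = 0 := fun n ↦
    (hz.prodMk_nhds hbz).eventually
      (eventually_exists_flow_foot (by
        filter_upwards [extChartAt_source_mem_nhds (I := 𝓡 3) z] with x hx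
        exact continuousAt_extChartAt' hx) hder hℓ (show (0:ℝ) < 1 / ((n : ℝ) + 1) by positivity))
  obtain ⟨θ, hθ, hfoot⟩ := extraction_forall_of_eventually hfoot
  choose t ht hlev using hfoot
  have hθt := hθ.tendsto_atTop
  have ht0 : Tendsto t atTop (𝓝 0) :=
    squeeze_zero_norm (fun n ↦ (ht n).le) tendsto_one_div_add_atTop_nhds_zero_nat
  have hbz' := hbz.comp hθt
  let a' : ℕ → M := fun k ↦ ψ (t k) (a (φ (θ k)))
  have ha' : Tendsto a' atTop (𝓝 z) := by
    have hc : Continuous fun p : ℝ × M ↦ ψ p.1 p.2 := by fun_prop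
    have := (hc.tendsto (0, z)).comp (ht0.prodMk_nhds (hz.comp hθt))
    simp only [ψ.map_zero_apply] at this
    exact this
  have hsrc := extChartAt_source_mem_nhds (I := 𝓡 3) z
  have hne' : ∀ᶠ k in atTop, κ (a' k) - κ (b (φ (θ k))) ≠ 0 := by
    filter_upwards [ha'.eventually_mem hsrc, hbz'.eventually_mem hsrc] with k h1 h2 h3
    exact hne _ _ ((extChartAt (𝓡 3) z).injOn h1 h2 (sub_eq_zero.1 h3))
  let u : ℕ → EuclideanSpace ℝ (Fin 3) := fun k ↦
    ‖κ (a' k) - κ (b (φ (θ k)))‖⁻¹ • (κ (a' k) - κ (b (φ (θ k))))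
  have hu : ∀ᶠ k in atTop, u k ∈ Metric.sphere 0 1 := by
    filter_upwards [hne'] with k h
    rw [mem_sphere_zero_iff_norm]
    simp only [u]
    rw [norm_smul, norm_inv, norm_norm, inv_mul_cancel₀ (norm_ne_zero_iff.2 h)]
  obtain ⟨v, hv1, χ, hχ, hv⟩ :=
    tendsto_subseq_of_frequently_bounded Metric.isBounded_sphere hu.frequently
  rw [Metric.isClosed_sphere.closure_eq, mem_sphere_zero_iff_norm] at hv1
  have hχt := hχ.tendsto_atTop
  have hmem : ∀ {F : SurfaceFoliation M} {P : ∀ x : M, Submodule ℝ (TangentSpace (𝓡 3) x)} {R : ℝ},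
      F.IsTangentTo P → (∀ x, Module.finrank ℝ (P x) = 2) → IsClosedPlaneField P → 0 < R →
      (∀ x : M, ∃ e ∈ F.atlas, Metric.ball x R ⊆ e.source) → (∀ x t, ψ t x ∈ F.leaf x) →
      (∀ k : ℕ, F.LeafConn (1 / ((k : ℝ) + 1)) (a k) (b k)) → v ∈ P z := by
    intro F P R hT hP hPc hR hRF hψ hab
    obtain ⟨η, hη, h⟩ := SurfaceFoliation.exists_leafConn_flow hψ (show 0 < R / 4 by positivity)
    refine secant_mem (v := v) hT hP hPc (half_pos hR) (by rwa [mul_div_cancel₀ _ two_ne_zero])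
      (ha'.comp hχt) (hbz'.comp hχt) ?_ hv
    have h1 : ∀ᶠ k in atTop, |t k| ≤ η := by
      have := ht0.abs
      rw [abs_zero] at this
      exact (this.eventually_lt_const hη).mono fun _ h ↦ h.le
    filter_upwards [hχt.eventually h1, ((hε.comp hθt).comp hχt).eventually_lt_const
      (show 0 < R / 4 by positivity)] with k h1 h2
    exact ((h _ h1 _).symm.trans ((hab _).mono (s := R / 4) h2.le)).mono (by linarith)
  obtain ⟨c, hc⟩ := hline z v (hmem hT₁ hP₁ hPc₁ hR₁ hRF₁ hψ₁ hab₁)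
    (hmem hT₂ hP₂ hPc₂ hR₂ hRF₂ hψ₂ hab₂)
  have hc' : v = c • Y := hc
  -- The limit `v` of unit vectors is a multiple of the vector field and orthogonal to it.
  have hℓv : ℓ v = 0 := by
    refine tendsto_nhds_unique ((ℓ.continuous.tendsto v).comp hv)
      (tendsto_const_nhds.congr fun k ↦ ?_)
    simp only [Function.comp, u, a', map_smul, hlev, smul_zero]
  rw [hc', map_smul, smul_eq_mul, mul_eq_zero, or_iff_left hℓ.ne'] at hℓv
  rw [hc', hℓv, zero_smul, norm_zero] at hv1
  exact zero_ne_one hv1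

end Orbits

/-- If the points that are close inside the leaves of both foliations lie on a common orbit, then so
does every path in the intersection of two leaves. -/
lemma SurfaceFoliation.interLeaf_subset_orbit {M : Type*} [MetricSpace M]
    {F₁ F₂ : SurfaceFoliation M} {ψ : Flow ℝ M} {R : ℝ} (hR : 0 < R)
    (h : ∀ a b, F₁.LeafConn R a b → F₂.LeafConn R a b → ∃ τ, ψ τ a = b) (x : M) :
    F₁.interLeaf F₂ x ⊆ ψ.orbit x := by
  rintro y ⟨γ, hγ⟩
  have hγ' : ∀ t, γ.extend t ∈ F₁.leaf x ∩ F₂.leaf x := fun t ↦ by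
    obtain ⟨s, hs⟩ : γ.extend t ∈ range γ := γ.extend_range ▸ mem_range_self t
    exact hs ▸ hγ s
  have hloc : ∀ s ∈ (univ : Set ℝ), ∀ᶠ t in 𝓝[univ] s, ∃ τ, ψ τ (γ.extend s) = γ.extend t := by
    intro s hs
    filter_upwards [exists_leafConn_path ordConnected_univ γ.continuous_extend.continuousOn
        (fun t _ ↦ (hγ' t).1) hR hs,
      exists_leafConn_path ordConnected_univ γ.continuous_extend.continuousOn
        (fun t _ ↦ (hγ' t).2) hR hs] with t h1 h2
    exact h _ _ h1 h2
  have := isPreconnected_univ.induction₂ (fun s t ↦ ∃ τ, ψ τ (γ.extend s) = γ.extend t) hloc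
    (fun _ _ _ _ _ _ ⟨τ, h1⟩ ⟨τ', h2⟩ ↦ ⟨τ' + τ, by rw [ψ.map_add, h1, h2]⟩)
    (fun _ _ _ _ ⟨τ, h1⟩ ↦ ⟨-τ, by rw [← h1, ← ψ.map_add, neg_add_cancel, ψ.map_zero_apply]⟩)
    (mem_univ (0:ℝ)) (mem_univ (1:ℝ))
  rwa [γ.extend_zero, γ.extend_one] at this

lemma mem_span_of_mem_sup {a b c w : EuclideanSpace ℝ (Fin 3)}
    (h : LinearIndependent ℝ ![a, b, c]) (h₁ : w ∈ Submodule.span ℝ {a} ⊔ Submodule.span ℝ {b})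
    (h₂ : w ∈ Submodule.span ℝ {b} ⊔ Submodule.span ℝ {c}) : w ∈ Submodule.span ℝ {b} := by
  have hni := notMem_span_of_linearIndependent h
  obtain ⟨u, hu, v, hv, huv⟩ := Submodule.mem_sup.1 h₁
  obtain ⟨s, rfl⟩ := Submodule.mem_span_singleton.1 hu
  have hmem : s • a ∈ Submodule.span ℝ {b} ⊔ Submodule.span ℝ {c} := by
    rw [eq_sub_of_add_eq huv]
    exact Submodule.sub_mem _ h₂ (Submodule.mem_sup_left hv)
  rcases eq_or_ne s 0 with rfl | h0
  · rw [zero_smul, zero_add] at huv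
    exact huv ▸ hv
  · exact absurd ((Submodule.smul_mem_iff _ h0).1 hmem) hni

section CenterLeaf

variable {M : Type*} [MetricSpace M] [ChartedSpace (EuclideanSpace ℝ (Fin 3)) M]
  [IsManifold (𝓡 3) ∞ M] {f : M ≃ₘ⟮𝓡 3, 𝓡 3⟯ M}

lemma PartiallyHyperbolicSplitting.mem_Ec (S : PartiallyHyperbolicSplitting f) {z : M}
    {w : EuclideanSpace ℝ (Fin 3)} (h₁ : w ∈ S.Es z ⊔ S.Ec z) (h₂ : w ∈ S.Ec z ⊔ S.Eu z) :
    w ∈ S.Ec z := by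
  obtain ⟨a, -, ha⟩ := S.continuous_Es.exists_generator z
  obtain ⟨b, -, hb⟩ := S.continuous_Ec.exists_generator z
  obtain ⟨c, -, hc⟩ := S.continuous_Eu.exists_generator z
  have hsp := S.span_eq_top z
  rw [sup_assoc, ha.self_of_nhds.2, hb.self_of_nhds.2, hc.self_of_nhds.2] at hsp
  rw [ha.self_of_nhds.2, hb.self_of_nhds.2] at h₁
  rw [hb.self_of_nhds.2, hc.self_of_nhds.2] at h₂
  rw [hb.self_of_nhds.2]
  exact mem_span_of_mem_sup (linearIndependent_of_span_sup_eq_top hsp) h₁ h₂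

variable [CompactSpace M]

/-- The center leaves are the orbits of the flow. -/
lemma centerLeaf_eq_orbit (W : CenterFoliations f) {ψ : Flow ℝ M} (hA : IsTopologicalAnosovFlow ψ)
    {h : M → ℝ} (hc : Continuous h) (hpos : ∀ x, 0 < h x) (hψ : ∀ x, f x = ψ (h x) x) (x : M) :
    W.centerLeaf x = ψ.orbit x := by
  refine Subset.antisymm ?_ (by
    rintro _ ⟨t, rfl⟩
    exact orbit_subset_centerLeaf W hc hpos hψ x t)
  obtain ⟨X, -, hX0, hX⟩ := hA.exists_vectorField
  let S := W.splitting
  have hs₁ : ∀ x, S.Eu x ⊔ (S.Es x ⊔ S.Ec x) = ⊤ := fun x ↦ by rw [sup_comm, S.span_eq_top]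
  have hs₂ : ∀ x, S.Es x ⊔ (S.Ec x ⊔ S.Eu x) = ⊤ := fun x ↦ by rw [← sup_assoc, S.span_eq_top]
  have hP₁ := finrank_sup_eq_two S.continuous_Eu S.continuous_Es S.continuous_Ec hs₁
  have hP₂ := finrank_sup_eq_two S.continuous_Es S.continuous_Ec S.continuous_Eu hs₂
  have hPc₁ := isClosedPlaneField_sup S.continuous_Eu S.continuous_Es S.continuous_Ec hs₁
  have hPc₂ := isClosedPlaneField_sup S.continuous_Es S.continuous_Ec S.continuous_Eu hs₂
  have hψ₁ : ∀ x t, ψ t x ∈ W.Wcs.leaf x := fun x t ↦ (flow_mem_leaves W hc hpos hψ x t).1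
  have hψ₂ : ∀ x t, ψ t x ∈ W.Wcu.leaf x := fun x t ↦ (flow_mem_leaves W hc hpos hψ x t).2
  obtain ⟨R, hR, h⟩ := exists_flow_eq_of_leafConn W.tangent_Wcs hP₁ hPc₁ W.tangent_Wcu hP₂ hPc₂
    hψ₁ hψ₂ hX hX0 fun z w h₁ h₂ ↦ by
      have hw := S.mem_Ec h₁ h₂
      have hXz := S.mem_Ec (vectorField_mem W.tangent_Wcs hP₁ hPc₁ hψ₁ (hX z))
        (vectorField_mem W.tangent_Wcu hP₂ hPc₂ hψ₂ (hX z))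
      obtain ⟨b, -, hb⟩ := S.continuous_Ec.exists_generator z
      rw [hb.self_of_nhds.2] at hw hXz
      obtain ⟨s, hs⟩ := Submodule.mem_span_singleton.1 hw
      obtain ⟨t, ht⟩ := Submodule.mem_span_singleton.1 hXz
      -- The vector field does not vanish, so it spans the center line.
      have ht0 : t ≠ 0 := by
        rintro rfl
        exact hX0 z (ht.symm.trans (zero_smul ℝ (b z)))
      refine ⟨s / t, ?_⟩
      have ht' : (show EuclideanSpace ℝ (Fin 3) from X z) = t • b z := ht.symm
      have hs' : w = s • b z := hs.symm
      rw [ht', hs', smul_smul, div_mul_cancel₀ _ ht0]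
  exact SurfaceFoliation.interLeaf_subset_orbit hR h x

end CenterLeaf

/-! ### Periodic orbits -/

section Periods

variable {M : Type*} [MetricSpace M] (ψ : Flow ℝ M) (x : M)

/-- The group of periods of a point. -/
def periods : AddSubgroup ℝ where
  carrier := {t | ψ t x = x}
  add_mem' {s t} (hs : ψ s x = x) (ht : ψ t x = x) := by
    change ψ (s + t) x = x
    rw [ψ.map_add, ht, hs]
  zero_mem' := ψ.map_zero_apply x
  neg_mem' {t} (ht : ψ t x = x) := by
    change ψ (-t) x = x
    conv_lhs => rw [← ht]
    rw [← ψ.map_add, neg_add_cancel, ψ.map_zero_apply]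

variable {ψ x}

lemma mem_periods {t : ℝ} : t ∈ periods ψ x ↔ ψ t x = x := Iff.rfl

lemma sub_mem_periods {s t : ℝ} : s - t ∈ periods ψ x ↔ ψ s x = ψ t x := by
  rw [mem_periods]
  constructor
  · intro h
    conv_rhs => rw [← h]
    rw [← ψ.map_add, add_sub_cancel]
  · intro h
    rw [sub_eq_neg_add, ψ.map_add, h, ← ψ.map_add, neg_add_cancel, ψ.map_zero_apply]

lemma orbit_eq_of_mem {y : M} (h : y ∈ ψ.orbit x) : ψ.orbit y = ψ.orbit x := by
  obtain ⟨t, rfl⟩ := h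
  ext z
  constructor
  · rintro ⟨s, rfl⟩
    exact ⟨s + t, ψ.map_add s t x⟩
  · rintro ⟨s, rfl⟩
    refine ⟨s - t, ?_⟩
    change ψ (s - t) (ψ t x) = ψ s x
    rw [← ψ.map_add, sub_add_cancel]

/-- A compact orbit is periodic: by Baire's theorem some compact segment has interior in the orbit,
and finitely many of its translates cover the orbit. -/
lemma exists_period_of_isCompact (h : IsCompact (ψ.orbit x)) : ∃ T > 0, ψ T x = x := by
  have : CompactSpace (ψ.orbit x) := isCompact_iff_compactSpace.1 h
  have : Nonempty (ψ.orbit x) := (ψ.nonempty_orbit x).to_subtype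
  let p : ℝ → ψ.orbit x := fun t ↦ ⟨ψ t x, ψ.mem_orbit x t⟩
  have hp : Continuous p := Continuous.subtype_mk (by fun_prop) _
  obtain ⟨n, hn⟩ := nonempty_interior_of_iUnion_of_closed
    (f := fun n : ℕ ↦ p '' Icc (-n) n) (fun n ↦ (isCompact_Icc.image hp).isClosed) (by
      refine eq_univ_of_forall ?_
      rintro ⟨_, t, rfl⟩
      obtain ⟨n, hn⟩ := exists_nat_ge |t|
      exact mem_iUnion.2 ⟨n, t, abs_le.1 hn, rfl⟩)
  obtain ⟨⟨_, t₀, rfl⟩, hq⟩ := hn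
  obtain ⟨s, hs⟩ := isCompact_univ.elim_finite_subcover
    (fun t : ℝ ↦ (fun y : ψ.orbit x ↦ (⟨ψ t y, ψ.mem_orbit_of_mem_orbit t y.2⟩ : ψ.orbit x)) ⁻¹'
      interior (p '' Icc (-n) n))
    (fun t ↦ isOpen_interior.preimage (Continuous.subtype_mk (by fun_prop) _)) (by
      rintro ⟨_, t, rfl⟩ -
      refine mem_iUnion.2 ⟨t₀ - t, ?_⟩
      rw [mem_preimage]
      convert hq using 1
      refine Subtype.ext ?_
      change ψ (t₀ - t) (ψ t x) = ψ t₀ x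
      rw [← ψ.map_add, sub_add_cancel])
  -- every point of the orbit is at bounded time from `x`
  obtain ⟨B, hB⟩ := (s.finite_toSet.image fun t ↦ (n : ℝ) - t).bddAbove
  obtain ⟨t, ht, hmem⟩ := mem_iUnion₂.1 (hs (mem_univ (p (B + 1))))
  obtain ⟨u, hu, hu'⟩ := interior_subset hmem
  have hu2 : ψ u x = ψ (t + (B + 1)) x := by
    rw [ψ.map_add]
    exact congrArg Subtype.val hu'
  have h1 : (n : ℝ) - t ≤ B := hB ⟨t, ht, rfl⟩
  refine ⟨t + (B + 1) - u, by linarith [hu.2], ?_⟩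
  exact sub_mem_periods.2 hu2.symm

end Periods

section Arcs

variable {M : Type*} [MetricSpace M] {ψ : Flow ℝ M} {x : M}

/-- The periods of a periodic point that is not fixed by the flow have a positive generator. -/
lemma exists_minimal_period {T : ℝ} (hT : 0 < T) (hTx : ψ T x = x) {s : ℝ} (hs : ψ s x ≠ x) :
    ∃ a > 0, ψ a x = x ∧ ∀ u v, ψ u x = ψ v x → ∃ j : ℤ, u - v = j * a := by
  have hcl : IsClosed (periods ψ x : Set ℝ) :=
    isClosed_eq (f := fun t ↦ ψ t x) (by fun_prop) continuous_const
  rcases (periods ψ x).dense_or_cyclic with hd | ⟨a, ha⟩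
  · have : (periods ψ x : Set ℝ) = univ := by rw [← hcl.closure_eq, hd.closure_eq]
    exact absurd (show s ∈ (periods ψ x : Set ℝ) by rw [this]; trivial) hs
  · rw [← AddSubgroup.zmultiples_eq_closure] at ha
    have ha0 : a ≠ 0 := by
      rintro rfl
      have : T ∈ periods ψ x := hTx
      rw [ha, AddSubgroup.zmultiples_zero_eq_bot, AddSubgroup.mem_bot] at this
      exact hT.ne' this
    have hb : periods ψ x = AddSubgroup.zmultiples |a| := by
      rcases abs_choice a with h | h
      · rw [h, ha]
      · rw [h, AddSubgroup.zmultiples_neg, ha]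
    refine ⟨|a|, abs_pos.2 ha0, ?_, fun u v huv ↦ ?_⟩
    · rw [← mem_periods, hb]
      exact AddSubgroup.mem_zmultiples _
    · have := sub_mem_periods.2 huv
      rw [hb] at this
      obtain ⟨j, hj⟩ := this
      exact ⟨j, by simpa using hj.symm⟩

/-- A connected subset of a closed orbit contains one of the two arcs between two of its points. -/
lemma arc_subset_or_arc_subset {a : ℝ} (hax : ψ a x = x)
    (hinj : ∀ u v, ψ u x = ψ v x → ∃ j : ℤ, u - v = j * a) {A : Set M} (hA : IsPreconnected A)
    (hAx : A ⊆ ψ.orbit x) (hxA : x ∈ A) {c : ℝ} (hc : c ∈ Ioo 0 a) (hcA : ψ c x ∈ A) :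
    (∀ t ∈ Icc 0 c, ψ t x ∈ A) ∨ ∀ t ∈ Icc c a, ψ t x ∈ A := by
  by_contra! hcon
  obtain ⟨⟨s, hs, hsA⟩, s', hs', hsA'⟩ := hcon
  have h0 : (0:ℝ) < a := hc.1.trans hc.2
  have hψc : Continuous fun t ↦ ψ t x := by fun_prop
  have hadd : ∀ t, ψ (t + a) x = ψ t x := fun t ↦ by rw [ψ.map_add, hax]
  have hs0 : 0 < s := hs.1.lt_of_ne fun h ↦ hsA (by rwa [← h, ψ.map_zero_apply])
  have hsa' : s' < a := hs'.2.lt_of_ne fun h ↦ hsA' (by rwa [h, hax])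
  -- The two arcs that the missed points at the times `s` and `s'` bound cover the orbit, and the
  -- connected set `A` meets both; so it contains a common point, which is one of these two.
  obtain ⟨w, hwA, ⟨u, hu, rfl⟩, v, hv, hvu⟩ := isPreconnected_closed_iff.1 hA
    ((fun t ↦ ψ t x) '' Icc s s') ((fun t ↦ ψ t x) '' Icc s' (s + a))
    (isCompact_Icc.image hψc).isClosed (isCompact_Icc.image hψc).isClosed (by
      intro y hy
      obtain ⟨t, rfl⟩ := hAx hy
      obtain ⟨t', ht', k, hk⟩ : ∃ t' ∈ Ico s (s + a), ∃ k : ℤ, t = t' + k * a := by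
        refine ⟨toIcoMod h0 s t, toIcoMod_mem_Ico h0 s t, toIcoDiv h0 s t, ?_⟩
        have := toIcoMod_add_toIcoDiv_zsmul h0 s t
        rw [zsmul_eq_mul] at this
        exact this.symm
      have htt' : ψ t' x = ψ t x := by
        rw [eq_comm, ← sub_mem_periods]
        have := (periods ψ x).zsmul_mem hax k
        simpa [hk] using this
      rcases le_total t' s' with h | h
      · exact .inl ⟨t', ⟨ht'.1, h⟩, htt'⟩
      · exact .inr ⟨t', ⟨h, ht'.2.le⟩, htt'⟩)
    ⟨ψ c x, hcA, c, ⟨hs.2, hs'.1⟩, rfl⟩ ⟨x, hxA, a, ⟨hsa'.le, by linarith⟩, hax⟩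
  obtain ⟨j, hj⟩ := hinj _ _ hvu
  -- the time `v - u` is a multiple of `a` between `0` and `a`
  have hj0 : (0:ℝ) ≤ j * a := by linarith [hu.2, hv.1]
  have hj1 : (j:ℝ) * a ≤ 1 * a := by linarith [hu.1, hv.2]
  have hj0' : 0 ≤ j := by exact_mod_cast nonneg_of_mul_nonneg_left hj0 h0
  have hj1' : j ≤ 1 := by exact_mod_cast le_of_mul_le_mul_right hj1 h0
  obtain rfl | rfl : j = 0 ∨ j = 1 := by omega
  · have : u = s' := by
      simp only [Int.cast_zero, zero_mul] at hj
      linarith [hu.2, hv.1]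
    exact hsA' (this ▸ hwA)
  · have : u = s := by
      simp only [Int.cast_one, one_mul] at hj
      linarith [hu.1, hv.2]
    exact hsA (this ▸ hwA)

/-- If `f` moves the points of a closed orbit by positive times `u`, then finitely many images of a
fundamental arc cover the orbit. -/
lemma exists_iterate_cover {f : M → M} {a : ℝ} (ha : 0 < a) (hax : ψ a x = x) {u : ℝ → ℝ}
    (hu : Continuous u) (hpos : ∀ t, 0 < u t) (hper : ∀ t, u (t + a) = u t)
    (hf : ∀ t, f (ψ t x) = ψ (t + u t) x) :
    ∃ m : ℕ, ∀ A : Set M, (∀ t ∈ Icc 0 (u 0), ψ t x ∈ A) →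
      ∀ y ∈ ψ.orbit x, ∃ i < m, y ∈ f^[i] '' A := by
  obtain ⟨e, he, hle⟩ : ∃ e > 0, ∀ t, e ≤ u t := by
    obtain ⟨t₀, -, ht₀⟩ := isCompact_Icc.exists_isMinOn (nonempty_Icc.2 ha.le) hu.continuousOn
    refine ⟨u t₀, hpos t₀, fun t ↦ ?_⟩
    obtain ⟨t', ht', h⟩ := Function.Periodic.exists_mem_Ico₀ (c := a) hper ha t
    rw [h]
    exact ht₀ ⟨ht'.1, ht'.2.le⟩
  let F : ℝ → ℝ := fun t ↦ t + u t
  have hF : Continuous F := by fun_prop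
  have hmono : ∀ i : ℕ, F^[i] 0 ≤ F^[i + 1] 0 := fun i ↦ by
    rw [Function.iterate_succ_apply']
    exact le_add_of_nonneg_right (hpos _).le
  have hgrow : ∀ i : ℕ, i * e ≤ F^[i] 0 := fun i ↦ by
    induction i with
    | zero => simp
    | succ i ih =>
      rw [Function.iterate_succ_apply']
      push_cast
      have := hle (F^[i] 0)
      simp only [F] at *
      linarith
  obtain ⟨m, hm⟩ := exists_nat_ge (a / e)
  rw [div_le_iff₀ he] at hm
  refine ⟨m, fun A hA y hy ↦ ?_⟩
  -- `F` is the lift of `f` to the time axis: the images of the first arc are consecutive arcs.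
  have harc : ∀ i : ℕ, ∀ t ∈ Icc (F^[i] 0) (F^[i + 1] 0), ψ t x ∈ f^[i] '' A := fun i ↦ by
    induction i with
    | zero =>
      intro t ht
      exact ⟨_, hA t (by simpa [F] using ht), rfl⟩
    | succ i ih =>
      intro t ht
      rw [Function.iterate_succ_apply', Function.iterate_succ_apply' F (i + 1)] at ht
      obtain ⟨s, hs, rfl⟩ := intermediate_value_Icc (hmono i) hF.continuousOn ht
      obtain ⟨w, hw, hws⟩ := ih s hs
      exact ⟨w, hw, by rw [Function.iterate_succ_apply', hws, hf]⟩
  have hcover : ∀ k : ℕ, ∀ t ∈ Ico 0 (F^[k] 0), ∃ i < k, ψ t x ∈ f^[i] '' A := fun k ↦ by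
    induction k with
    | zero => simp
    | succ k ih =>
      intro t ht
      rcases lt_or_ge t (F^[k] 0) with h | h
      · obtain ⟨i, hi, h⟩ := ih t ⟨ht.1, h⟩
        exact ⟨i, by omega, h⟩
      · exact ⟨k, k.lt_succ_self, harc k t ⟨h, ht.2.le⟩⟩
  obtain ⟨t, rfl⟩ := hy
  obtain ⟨t', ht', h⟩ := Function.Periodic.exists_mem_Ico₀ (f := fun t ↦ ψ t x) (c := a)
    (fun t ↦ by beta_reduce; rw [ψ.map_add, hax]) ha t
  change ∃ i < m, ψ t x ∈ f^[i] '' A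
  change ψ t x = ψ t' x at h
  rw [h]
  exact hcover m t' ⟨ht'.1, ht'.2.trans_le (hm.trans (hgrow m))⟩

/-- If `f` moves points along the flow and has no fixed point on a closed orbit, then a connected
subset of the orbit that contains a point and its image covers the orbit by a bounded number of
images. -/
lemma exists_iterate_cover_of_isPreconnected {f : M → M} {h : M → ℝ} (hh : Continuous h)
    (hf : ∀ y, f y = ψ (h y) y) {T : ℝ} (hT : 0 < T) (hTx : ψ T x = x)
    (hfix : ∀ y ∈ ψ.orbit x, f y ≠ y) :
    ∃ m : ℕ, ∀ A : Set M, IsPreconnected A → A ⊆ ψ.orbit x → x ∈ A → f x ∈ A →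
      ∀ y ∈ ψ.orbit x, ∃ i < m, y ∈ f^[i] '' A := by
  obtain ⟨a, ha, hax, hinj⟩ := exists_minimal_period hT hTx (s := h x)
    (by rw [← hf]; exact hfix x (ψ.mem_orbit_self x))
  have hper : ∀ (t : ℝ) (k : ℤ), ψ (t + k * a) x = ψ t x := fun t k ↦ by
    rw [← sub_mem_periods]
    have := (periods ψ x).zsmul_mem hax k
    simpa using this
  let j : ℤ := ⌊h x / a⌋
  let u : ℝ → ℝ := fun t ↦ h (ψ t x) - j * a
  have hu : Continuous u := by fun_prop
  have hfu : ∀ t, f (ψ t x) = ψ (t + u t) x := fun t ↦ by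
    rw [hf, ← ψ.map_add, ← hper (t + u t) j]
    congr 1
    simp only [u]
    ring
  have hne : ∀ t, ∀ k : ℤ, u t ≠ k * a := fun t k hk ↦ by
    refine hfix _ (ψ.mem_orbit x t) ?_
    rw [hfu, hk, hper]
  have hu0 : u 0 ∈ Icc 0 a := by
    have h1 := Int.floor_le (h x / a)
    have h2 := Int.lt_floor_add_one (h x / a)
    rw [le_div_iff₀ ha] at h1
    rw [div_lt_iff₀ ha] at h2
    simp only [u, ψ.map_zero_apply]
    constructor <;> linarith
  -- the continuous function `u` takes no value in `ℤ a`
  have hpos : ∀ t, 0 < u t := fun t ↦ by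
    by_contra! hle
    obtain ⟨s, hs⟩ := mem_range_of_exists_le_of_exists_ge hu ⟨t, hle⟩ ⟨0, hu0.1⟩
    exact hne s 0 (by simpa using hs)
  have hlt : ∀ t, u t < a := fun t ↦ by
    by_contra! hle
    obtain ⟨s, hs⟩ := mem_range_of_exists_le_of_exists_ge hu ⟨0, hu0.2⟩ ⟨t, hle⟩
    exact hne s 1 (by simpa using hs)
  have hup : ∀ t, u (t + a) = u t := fun t ↦ by
    simp only [u]
    rw [ψ.map_add, hax]
  -- Seen along the reversed flow, `f` moves the points by the positive times `a - u`.
  obtain ⟨m₁, hm₁⟩ := exists_iterate_cover ha hax hu hpos hup hfu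
  obtain ⟨m₂, hm₂⟩ := exists_iterate_cover (ψ := ψ.reverse) (x := x) (f := f) (a := a) ha
    (by
      have := hper 0 (-1)
      simpa using this) (u := fun t ↦ a - u (-t)) (by fun_prop) (fun t ↦ sub_pos.2 (hlt _))
    (fun t ↦ by
      have := hup (-(t + a))
      rw [neg_add, neg_add_cancel_right] at this
      rw [neg_add, this]) (fun t ↦ by
      rw [Flow.reverse_apply, Flow.reverse_apply, hfu,
        ← hper (-(t + (a - u (-t)))) 1]
      congr 1
      push_cast
      ring)
  refine ⟨max m₁ m₂, fun A hA hAx hxA hfxA y hy ↦ ?_⟩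
  have hcA : ψ (u 0) x ∈ A := by
    have := hfu 0
    rw [ψ.map_zero_apply, zero_add] at this
    rwa [← this]
  rcases arc_subset_or_arc_subset hax hinj hA hAx hxA ⟨hpos 0, hlt 0⟩ hcA with harc | harc
  · obtain ⟨i, hi, h⟩ := hm₁ A harc y hy
    exact ⟨i, hi.trans_le (le_max_left _ _), h⟩
  · obtain ⟨t, rfl⟩ := hy
    obtain ⟨i, hi, h⟩ := hm₂ A (fun s hs ↦ by
      simp only [neg_zero] at hs
      rw [Flow.reverse_apply, ← hper (-s) 1]
      exact harc _ ⟨by push_cast; linarith [hs.2], by push_cast; linarith [hs.1]⟩) (ψ t x)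
      ⟨-t, by
        change ψ (- -t) x = ψ t x
        rw [neg_neg]⟩
    exact ⟨i, hi.trans_le (le_max_right _ _), h⟩

end Arcs

section Expansive

variable {M : Type*} [MetricSpace M] [CompactSpace M] {ψ : Flow ℝ M}

/-- An expansive flow has finitely many periodic orbits of bounded period. -/
lemma exists_orbit_eq_of_bounded_period (hψ : IsExpansiveFlow ψ) {y : ℕ → M} {p : ℕ → ℝ} {a b : ℝ}
    (ha : 0 < a) (hp : ∀ n, p n ∈ Icc a b) (hper : ∀ n, ψ (p n) (y n) = y n) :
    ∃ n m, n < m ∧ y m ∈ ψ.orbit (y n) := by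
  obtain ⟨δ, hδ, hexp⟩ := hψ 1 one_pos
  obtain ⟨⟨z, q⟩, hq, φ, hφ, hlim⟩ := (isCompact_univ.prod (isCompact_Icc (a := a) (b := b)))
    |>.tendsto_subseq (x := fun n ↦ (y n, p n)) fun n ↦ ⟨mem_univ _, hp n⟩
  have hq0 : q ≠ 0 := (ha.trans_le hq.2.1).ne'
  have hy : Tendsto (fun k ↦ y (φ k)) atTop (𝓝 z) := (continuous_fst.tendsto _).comp hlim
  have hpq : Tendsto (fun k ↦ p (φ k)) atTop (𝓝 q) := (continuous_snd.tendsto _).comp hlim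
  have hr : Tendsto (fun k ↦ p (φ (k + 1)) / p (φ k)) atTop (𝓝 1) := by
    have := (hpq.comp (tendsto_add_atTop_nat 1)).div hpq hq0
    rwa [div_self hq0] at this
  have hev : ∀ᶠ w : M × M × ℝ in 𝓝 (z, z, 1), ∀ t ∈ Icc 0 b,
      dist (ψ t w.1) (ψ (t * w.2.2) w.2.1) < δ := by
    refine isCompact_Icc.eventually_forall_of_forall_eventually fun t _ ↦ ?_
    have hc : Continuous fun w : (M × M × ℝ) × ℝ ↦
      dist (ψ w.2 w.1.1) (ψ (w.2 * w.1.2.2) w.1.2.1) := by fun_prop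
    refine hc.continuousAt.eventually_lt_const ?_
    simpa using hδ
  obtain ⟨k, hk⟩ := ((hy.prodMk_nhds
    ((hy.comp (tendsto_add_atTop_nat 1)).prodMk_nhds hr)).eventually hev).exists
  refine ⟨φ k, φ (k + 1), hφ k.lt_succ_self, ?_⟩
  have hpk : 0 < p (φ k) := ha.trans_le (hp _).1
  -- Rescaling time linearly, so that the periods match, makes the two closed orbits shadow each
  -- other over one period, hence for all times.
  obtain ⟨τ, -, hτ⟩ := hexp (y (φ k)) (y (φ (k + 1))) (fun t ↦ t * (p (φ (k + 1)) / p (φ k)))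
    (by fun_prop) (zero_mul _) fun t ↦ by
      let t₀ := t - ⌊t / p (φ k)⌋ * p (φ k)
      have h1 : t₀ ∈ Icc 0 b := by
        have h2 := Int.floor_le (t / p (φ k))
        have h3 := (Int.lt_floor_add_one (t / p (φ k))).le
        rw [le_div_iff₀ hpk] at h2
        rw [div_le_iff₀ hpk] at h3
        exact ⟨by simp only [t₀]; linarith, by simp only [t₀]; linarith [(hp (φ k)).2]⟩
      have h2 : ψ t₀ (y (φ k)) = ψ t (y (φ k)) := by
        rw [eq_comm, ← sub_mem_periods]
        have := (periods ψ (y (φ k))).zsmul_mem (hper (φ k)) ⌊t / p (φ k)⌋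
        simpa [t₀] using this
      have h3 : ψ (t₀ * (p (φ (k + 1)) / p (φ k))) (y (φ (k + 1))) =
          ψ (t * (p (φ (k + 1)) / p (φ k))) (y (φ (k + 1))) := by
        rw [eq_comm, ← sub_mem_periods]
        have := (periods ψ (y (φ (k + 1)))).zsmul_mem (hper (φ (k + 1))) ⌊t / p (φ k)⌋
        convert this using 1
        simp only [t₀, zsmul_eq_mul]
        field_simp
        ring
      have := hk t₀ h1
      simp only [Function.comp] at this
      rwa [h2, h3] at this
  exact ⟨τ, hτ.symm⟩

end Expansive

section Commuting

variable {M : Type*} [MetricSpace M] {ψ : Flow ℝ M} {x : M}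

lemma image_orbit_eq {g : M ≃ₜ M} (hg : ∀ y t, g (ψ t y) ∈ ψ.orbit (g y))
    (hg' : ∀ y t, g.symm (ψ t y) ∈ ψ.orbit (g.symm y)) (y : M) :
    g '' ψ.orbit y = ψ.orbit (g y) := by
  refine Subset.antisymm ?_ ?_
  · rintro _ ⟨_, ⟨t, rfl⟩, rfl⟩
    exact hg y t
  · rintro _ ⟨t, rfl⟩
    have := hg' (g y) t
    rw [g.symm_apply_apply] at this
    exact ⟨_, this, g.apply_symm_apply _⟩

lemma image_iterate_orbit {g : M → M} (hg : ∀ y, g '' ψ.orbit y = ψ.orbit (g y)) (n : ℕ) (y : M) :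
    g^[n] '' ψ.orbit y = ψ.orbit (g^[n] y) := by
  induction n with
  | zero => simp
  | succ n ih => rw [Function.iterate_succ', image_comp, ih, hg, Function.comp_apply]

variable [CompactSpace M]

/-- The images of a closed orbit by the iterates of a homeomorphism that commutes with `f` and
permutes the orbits have bounded periods. -/
lemma exists_bounded_period {f : M → M} {h : M → ℝ} (hh : Continuous h) (hpos : ∀ y, 0 < h y)
    (hf : ∀ y, f y = ψ (h y) y) {g : M ≃ₜ M} (hgf : Function.Commute g f)
    (hg : ∀ y, g '' ψ.orbit y = ψ.orbit (g y)) {T : ℝ} (hT : 0 < T) (hTx : ψ T x = x) :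
    ∃ a b : ℝ, 0 < a ∧ ∀ n : ℕ, ∃ y ∈ ψ.orbit (g^[n] x), ∃ p ∈ Icc a b, ψ p y = y := by
  have : Nonempty M := ⟨x⟩
  obtain ⟨y₁, -, hy₁⟩ := isCompact_univ.exists_isMinOn univ_nonempty hh.continuousOn
  obtain ⟨y₂, -, hy₂⟩ := isCompact_univ.exists_isMaxOn univ_nonempty hh.continuousOn
  have hmin : ∀ y, h y₁ ≤ h y := fun y ↦ hy₁ (mem_univ y)
  have hmax : ∀ y, h y ≤ h y₂ := fun y ↦ hy₂ (mem_univ y)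
  by_cases hfix : ∃ y ∈ ψ.orbit x, f y = y
  · obtain ⟨y, hy, hfy⟩ := hfix
    -- The images of a fixed point of `f` are fixed by `f`; hence `h` takes a period of their
    -- orbits as its value there.
    refine ⟨h y₁, h y₂, hpos y₁, fun n ↦ ⟨g^[n] y, ?_, h (g^[n] y), ⟨hmin _, hmax _⟩, ?_⟩⟩
    · rw [← image_iterate_orbit hg]
      exact mem_image_of_mem _ hy
    · rw [← hf, ← (hgf.iterate_left n).eq, hfy]
  · push Not at hfix
    have hc : Continuous f := by
      have : f = fun y ↦ ψ (h y) y := funext hf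
      rw [this]
      fun_prop
    obtain ⟨m, hm⟩ := exists_iterate_cover_of_isPreconnected hh hf hT hTx hfix
    let L := (m + 1) * h y₂
    have hL : 0 ≤ L := by
      have := hpos y₂
      positivity
    refine ⟨1, L + 1, one_pos, fun n ↦ ⟨g^[n] x, ψ.mem_orbit_self _, ?_⟩⟩
    let G := iterateHomeomorph g n
    have hG : ∀ y, G y = g^[n] y := fun _ ↦ rfl
    have hGf : ∀ i y, G (f^[i] y) = f^[i] (G y) := fun i y ↦
      ((hgf.iterate_left n).iterate_right i).eq y
    have hGO : G '' ψ.orbit x = ψ.orbit (G x) := image_iterate_orbit hg n x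
    -- the arc of the orbit of `G x` from this point to its image by `f`
    let A : Set M := (fun t ↦ ψ t (G x)) '' Icc 0 (h (G x))
    have hψc : Continuous fun t ↦ ψ t (G x) := by fun_prop
    have hA : A ⊆ G '' ψ.orbit x := by
      rw [hGO]
      rintro _ ⟨t, -, rfl⟩
      exact ψ.mem_orbit _ t
    have hw : ψ (L + 1) (G x) ∈ G '' ψ.orbit x := by
      rw [hGO]
      exact ψ.mem_orbit _ _
    -- The first `m` images of this arc by `f` cover the orbit and lie at times less than `L + 1`;
    -- so the point at time `L + 1` has been reached before.
    obtain ⟨w, hwx, hw⟩ := hw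
    obtain ⟨i, hi, v, hv, rfl⟩ := hm (G.symm '' A)
      ((isPreconnected_Icc.image _ hψc.continuousOn).image _ G.symm.continuous.continuousOn)
      (by
        rintro _ ⟨z, hz, rfl⟩
        obtain ⟨y, hy, rfl⟩ := hA hz
        rwa [G.symm_apply_apply])
      ⟨G x, ⟨0, ⟨le_rfl, (hpos _).le⟩, ψ.map_zero_apply _⟩, G.symm_apply_apply x⟩
      ⟨f (G x), ⟨h (G x), ⟨(hpos _).le, le_rfl⟩, (hf _).symm⟩, by
        rw [← Function.iterate_one f, ← hGf, G.symm_apply_apply]⟩ w hwx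
    obtain ⟨_, ⟨t, ht, rfl⟩, rfl⟩ := hv
    rw [hGf, G.apply_symm_apply, iterate_eq_flow hf, ← ψ.map_add, eq_comm, ← sub_mem_periods] at hw
    refine ⟨_, ?_, hw⟩
    set S := birkhoffSum f h i (ψ t (G x))
    have hS0 : 0 ≤ S := birkhoffSum_nonneg_of_pos hpos i _
    have hS1 : S ≤ m * h y₂ := by
      refine (birkhoffSum_le hmax i _).trans ?_
      have := hpos y₂
      gcongr
    have ht1 := ht.2.trans (hmax (G x))
    have ht0 := ht.1
    have hLe : L = m * h y₂ + h y₂ := by simp only [L]; ring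
    constructor <;> linarith

/-- A homeomorphism that permutes the orbits of an expansive flow and commutes with a map
`x ↦ φ^{h x} x` permutes periodically the images of each closed orbit. -/
lemma exists_iterate_image_orbit_eq (hψ : IsExpansiveFlow ψ) {f : M → M} {h : M → ℝ}
    (hh : Continuous h) (hpos : ∀ y, 0 < h y) (hf : ∀ y, f y = ψ (h y) y) {g : M ≃ₜ M}
    (hgf : Function.Commute g f) (hg : ∀ y, g '' ψ.orbit y = ψ.orbit (g y))
    (hx : IsCompact (ψ.orbit x)) : ∃ k : ℕ, 1 ≤ k ∧ g^[k] '' ψ.orbit x = ψ.orbit x := by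
  obtain ⟨T, hT, hTx⟩ := exists_period_of_isCompact hx
  obtain ⟨a, b, ha, hab⟩ := exists_bounded_period hh hpos hf hgf hg hT hTx
  choose y hy p hp hper using hab
  obtain ⟨n, m, hnm, h⟩ := exists_orbit_eq_of_bounded_period hψ ha hp hper
  have h1 : ψ.orbit (g^[n] x) = ψ.orbit (g^[m] x) := by
    rw [← orbit_eq_of_mem (hy n), ← orbit_eq_of_mem (hy m), orbit_eq_of_mem h]
  refine ⟨m - n, by omega, (g.injective.iterate n).image_injective ?_⟩
  rw [← image_comp, ← Function.iterate_add, Nat.add_sub_cancel' hnm.le, image_iterate_orbit hg,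
    image_iterate_orbit hg, h1]

end Commuting

/-! ### The centralizer -/

/-- The conjugate of a flow by a homeomorphism. -/
def conjFlow {M : Type*} [TopologicalSpace M] (g : M ≃ₜ M) (ψ : Flow ℝ M) : Flow ℝ M where
  toFun t x := g (ψ t (g.symm x))
  cont' := by fun_prop
  map_add' s t x := by rw [g.symm_apply_apply, ψ.map_add]
  map_zero' x := by rw [ψ.map_zero_apply, g.apply_symm_apply]

section Centralizer

variable {M : Type*} [MetricSpace M] [CompactSpace M]
  [ChartedSpace (EuclideanSpace ℝ (Fin 3)) M] [IsManifold (𝓡 3) ∞ M] {f : M ≃ₘ⟮𝓡 3, 𝓡 3⟯ M}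

/-- A homeomorphism that commutes with `f` maps orbits into orbits: the conjugate flow also moves
points to their images by `f` in positive time, so that its orbits lie in the center leaves. -/
lemma map_flow_mem_orbit (W : CenterFoliations f) {ψ : Flow ℝ M} (hA : IsTopologicalAnosovFlow ψ)
    {h : M → ℝ} (hc : Continuous h) (hpos : ∀ x, 0 < h x) (hψ : ∀ x, f x = ψ (h x) x) {g : M ≃ₜ M}
    (hg : Function.Commute g f) (y : M) (t : ℝ) : g (ψ t y) ∈ ψ.orbit (g y) := by
  have h1 := orbit_subset_centerLeaf W (ψ := conjFlow g ψ) (h := fun x ↦ h (g.symm x))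
    (hc.comp g.symm.continuous) (fun x ↦ hpos _) (fun x ↦ by
      change f x = g (ψ (h (g.symm x)) (g.symm x))
      rw [← hψ, hg.eq, g.apply_symm_apply]) (g y) t
  rw [centerLeaf_eq_orbit W hA hc hpos hψ] at h1
  have h2 : conjFlow g ψ t (g y) = g (ψ t (g.symm (g y))) := rfl
  rwa [h2, g.symm_apply_apply] at h1

end Centralizer

end DiscretizedAnosov

theorem mainTheorem7 {M : Type*} [MetricSpace M] [CompactSpace M] [ConnectedSpace M]
    [ChartedSpace (EuclideanSpace ℝ (Fin 3)) M] [IsManifold (𝓡 3) ∞ M]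
    (f : M ≃ₘ⟮𝓡 3, 𝓡 3⟯ M) (hf : DiscretizedAnosov.IsDiscretizedAnosovFlow f)
    (W : DiscretizedAnosov.CenterFoliations f)
    (g : M ≃ₘ^1⟮𝓡 3, 𝓡 3⟯ M) (hg : g ∈ DiscretizedAnosov.centralizer f)
    (x : M) (hx : IsCompact (W.centerLeaf x)) :
    ∃ k : ℕ, 1 ≤ k ∧ g^[k] '' W.centerLeaf x = W.centerLeaf x := by
  obtain ⟨-, ψ, hA, h, hc, hpos, hψ⟩ := hf
  have hcomm : Function.Commute g.toHomeomorph f := hg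
  have hcomm' : Function.Commute g.toHomeomorph.symm f := fun y ↦ by
    rw [Homeomorph.symm_apply_eq, hcomm.eq, Homeomorph.apply_symm_apply]
  have horb := DiscretizedAnosov.image_orbit_eq
    (DiscretizedAnosov.map_flow_mem_orbit W hA hc hpos hψ hcomm)
    (DiscretizedAnosov.map_flow_mem_orbit W hA hc hpos hψ hcomm')
  rw [DiscretizedAnosov.centerLeaf_eq_orbit W hA hc hpos hψ] at hx ⊢
  exact DiscretizedAnosov.exists_iterate_image_orbit_eq hA.expansive hc hpos hψ hcomm horb hx
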